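/- **Setting.** Consider a chain of $N$ sites $1,\dots,N$; site $i$ carries a finite-dimensional Hilbert space, and $\|\cdot\|$ is the operator norm on the tensor product. Let $R\ge 1$ be an integer and $h,T>0$; put $\omega=2\pi/T$. Let $H(t)=H_0+V(t)$, $H_0=\sum_i H_i$, $V(t)=\sum_i V_i(t)$, where $H_i,V_i(t)$ act nontrivially only on the sites $i,\dots,i+R-1$ of the chain, $\|H_i\|\le h$, $\|V_i(t)\|\le h$ for all $t$, $V_i$ is measurable in $t$, $H_0$ and $V(t)$ are Hermitian, $V(t+T)=V(t)$ and $\int_0^T V(t)\,dt=0$. Put $G^{(0)}=H$, and for $q\ge 0$ $$\bar H^{(q)}=\frac1T\int_0^T G^{(q)}(t)\,dt,\qquad V^{(q)}=G^{(q)}-\bar H^{(q)},\qquad \Omega_{q+1}(t)=-i\int_0^t V^{(q)}(s)\,ds,$$ where for $q\ge1$, with $\mathrm{ad}_AB=[A,B]$ and $\partial_t\Omega_m=-iV^{(m-1)}$, $$G^{(q)}=\sum_{k=1}^{q}\frac{(-1)^k}{k!}\sum_{\substack{i_1,\dots,i_k\ge1\\ i_1+\dots+i_k=q}}\mathrm{ad}_{\Omega_{i_1}}\cdots\mathrm{ad}_{\Omega_{i_k}}H+i\sum_{m=1}^{q}\sum_{k=1}^{q+1-m}\frac{(-1)^{k+1}}{(k+1)!}\sum_{\substack{i_1,\dots,i_k\ge1\\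 i_1+\dots+i_k=q+1-m}}\mathrm{ad}_{\Omega_{i_1}}\cdots\mathrm{ad}_{\Omega_{i_k}}\partial_t\Omega_m .$$ For an integer $n\ge0$ let $Q(t)=\exp\big(\sum_{p=1}^{n}\Omega_p(t)\big)$, $H'(t)=Q^\dagger HQ-iQ^\dagger\partial_tQ$, $H_*=H_0+\sum_{1\le q<n}\bar H^{(q)}$ and $\delta H'(t)=H'(t)-H_*$. For $\kappa>0$ and a decomposition $A=\sum_I A_I$ over nonempty intervals $I$ of sites, with $A_I$ supported on $I$, put $\|A\|_\kappa=\sup_i\sum_{I\ni i}\|A_I\|e^{\kappa|I|}$. For a sum $B=\sum_iB_i$ of local terms put $\|B\|_l=\sup_i\|B_i\|$; it has range $m$ if each $B_i$ is supported on $\{i,\dots,i+m-1\}$. **Theorem.** There are universal constants $C_0,C_1>0$ such that for all $R\ge1$, $\kappa,r_0>0$ and all $r$ with $r-r_0>1+\log(C_1R)+R\kappa$ there are $C,c>0$, depending only on $R,\kappa,r_0,r$ (and not on $h$, $T$, $N$, the dimensions of the sites or the Hamiltonian), for which the following holds for every $H(t)$ as above, with $$n=n_*=\Big\lfloor \frac{e^{-r}}{C_0\,e\,R\,h\,T}\Big\rfloor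 .$$ 1. $Q(t)$ is unitary and $T$-periodic, and $Q(0)=1$. 2. $H_*$ is Hermitian, and each $\bar H^{(q)}$, $1\le q<n_*$, can be written as a sum of local terms of range $R(q+1)$ in such a way that $\|H_*-H_0\|\le N\sum_{1\le q<n_*}\|\bar H^{(q)}\|_l$ and $\sum_{1\le q<n_*}\|\bar H^{(q)}\|_l\le Ch$. 3. For almost every $t$, and for every $t$ at which $V$ is continuous, $Q$ is differentiable at $t$, $H'(t)=H_*+\delta H'(t)$, and $\delta H'(t)$ has an interval decomposition for which $$\|\delta H'(t)\|_\kappa\le Ch\,e^{-r_0n_*}\qquad\text{and}\qquad \|\delta H'(t)\|_\kappa\le Ch\,e^{-c\,\omega/h}.$$ 4. (Heating time.) Let $U$ be the evolution generated by $H$ ($i\partial_tU=HU$, $U(0)=1$, in integrated form). Then $W=Q^\dagger U$ is the evolution generated by $H'$, for all $s\le t$ $$\frac1N\big\|W(t)^\dagger H_*W(t)-W(s)^\dagger H_*W(s)\big\|\le Ch^2e^{-r_0n_*}(t-s),$$ and for all $0\le t\le\tau_*:=h^{-1}e^{c\,\omega/h}$ $$\frac1N\big\|W(t)^\dagger H_*W(t)-H_*\big\|\le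 Ch\,e^{-c\,\omega/h}.$$ -/

import Mathlib

open scoped Matrix.Norms.L2Operator

noncomputable section

namespace Floquet

/-- Operators of a chain of `N` sites whose site `i` carries the Hilbert space `ℂ^(d i)`: matrices
in the product basis of the tensor product. Their norm `‖A‖` is the (Euclidean) operator norm. -/
abbrev Op {N : ℕ} (d : Fin N → ℕ) : Type :=
  Matrix (∀ i, Fin (d i)) (∀ i, Fin (d i)) ℂ

/-- `A` acts nontrivially only on the sites in `S`: it is `B ⊗ 1` with `B` an operator on the
sites in `S` and `1` the identity on the remaining sites. -/
def SupportedOn {N : ℕ} {d : Fin N → ℕ} (S : Finset (Fin N)) (A : Op d) : Prop :=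
  ∃ B : Matrix (∀ j : S, Fin (d j)) (∀ j : S, Fin (d j)) ℂ,
    ∀ x y, A x y = if ∀ j, j ∉ S → x j = y j then B (fun j => x j) (fun j => y j) else 0

/-- The sites `i, i+1, …, i+m-1` (those of them that belong to the chain). -/
def window {N : ℕ} (i : Fin N) (m : ℕ) : Finset (Fin N) :=
  Finset.univ.filter fun j => i.val ≤ j.val ∧ j.val < i.val + m

/-- `A = ∑ i, B i`, each `B i` acting nontrivially only on `i, …, i+m-1` (`m` is the range). -/
def IsLocalSum {N : ℕ} {d : Fin N → ℕ} (m : ℕ) (A : Op d) (B : Fin N → Op d) : Prop :=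
  (∀ i, SupportedOn (window i m) (B i)) ∧ A = ∑ i, B i

/-- The local norm `‖A‖_l = sup_i ‖B i‖` of an operator given as a sum of local terms. -/
def localNorm {N : ℕ} {d : Fin N → ℕ} (B : Fin N → Op d) : ℝ := ⨆ i, ‖B i‖

/-- `A = ∑ A_I` over nonempty intervals `I = [a, b]` of sites, with `A_I = Φ a b` acting
nontrivially only on `I` (values of `Φ a b` for `b < a` play no role). -/
def IsIntervalSum {N : ℕ} {d : Fin N → ℕ} (A : Op d) (Φ : Fin N → Fin N → Op d) : Prop :=
  (∀ a b, a ≤ b → SupportedOn (Finset.Icc a b) (Φ a b)) ∧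
    A = ∑ a, ∑ b ∈ Finset.Ici a, Φ a b

/-- The weighted norm `‖A‖_κ = sup_i ∑_{I ∋ i} ‖A_I‖ exp (κ |I|)`, where `I = [a, b]` with
`a ≤ i ≤ b` and `|I|` is the number of sites of `I`. -/
def weightedNorm {N : ℕ} {d : Fin N → ℕ} (κ : ℝ) (Φ : Fin N → Fin N → Op d) : ℝ :=
  ⨆ i, ∑ a ∈ Finset.Iic i, ∑ b ∈ Finset.Ici i,
    ‖Φ a b‖ * Real.exp (κ * ((Finset.Icc a b).card : ℝ))

/-- A periodically driven chain: static local terms `stat i` and driving local terms `drv i t` of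
range `R` and strength at most `h`, with total Hamiltonian Hermitian, and total drive
`T`-periodic with zero time average. -/
structure DrivenChain {N : ℕ} (d : Fin N → ℕ) (R : ℕ) (h T : ℝ) where
  stat : Fin N → Op d
  drv : Fin N → ℝ → Op d
  stat_supp : ∀ i, SupportedOn (window i R) (stat i)
  drv_supp : ∀ i t, SupportedOn (window i R) (drv i t)
  norm_stat_le : ∀ i, ‖stat i‖ ≤ h
  norm_drv_le : ∀ i t, ‖drv i t‖ ≤ h
  drv_meas : ∀ i, MeasureTheory.AEStronglyMeasurable (drv i) MeasureTheory.volume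
  stat_herm : (∑ i, stat i).IsHermitian
  drv_herm : ∀ t, (∑ i, drv i t).IsHermitian
  drv_periodic : Function.Periodic (fun t => ∑ i, drv i t) T
  drv_mean : ∫ t in (0 : ℝ)..T, ∑ i, drv i t = 0

/-- The static part `H_0 = ∑ i, H_i`. -/
def DrivenChain.H0 {N : ℕ} {d : Fin N → ℕ} {R : ℕ} {h T : ℝ} (E : DrivenChain d R h T) : Op d :=
  ∑ i, E.stat i

/-- The drive `V(t) = ∑ i, V_i(t)`. -/
def DrivenChain.V {N : ℕ} {d : Fin N → ℕ} {R : ℕ} {h T : ℝ} (E : DrivenChain d R h T)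
    (t : ℝ) : Op d :=
  ∑ i, E.drv i t

/-- The Hamiltonian `H(t) = H_0 + V(t)`. -/
def DrivenChain.H {N : ℕ} {d : Fin N → ℕ} {R : ℕ} {h T : ℝ} (E : DrivenChain d R h T)
    (t : ℝ) : Op d :=
  E.H0 + E.V t

/-- The time average `T⁻¹ ∫_0^T F`. -/
def timeAvg {N : ℕ} {d : Fin N → ℕ} (T : ℝ) (F : ℝ → Op d) : Op d :=
  T⁻¹ • ∫ t in (0 : ℝ)..T, F t

/-- The zero-average part `F(t) - T⁻¹ ∫_0^T F`. -/
def oscPart {N : ℕ} {d : Fin N → ℕ} (T : ℝ) (F : ℝ → Op d) (t : ℝ) : Op d :=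
  F t - timeAvg T F

/-- For a sequence `G = (G^(0), G^(1), …)`: the generator `Ω_p(t) = -i ∫_0^t V^(p-1)(s) ds`,
`p ≥ 1`, where `V^(p-1)` is the zero-average part of `G^(p-1)`. -/
def omegaOf {N : ℕ} {d : Fin N → ℕ} (T : ℝ) (G : ℕ → ℝ → Op d) (p : ℕ) (t : ℝ) : Op d :=
  (-Complex.I) • ∫ s in (0 : ℝ)..t, oscPart T (G (p - 1)) s

/-- The time derivative `∂_t Ω_p(t) = -i V^(p-1)(t)`. -/
def domegaOf {N : ℕ} {d : Fin N → ℕ} (T : ℝ) (G : ℕ → ℝ → Op d) (p : ℕ) (t : ℝ) : Op d :=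
  (-Complex.I) • oscPart T (G (p - 1)) t

/-- The nested commutator `ad_{A 0} ad_{A 1} … ad_{A (k-1)} X`, with `ad_A X = A X - X A`. -/
def nestedComm {N : ℕ} {d : Fin N → ℕ} : (k : ℕ) → (Fin k → Op d) → Op d → Op d
  | 0, _, X => X
  | k + 1, A, X => ⁅A 0, nestedComm k (fun j => A j.succ) X⁆

/-- The sum over `i_1, …, i_k ≥ 1` with `i_1 + … + i_k = M` of
`ad_{W i_1} … ad_{W i_k} X`. -/
def nestedSum {N : ℕ} {d : Fin N → ℕ} (W : ℕ → Op d) (k M : ℕ) (X : Op d) : Op d :=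
  ∑ i ∈ (Finset.Nat.antidiagonalTuple k M).filter (fun i => ∀ j, 1 ≤ i j),
    nestedComm k (fun j => W (i j)) X

/-- The right-hand side of the recursion for `G^(q)`, `q ≥ 1`. It involves only
`G^(0), …, G^(q-1)`. -/
def nextG {N : ℕ} {d : Fin N → ℕ} (T : ℝ) (H : ℝ → Op d) (G : ℕ → ℝ → Op d) (q : ℕ) (t : ℝ) :
    Op d :=
  ∑ k ∈ Finset.Icc 1 q, ((-1 : ℂ) ^ k / (k.factorial : ℂ)) •
      nestedSum (fun p => omegaOf T G p t) k q (H t) +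
  Complex.I • ∑ m ∈ Finset.Icc 1 q, ∑ k ∈ Finset.Icc 1 (q + 1 - m),
    ((-1 : ℂ) ^ (k + 1) / ((k + 1).factorial : ℂ)) •
      nestedSum (fun p => omegaOf T G p t) k (q + 1 - m) (domegaOf T G m t)

/-- Table of `G^(0), …, G^(n)`. -/
def tableG {N : ℕ} {d : Fin N → ℕ} (T : ℝ) (H : ℝ → Op d) : ℕ → ℕ → ℝ → Op d
  | 0 => fun _ => H
  | n + 1 => Function.update (tableG T H n) (n + 1) (nextG T H (tableG T H n) (n + 1))

/-- The operators `G^(q)(t)`: `G^(0) = H`, and `G^(q)` is given by `nextG` for `q ≥ 1`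
(see `opG_zero`, `opG_eq`). -/
def opG {N : ℕ} {d : Fin N → ℕ} (T : ℝ) (H : ℝ → Op d) (q : ℕ) : ℝ → Op d :=
  tableG T H q q

/-- `Ω_p(t)`. -/
def omega {N : ℕ} {d : Fin N → ℕ} (T : ℝ) (H : ℝ → Op d) (p : ℕ) (t : ℝ) : Op d :=
  omegaOf T (opG T H) p t

/-- The time-independent part `H̄^(q)` of `G^(q)`. -/
def Hbar {N : ℕ} {d : Fin N → ℕ} (T : ℝ) (H : ℝ → Op d) (q : ℕ) : Op d :=
  timeAvg T (opG T H q)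

/-- `Q(t) = exp (Ω_1(t) + … + Ω_n(t))`. -/
def Q {N : ℕ} {d : Fin N → ℕ} (T : ℝ) (H : ℝ → Op d) (n : ℕ) (t : ℝ) : Op d :=
  NormedSpace.exp (∑ p ∈ Finset.Icc 1 n, omega T H p t)

/-- The transformed Hamiltonian `H'(t) = Q† H Q - i Q† ∂_t Q`. -/
def Hprime {N : ℕ} {d : Fin N → ℕ} (T : ℝ) (H : ℝ → Op d) (n : ℕ) (t : ℝ) : Op d :=
  star (Q T H n t) * H t * Q T H n t - Complex.I • (star (Q T H n t) * deriv (Q T H n) t)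

/-- The effective Hamiltonian `H_* = H_0 + ∑_{1 ≤ q < n} H̄^(q)`. -/
def DrivenChain.Hstar {N : ℕ} {d : Fin N → ℕ} {R : ℕ} {h T : ℝ} (E : DrivenChain d R h T)
    (n : ℕ) : Op d :=
  E.H0 + ∑ q ∈ Finset.Ico 1 n, Hbar T E.H q

/-- The remaining drive `δH'(t) = H'(t) - H_*`. -/
def DrivenChain.deltaH {N : ℕ} {d : Fin N → ℕ} {R : ℕ} {h T : ℝ} (E : DrivenChain d R h T)
    (n : ℕ) (t : ℝ) : Op d :=
  Hprime T E.H n t - E.Hstar n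

/-- `U` is the evolution generated by `H`: `i ∂_t U = H U`, `U(0) = 1`, in integrated form. -/
def IsPropagator {N : ℕ} {d : Fin N → ℕ} (H U : ℝ → Op d) : Prop :=
  Continuous U ∧ ∀ t, IntervalIntegrable (fun s => H s * U s) MeasureTheory.volume 0 t ∧
    U t = 1 - Complex.I • ∫ s in (0 : ℝ)..t, H s * U s

/-- The order `n_* = e^{-r} / (C₀ e R h T)`, rounded down. -/
def nStar (C₀ r : ℝ) (R : ℕ) (h T : ℝ) : ℕ :=
  ⌊Real.exp (-r) / (C₀ * Real.exp 1 * R * h * T)⌋₊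

/-! The recursion satisfied by `opG`. -/

theorem tableG_stable {N : ℕ} {d : Fin N → ℕ} (T : ℝ) (H : ℝ → Op d) (j n : ℕ) (hj : j ≤ n) :
    tableG T H n j = opG T H j := by
  induction n, hj using Nat.le_induction with
  | base => rfl
  | succ n hn ih =>
    rw [tableG, Function.update_of_ne (by omega), ih]

theorem nestedSum_congr {N : ℕ} {d : Fin N → ℕ} (W W' : ℕ → Op d) (k M : ℕ) (X : Op d)
    (hW : ∀ p, 1 ≤ p → p ≤ M → W p = W' p) : nestedSum W k M X = nestedSum W' k M X := by
  unfold nestedSum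
  refine Finset.sum_congr rfl fun i hi => ?_
  rw [Finset.mem_filter, Finset.Nat.mem_antidiagonalTuple] at hi
  congr 1
  funext j
  refine hW _ (hi.2 j) ?_
  rw [← hi.1]
  exact Finset.single_le_sum (f := i) (fun _ _ => Nat.zero_le _) (Finset.mem_univ j)

theorem nextG_congr {N : ℕ} {d : Fin N → ℕ} (T : ℝ) (H : ℝ → Op d) (G G' : ℕ → ℝ → Op d)
    (q : ℕ) (hG : ∀ j, j < q → G j = G' j) : nextG T H G q = nextG T H G' q := by
  funext t
  have hom : ∀ p, 1 ≤ p → p ≤ q → omegaOf T G p t = omegaOf T G' p t := fun p h1 h2 => by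
    unfold omegaOf
    rw [hG (p - 1) (by omega)]
  unfold nextG
  congr 1
  · refine Finset.sum_congr rfl fun k _ => ?_
    rw [nestedSum_congr _ _ _ _ _ hom]
  · congr 1
    refine Finset.sum_congr rfl fun m hm => Finset.sum_congr rfl fun k _ => ?_
    rw [Finset.mem_Icc] at hm
    have hd : domegaOf T G m t = domegaOf T G' m t := by
      unfold domegaOf
      rw [hG (m - 1) (by omega)]
    rw [hd, nestedSum_congr _ _ _ _ _ fun p h1 h2 => hom p h1 (by omega)]

theorem opG_zero {N : ℕ} {d : Fin N → ℕ} (T : ℝ) (H : ℝ → Op d) : opG T H 0 = H := rfl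

theorem opG_eq {N : ℕ} {d : Fin N → ℕ} (T : ℝ) (H : ℝ → Op d) (q : ℕ) (hq : 1 ≤ q) :
    opG T H q = nextG T H (opG T H) q := by
  obtain ⟨n, rfl⟩ : ∃ n, q = n + 1 := ⟨q - 1, by omega⟩
  have h1 : opG T H (n + 1) = nextG T H (tableG T H n) (n + 1) := by
    rw [opG, tableG, Function.update_self]
  rw [h1]
  exact nextG_congr T H _ _ _ fun j hj => tableG_stable T H j n (by omega)

end Floquet

end

/-!
The rotated Hamiltonian `H' = Q† H Q - i Q† ∂_t Q` with `Q = exp Ω`, `Ω = Ω_1 + … + Ω_n`, is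
expanded in the order `k` of the generator (`hasSum_exp_conj`, `hasDerivAt_exp_curve`) and in the
degree `q`, for which `Ω_p` has degree `p`, `H` has degree `0` and `∂_t Ω_p` has degree `p - 1`.
The recursion for `G^(q)` collects all terms of degree `q` except for `∂_t Ω_{q+1}`, and
`∂_t Ω_{q+1} = -i V^(q)` removes the oscillating part. So the part of `H'` of degree below `n` is
exactly `H_*`, and `δH'` consists of the terms of degree at least `n` (`hasSum_frameOp_of_lt`,
`DrivenChain.hasSum_deltaH`). For `n = 0` it is the drive itself.

The components of degree `q` of `H` and `∂_t Ω` are sums of local terms of range `R (q + 1)`, and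
`Ω_p` is one of range `R p`. A commutator adds the ranges, for an explicit distribution of the
commutators of local terms over the sites (`localBracket`), so that all terms of degree `q` have
range `R (q + 1)`. The local norm of a commutator is bounded by a numerical bracket of local
norms, and the local norm of `G^(q)` by a numerical sequence `γ q` that solves the recursion with
numerical brackets (`IsLocalRep`, `DrivenChain.exists_isLocalRep`). The norm of a commutator costs
a factor proportional to the range, hence to the degree. With the order `n` fixed, a `k`-fold
commutator has degree below `n (k + 1)`, so that these factors amount to at most `n ^ k (k + 1)!`
up to a constant to the power `k`; the factorial is compensated by the coefficients of the
exponential series, and `n ^ k` by the smallness of `n h T`, which is what the choice of `n_*`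
provides (`sum_iterBracket_num_le`, `sum_majTerm_le`). An induction on the degree then closes the
estimate `∑_{q ≤ n} e^{r q} γ q ≤ 4 h` (`sum_majorant_le`).

A sum of local terms of range `m` is an interval decomposition of weighted norm at most
`m e^{κ m}` times its local norm. The weight `e^{r q}` absorbs this factor for `m = R (q + 1)` and
leaves `e^{-r₀ q} ≤ e^{-r₀ n}` for the degrees `q ≥ n` (`range_mul_exp_le`,
`DrivenChain.deltaH_hasIntervalBound`).

As `H' = H_* + δH'`, the operator `W† H_* W` moves at the rate `‖[δH', H_*]‖`, which is extensive
with the same exponentially small factor (`DrivenChain.norm_lie_Hstar_le`, `norm_conj_sub_le`).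
The drive is only measurable in time: `Q` and the evolutions are locally Lipschitz, their
derivatives exist almost everywhere, and a locally Lipschitz function is controlled by its
derivative almost everywhere (`norm_sub_le_of_locallyLipschitz`).
-/

open scoped Matrix.Norms.L2Operator

noncomputable section

namespace Floquet

open MeasureTheory

/-! ### Exponentials, conjugation and the derivative along a curve -/

section Exponential

theorem norm_lie_le_two_mul {A : Type*} [NormedRing A] (x y : A) : ‖⁅x, y⁆‖ ≤ 2 * ‖x‖ * ‖y‖ := by
  rw [Ring.lie_def]
  calc ‖x * y - y * x‖ ≤ ‖x * y‖ + ‖y * x‖ := norm_sub_le _ _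
    _ ≤ ‖x‖ * ‖y‖ + ‖y‖ * ‖x‖ := add_le_add (norm_mul_le _ _) (norm_mul_le _ _)
    _ = 2 * ‖x‖ * ‖y‖ := by ring

theorem norm_iterate_lie_le {A : Type*} [NormedRing A] (x y : A) (k : ℕ) :
    ‖(fun z => ⁅x, z⁆)^[k] y‖ ≤ (2 * ‖x‖) ^ k * ‖y‖ := by
  induction k with
  | zero => simp
  | succ k ih =>
    rw [Function.iterate_succ_apply']
    calc _ ≤ 2 * ‖x‖ * ‖(fun z => ⁅x, z⁆)^[k] y‖ := norm_lie_le_two_mul _ _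
      _ ≤ 2 * ‖x‖ * ((2 * ‖x‖) ^ k * ‖y‖) := by gcongr
      _ = _ := by ring

variable {A : Type*} [NormedRing A] [NormedAlgebra ℂ A] [CompleteSpace A]

/-- Conjugation by an exponential is the exponential of the adjoint action, because left and right
multiplication by `x` commute. -/
theorem hasSum_exp_conj (x y : A) :
    HasSum (fun k : ℕ => ((-1 : ℂ) ^ k / (k.factorial : ℂ)) • (fun z => ⁅x, z⁆)^[k] y)
      (NormedSpace.exp (-x) * y * NormedSpace.exp x) := by
  let : NormedAlgebra ℚ A := NormedAlgebra.restrictScalars ℚ ℂ A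
  let : NormedAlgebra ℚ (A →L[ℂ] A) := NormedAlgebra.restrictScalars ℚ ℂ (A →L[ℂ] A)
  let L : A →L[ℂ] A := ContinuousLinearMap.mul ℂ A (-x)
  let M : A →L[ℂ] A := (ContinuousLinearMap.mul ℂ A).flip x
  have hLp : ∀ (k : ℕ) z, (L ^ k) z = (-x) ^ k * z := fun k => by
    induction k with
    | zero => intro z; simp
    | succ k ih =>
      intro z
      rw [pow_succ, mul_apply_eq_comp, ih, pow_succ, mul_assoc]
      rfl
  have hMp : ∀ (k : ℕ) z, (M ^ k) z = z * x ^ k := fun k => by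
    induction k with
    | zero => intro z; simp
    | succ k ih =>
      intro z
      rw [pow_succ, mul_apply_eq_comp, ih, pow_succ', ← mul_assoc]
      rfl
  have hL : ∀ z, NormedSpace.exp L z = NormedSpace.exp (-x) * z := fun z => by
    have h1 := (NormedSpace.exp_series_hasSum_exp' (𝕂 := ℂ) L).mapL
      (ContinuousLinearMap.apply ℂ A z)
    have h2 := (NormedSpace.exp_series_hasSum_exp' (𝕂 := ℂ) (-x)).mul_right z
    refine h1.unique (h2.congr_fun fun k => ?_)
    simp [hLp]
  have hM : ∀ z, NormedSpace.exp M z = z * NormedSpace.exp x := fun z => by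
    have h1 := (NormedSpace.exp_series_hasSum_exp' (𝕂 := ℂ) M).mapL
      (ContinuousLinearMap.apply ℂ A z)
    have h2 := (NormedSpace.exp_series_hasSum_exp' (𝕂 := ℂ) x).mul_left z
    refine h1.unique (h2.congr_fun fun k => ?_)
    simp [hMp]
  have hc : Commute L M := by
    ext z
    change (-x) * (z * x) = ((-x) * z) * x
    rw [mul_assoc]
  have hs := (NormedSpace.exp_series_hasSum_exp' (𝕂 := ℂ) (L + M)).mapL
    (ContinuousLinearMap.apply ℂ A y)
  rw [NormedSpace.exp_add_of_commute hc] at hs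
  have hv : (ContinuousLinearMap.apply ℂ A y) (NormedSpace.exp L * NormedSpace.exp M)
      = NormedSpace.exp (-x) * y * NormedSpace.exp x := by
    change NormedSpace.exp L (NormedSpace.exp M y) = _
    rw [hL, hM, mul_assoc]
  rw [hv] at hs
  refine hs.congr_fun fun k => ?_
  have hk : ((L + M) ^ k) y = (-1 : ℂ) ^ k • (fun z => ⁅x, z⁆)^[k] y := by
    induction k with
    | zero => simp
    | succ k ih =>
      rw [pow_succ', mul_apply_eq_comp, ih, Function.iterate_succ_apply', pow_succ',
        mul_smul, map_smul, smul_comm]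
      congr 1
      change (-x) * _ + _ * x = _
      rw [Ring.lie_def]
      simp
      abel
  change _ = (ContinuousLinearMap.apply ℂ A y) (((k.factorial : ℂ)⁻¹) • (L + M) ^ k)
  rw [map_smul, ContinuousLinearMap.apply_apply, hk, smul_smul]
  congr 1
  rw [div_eq_mul_inv, mul_comm]

/-- Duhamel's formula for the difference quotient of the exponential. -/
theorem exp_neg_mul_exp_add_smul (x y : A) (ε : ℝ) :
    NormedSpace.exp (-x) * NormedSpace.exp (x + ε • y) = 1 + ε • ∫ s in (0 : ℝ)..1,
      NormedSpace.exp (s • (-x)) * y * NormedSpace.exp (s • (x + ε • y)) := by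
  let : NormedAlgebra ℚ A := NormedAlgebra.restrictScalars ℚ ℂ A
  have hd : ∀ s : ℝ, HasDerivAt
      (fun s : ℝ => NormedSpace.exp (s • (-x)) * NormedSpace.exp (s • (x + ε • y)))
      (ε • (NormedSpace.exp (s • (-x)) * y * NormedSpace.exp (s • (x + ε • y)))) s := fun s => by
    refine ((hasDerivAt_exp_smul_const (𝕂 := ℝ) (-x) s).mul
      (hasDerivAt_exp_smul_const' (𝕂 := ℝ) (x + ε • y) s)).congr_deriv ?_
    simp only [mul_add, add_mul, mul_assoc, smul_mul_assoc, mul_smul_comm, neg_mul, mul_neg]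
    abel
  have hc : Continuous fun s : ℝ =>
      ε • (NormedSpace.exp (s • (-x)) * y * NormedSpace.exp (s • (x + ε • y))) := by
    fun_prop
  have h := intervalIntegral.integral_eq_sub_of_hasDerivAt (fun s _ => hd s)
    (hc.intervalIntegrable 0 1)
  rw [intervalIntegral.integral_smul] at h
  rw [h]
  simp

/-- The derivative of the exponential along a differentiable curve. -/
theorem hasDerivAt_exp_curve {Ω : ℝ → A} {D : A} {t : ℝ} (hΩ : HasDerivAt Ω D t) :
    ∃ K, HasDerivAt (fun s => NormedSpace.exp (Ω s)) (NormedSpace.exp (Ω t) * K) t ∧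
      HasSum (fun k : ℕ => ((-1 : ℂ) ^ k / ((k + 1).factorial : ℂ)) •
        (fun z => ⁅Ω t, z⁆)^[k] D) K := by
  let : NormedAlgebra ℚ A := NormedAlgebra.restrictScalars ℚ ℂ A
  set x := Ω t with hx
  let f : ℝ → ℝ → A := fun ε s =>
    NormedSpace.exp (s • (-x)) * D * NormedSpace.exp (s • (x + ε • D))
  have hfc : Continuous f.uncurry := by
    simp only [f, Function.uncurry_def]
    fun_prop
  have hKc : Continuous fun ε => ∫ s in (0 : ℝ)..1, f ε s :=
    intervalIntegral.continuous_parametric_intervalIntegral_of_continuous' hfc 0 1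
  refine ⟨∫ s in (0 : ℝ)..1, f 0 s, ?_, ?_⟩
  · -- the derivative exists since the exponential is analytic; it is read off along a line
    have hex : DifferentiableAt ℝ (NormedSpace.exp : A → A) x :=
      (NormedSpace.exp_analytic (𝕂 := ℝ) x).differentiableAt
    have h1 : HasDerivAt (fun s => NormedSpace.exp (Ω s))
        (fderiv ℝ (NormedSpace.exp : A → A) x D) t :=
      hex.hasFDerivAt.comp_hasDerivAt t hΩ
    have hline : HasDerivAt (fun ε : ℝ => x + ε • D) D 0 := by
      simpa using ((hasDerivAt_id (0 : ℝ)).smul_const D).const_add x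
    have h2 : HasDerivAt (fun ε : ℝ => NormedSpace.exp (x + ε • D))
        (fderiv ℝ (NormedSpace.exp : A → A) x D) 0 := by
      have hex' : HasFDerivAt (NormedSpace.exp : A → A) (fderiv ℝ (NormedSpace.exp : A → A) x)
          (x + (0 : ℝ) • D) := by simpa using hex.hasFDerivAt
      exact hex'.comp_hasDerivAt 0 hline
    have h3 : HasDerivAt (fun ε : ℝ => NormedSpace.exp (-x) * NormedSpace.exp (x + ε • D))
        (∫ s in (0 : ℝ)..1, f 0 s) 0 := by
      have he : (fun ε : ℝ => NormedSpace.exp (-x) * NormedSpace.exp (x + ε • D))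
          = fun ε : ℝ => 1 + ε • ∫ s in (0 : ℝ)..1, f ε s := by
        funext ε
        exact exp_neg_mul_exp_add_smul x D ε
      rw [he]
      rw [hasDerivAt_iff_tendsto_slope_zero]
      have : Filter.Tendsto (fun ε => ∫ s in (0 : ℝ)..1, f ε s) (nhdsWithin 0 {0}ᶜ)
          (nhds (∫ s in (0 : ℝ)..1, f 0 s)) := (hKc.tendsto 0).mono_left nhdsWithin_le_nhds
      refine this.congr' ?_
      filter_upwards [self_mem_nhdsWithin] with ε hε
      simp only [zero_add, zero_smul, add_zero, add_sub_cancel_left]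
      rw [smul_smul, inv_mul_cancel₀ hε, one_smul]
    have h4 := (h2.const_mul (NormedSpace.exp (-x))).unique h3
    have h5 : fderiv ℝ (NormedSpace.exp : A → A) x D
        = NormedSpace.exp x * ∫ s in (0 : ℝ)..1, f 0 s := by
      rw [← h4, ← mul_assoc, ← NormedSpace.exp_add_of_commute (Commute.refl x).neg_right]
      simp
    rw [h5] at h1
    exact h1
  · have hterm : ∀ s : ℝ, HasSum (fun k : ℕ => ((-1 : ℂ) ^ k / (k.factorial : ℂ)) •
        s ^ k • (fun z => ⁅x, z⁆)^[k] D) (f 0 s) := fun s => by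
      have h := hasSum_exp_conj (s • x) D
      have hf0 : f 0 s = NormedSpace.exp (-(s • x)) * D * NormedSpace.exp (s • x) := by
        simp [f]
      rw [hf0]
      refine h.congr_fun fun k => ?_
      congr 1
      induction k with
      | zero => simp
      | succ k ih =>
        rw [Function.iterate_succ_apply', Function.iterate_succ_apply', ← ih, Ring.lie_def,
          Ring.lie_def, pow_succ']
        simp only [smul_mul_assoc, mul_smul_comm, mul_smul, smul_sub]
        rw [smul_comm (s ^ k) s]
    let F : ℕ → C(ℝ, A) := fun k => ⟨fun s => ((-1 : ℂ) ^ k / (k.factorial : ℂ)) •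
        s ^ k • (fun z => ⁅x, z⁆)^[k] D, by fun_prop⟩
    have hsum : Summable fun k : ℕ => ((2 * ‖x‖) ^ k / (k.factorial : ℝ)) * ‖D‖ :=
      (Real.summable_pow_div_factorial (2 * ‖x‖)).mul_right _
    have hint := intervalIntegral.hasSum_intervalIntegral_of_summable_norm (a := 0) (b := 1)
      (f := F) (by
        refine hsum.of_nonneg_of_le (fun _ => norm_nonneg _) fun k => ?_
        rw [ContinuousMap.norm_le _ (by positivity)]
        rintro ⟨s, hs⟩
        simp only [ContinuousMap.restrict_apply, F, ContinuousMap.coe_mk]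
        rw [norm_smul, norm_smul]
        have hs' : s ∈ Set.Icc (0 : ℝ) 1 := by simpa using hs
        have hs1 : ‖s ^ k‖ ≤ 1 := by
          rw [norm_pow, Real.norm_of_nonneg hs'.1]
          exact pow_le_one₀ hs'.1 hs'.2
        have hcoef : ‖((-1 : ℂ) ^ k / (k.factorial : ℂ))‖ = 1 / (k.factorial : ℝ) := by
          simp
        rw [hcoef]
        calc _ ≤ 1 / (k.factorial : ℝ) * (1 * ((2 * ‖x‖) ^ k * ‖D‖)) := by
              gcongr
              exact norm_iterate_lie_le _ _ _
          _ = _ := by ring)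
    have hval : ∀ s, ∑' k, F k s = f 0 s := fun s => (hterm s).tsum_eq
    simp only [hval] at hint
    refine hint.congr_fun fun k => ?_
    have : ∀ s : ℝ, F k s = s ^ k • (((-1 : ℂ) ^ k / (k.factorial : ℂ)) •
        (fun z => ⁅x, z⁆)^[k] D) := fun s => by
      simp only [F, ContinuousMap.coe_mk]
      rw [smul_comm]
    simp only [this]
    rw [intervalIntegral.integral_smul_const, integral_pow, ← Complex.coe_smul, smul_smul]
    congr 1
    rw [Nat.factorial_succ]
    push_cast
    have : (k.factorial : ℂ) ≠ 0 := by exact_mod_cast k.factorial_ne_zero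
    have : (k : ℂ) + 1 ≠ 0 := by exact_mod_cast k.succ_ne_zero
    field_simp
    simp

end Exponential

/-! ### Supports of operators and brackets of local families -/

section Support

open scoped Kronecker

variable {N : ℕ} {d : Fin N → ℕ}

/-- Supported operators are the operators `B ⊗ 1` of a Kronecker product. -/
theorem supportedOn_iff_kronecker {S : Finset (Fin N)} {A : Op d} :
    SupportedOn S A ↔
      ∃ B : Matrix (∀ j : {j // j ∈ S}, Fin (d j)) (∀ j : {j // j ∈ S}, Fin (d j)) ℂ,
      A = (B ⊗ₖ (1 : Matrix (∀ j : {j // j ∉ S}, Fin (d j))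
        (∀ j : {j // j ∉ S}, Fin (d j)) ℂ)).submatrix
        (Equiv.piEquivPiSubtypeProd (· ∈ S) fun i => Fin (d i))
        (Equiv.piEquivPiSubtypeProd (· ∈ S) fun i => Fin (d i)) := by
  refine exists_congr fun B => ?_
  rw [← Matrix.ext_iff]
  refine forall_congr' fun x => forall_congr' fun y => ?_
  rw [Matrix.submatrix_apply, Matrix.kroneckerMap_apply, Matrix.one_apply]
  simp only [Equiv.piEquivPiSubtypeProd_apply, mul_ite, mul_one, mul_zero, funext_iff,
    Subtype.forall]

theorem SupportedOn.mono {S S' : Finset (Fin N)} (h : S ⊆ S') {A : Op d} (hA : SupportedOn S A) :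
    SupportedOn S' A := by
  obtain ⟨B, hB⟩ := hA
  classical
  refine ⟨Matrix.of fun x y => if ∀ j : S', (j : Fin N) ∉ S → x j = y j then
    B (fun j => x ⟨j, h j.2⟩) (fun j => y ⟨j, h j.2⟩) else 0, fun x y => ?_⟩
  rw [hB, Matrix.of_apply]
  beta_reduce
  by_cases h1 : ∀ j, j ∉ S → x j = y j
  · rw [if_pos h1, if_pos fun j hj => h1 j fun hS => hj (h hS)]
    exact (if_pos fun (j : S') hj => h1 j hj).symm
  · rw [if_neg h1]
    by_cases h2 : ∀ j, j ∉ S' → x j = y j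
    · rw [if_pos h2, if_neg]
      intro h3
      refine h1 fun j hj => ?_
      by_cases hj' : j ∈ S'
      · exact h3 ⟨j, hj'⟩ hj
      · exact h2 j hj'
    · rw [if_neg h2]

theorem SupportedOn.mul {S : Finset (Fin N)} {A A' : Op d} (hA : SupportedOn S A)
    (hA' : SupportedOn S A') : SupportedOn S (A * A') := by
  rw [supportedOn_iff_kronecker] at *
  obtain ⟨B, rfl⟩ := hA
  obtain ⟨B', rfl⟩ := hA'
  exact ⟨B * B', by rw [Matrix.submatrix_mul_equiv, ← Matrix.mul_kronecker_mul, one_mul]⟩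

theorem SupportedOn.zero (S : Finset (Fin N)) : SupportedOn S (0 : Op d) :=
  ⟨0, fun x y => by simp⟩

theorem SupportedOn.add {S : Finset (Fin N)} {A A' : Op d} (hA : SupportedOn S A)
    (hA' : SupportedOn S A') : SupportedOn S (A + A') := by
  obtain ⟨B, hB⟩ := hA
  obtain ⟨B', hB'⟩ := hA'
  refine ⟨B + B', fun x y => ?_⟩
  rw [Matrix.add_apply, hB, hB']
  split_ifs <;> simp

theorem SupportedOn.smul {S : Finset (Fin N)} {A : Op d} (c : ℂ) (hA : SupportedOn S A) :
    SupportedOn S (c • A) := by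
  obtain ⟨B, hB⟩ := hA
  refine ⟨c • B, fun x y => ?_⟩
  rw [Matrix.smul_apply, hB]
  split_ifs <;> simp

/-- The operators supported on `S`, as a subspace. -/
def suppSubmodule (d : Fin N → ℕ) (S : Finset (Fin N)) : Submodule ℂ (Op d) where
  carrier := {A | SupportedOn S A}
  add_mem' := SupportedOn.add
  zero_mem' := SupportedOn.zero S
  smul_mem' c _ := SupportedOn.smul c

theorem SupportedOn.sum {ι : Type*} {S : Finset (Fin N)} (s : Finset ι) {A : ι → Op d}
    (hA : ∀ i ∈ s, SupportedOn S (A i)) : SupportedOn S (∑ i ∈ s, A i) :=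
  (suppSubmodule d S).sum_mem hA

theorem SupportedOn.sub {S : Finset (Fin N)} {A A' : Op d} (hA : SupportedOn S A)
    (hA' : SupportedOn S A') : SupportedOn S (A - A') :=
  (suppSubmodule d S).sub_mem hA hA'

theorem SupportedOn.real_smul {S : Finset (Fin N)} {A : Op d} (c : ℝ) (hA : SupportedOn S A) :
    SupportedOn S (c • A) := by
  rw [← Complex.coe_smul]
  exact hA.smul c

theorem SupportedOn.lie {S : Finset (Fin N)} {A A' : Op d} (hA : SupportedOn S A)
    (hA' : SupportedOn S A') : SupportedOn S ⁅A, A'⁆ := by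
  rw [Ring.lie_def]
  exact (hA.mul hA').sub (hA'.mul hA)

theorem SupportedOn.tsum {ι : Type*} {S : Finset (Fin N)} {A : ι → Op d}
    (hA : ∀ i, SupportedOn S (A i)) : SupportedOn S (∑' i, A i) := by
  by_cases hs : Summable A
  · have hc : IsClosed (suppSubmodule d S : Set (Op d)) := Submodule.closed_of_finiteDimensional _
    exact hc.mem_of_tendsto hs.hasSum
      (Filter.Eventually.of_forall fun s => (suppSubmodule d S).sum_mem fun i _ => hA i)
  · rw [tsum_eq_zero_of_not_summable hs]
    exact SupportedOn.zero S

/-- A subspace of a finite-dimensional space is an intersection of kernels of functionals, and these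
commute with the integral. -/
theorem SupportedOn.intervalIntegral {S : Finset (Fin N)} {f : ℝ → Op d}
    (hf : ∀ t, SupportedOn S (f t)) (a b : ℝ) : SupportedOn S (∫ t in a..b, f t) := by
  by_cases hi : IntervalIntegrable f volume a b
  · by_contra hx
    obtain ⟨φ, hφ, hp⟩ := Submodule.exists_le_ker_of_notMem (p := suppSubmodule d S) hx
    have h := (LinearMap.toContinuousLinearMap φ).intervalIntegral_comp_comm hi
    refine hφ ?_
    change (LinearMap.toContinuousLinearMap φ) _ = 0
    rw [← h]
    have h0 : ∀ t, (LinearMap.toContinuousLinearMap φ) (f t) = 0 := fun t => hp (hf t)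
    simp [h0]
  · rw [intervalIntegral.integral_undef hi]
    exact SupportedOn.zero S

/-- Operators with disjoint supports commute. -/
theorem SupportedOn.lie_eq_zero {S S' : Finset (Fin N)} (hd : Disjoint S S') {A A' : Op d}
    (hA : SupportedOn S A) (hA' : SupportedOn S' A') : ⁅A, A'⁆ = 0 := by
  have hA'' : SupportedOn Sᶜ A' := hA'.mono (Finset.subset_compl_iff_disjoint_left.mpr hd)
  rw [supportedOn_iff_kronecker] at hA
  obtain ⟨B, rfl⟩ := hA
  obtain ⟨B', hB'⟩ := hA''
  have h : A' = ((1 : Matrix (∀ j : {j // j ∈ S}, Fin (d j)) (∀ j : {j // j ∈ S}, Fin (d j)) ℂ) ⊗ₖ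
      (Matrix.of fun x y : ∀ j : {j // j ∉ S}, Fin (d j) =>
        B' (fun j => x ⟨j, Finset.mem_compl.mp j.2⟩)
          (fun j => y ⟨j, Finset.mem_compl.mp j.2⟩))).submatrix
        (Equiv.piEquivPiSubtypeProd (· ∈ S) fun i => Fin (d i))
        (Equiv.piEquivPiSubtypeProd (· ∈ S) fun i => Fin (d i)) := by
    ext x y
    rw [hB', Matrix.submatrix_apply, Matrix.kroneckerMap_apply, Matrix.one_apply]
    simp only [Equiv.piEquivPiSubtypeProd_apply, ite_mul, one_mul, zero_mul, funext_iff,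
      Subtype.forall, Finset.mem_compl, not_not, Matrix.of_apply]
  rw [h, Ring.lie_def, Matrix.submatrix_mul_equiv, Matrix.submatrix_mul_equiv,
    ← Matrix.mul_kronecker_mul, ← Matrix.mul_kronecker_mul]
  simp

theorem mem_window {i j : Fin N} {m : ℕ} :
    j ∈ window i m ↔ i.val ≤ j.val ∧ j.val < i.val + m := by
  simp [window]

theorem card_window_le (i : Fin N) (m : ℕ) : (window i m).card ≤ m := by
  calc (window i m).card ≤ (Finset.Ico i.val (i.val + m)).card :=
        Finset.card_le_card_of_injOn Fin.val (fun j hj => by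
          have := mem_window.mp hj
          simpa using this) (Fin.val_injective.injOn)
    _ = m := by simp

end Support

section LocalBracket

variable {N : ℕ} {d : Fin N → ℕ}

/-- The bracket of two families of local terms: the commutator of the `i`-th and the `j`-th term
is attributed to the site `min i j`. -/
def localBracket (A B : Fin N → Op d) (x : Fin N) : Op d :=
  ∑ j ∈ Finset.Ici x, ⁅A x, B j⁆ + ∑ i ∈ Finset.Ioi x, ⁅A i, B x⁆

theorem sum_localBracket (A B : Fin N → Op d) :
    ∑ x, localBracket A B x = ⁅∑ i, A i, ∑ j, B j⁆ := by
  have h : ⁅∑ i, A i, ∑ j, B j⁆ = ∑ i, ∑ j, ⁅A i, B j⁆ := by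
    simp only [Ring.lie_def, Finset.sum_sub_distrib, Finset.sum_mul_sum]
    congr 1
    exact Finset.sum_comm
  rw [h]
  simp only [localBracket, Finset.sum_add_distrib]
  have h2 : ∑ x, ∑ i ∈ Finset.Ioi x, ⁅A i, B x⁆ = ∑ i, ∑ x ∈ Finset.Iio i, ⁅A i, B x⁆ :=
    Finset.sum_comm' fun x y => by simp
  rw [h2, ← Finset.sum_add_distrib]
  refine Finset.sum_congr rfl fun i _ => ?_
  rw [← Finset.sum_union]
  · congr 1
    ext j
    simp [le_or_gt]
  · rw [Finset.disjoint_left]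
    intro j hj hj'
    exact absurd (Finset.mem_Ici.mp hj) (not_le.mpr (Finset.mem_Iio.mp hj'))

variable {A B : Fin N → Op d} {m m' : ℕ}

theorem lie_eq_zero_of_add_le (hA : ∀ i, SupportedOn (window i m) (A i))
    (hB : ∀ i, SupportedOn (window i m') (B i)) {i j : Fin N} (h : i.val + m ≤ j.val) :
    ⁅A i, B j⁆ = 0 ∧ ⁅B j, A i⁆ = 0 := by
  have hd : Disjoint (window i m) (window j m') := by
    rw [Finset.disjoint_left]
    intro x hx hx'
    rw [mem_window] at hx hx'
    omega
  exact ⟨(hA i).lie_eq_zero hd (hB j), (hB j).lie_eq_zero hd.symm (hA i)⟩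

theorem supportedOn_localBracket (hA : ∀ i, SupportedOn (window i m) (A i))
    (hB : ∀ i, SupportedOn (window i m') (B i)) (x : Fin N) :
    SupportedOn (window x (m + m')) (localBracket A B x) := by
  refine (SupportedOn.sum _ fun j hj => ?_).add (SupportedOn.sum _ fun i hi => ?_)
  · have hj := Finset.mem_Ici.mp hj
    rw [Fin.le_def] at hj
    by_cases h : x.val + m ≤ j.val
    · rw [(lie_eq_zero_of_add_le hA hB h).1]
      exact SupportedOn.zero _
    · refine ((hA x).mono ?_).lie ((hB j).mono ?_) <;> intro y hy <;> rw [mem_window] at * <;> omega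
  · have hi := Finset.mem_Ioi.mp hi
    rw [Fin.lt_def] at hi
    by_cases h : x.val + m' ≤ i.val
    · rw [(lie_eq_zero_of_add_le hB hA h).2]
      exact SupportedOn.zero _
    · refine ((hA i).mono ?_).lie ((hB x).mono ?_) <;> intro y hy <;> rw [mem_window] at * <;> omega

/-- At each site `x`, only `m + m'` of the commutators do not vanish. -/
theorem norm_localBracket_le {a b : ℝ} (hA : ∀ i, SupportedOn (window i m) (A i))
    (hB : ∀ i, SupportedOn (window i m') (B i)) (ha : ∀ i, ‖A i‖ ≤ a) (hb : ∀ i, ‖B i‖ ≤ b)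
    (x : Fin N) : ‖localBracket A B x‖ ≤ 2 * ((m + m' : ℕ) : ℝ) * a * b := by
  have ha0 : 0 ≤ a := (norm_nonneg _).trans (ha x)
  have hb0 : 0 ≤ b := (norm_nonneg _).trans (hb x)
  have hab : ∀ i j, ‖⁅A i, B j⁆‖ ≤ 2 * a * b := fun i j =>
    (norm_lie_le_two_mul _ _).trans (by gcongr <;> first | exact ha i | exact hb j)
  have key : ∀ (s : Finset (Fin N)) (f : Fin N → Op d) (l : ℕ), (∀ j ∈ s, x.val ≤ j.val) →
      (∀ j ∈ s, x.val + l ≤ j.val → f j = 0) → (∀ j, ‖f j‖ ≤ 2 * a * b) →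
      ‖∑ j ∈ s, f j‖ ≤ l * (2 * a * b) := by
    intro s f l hs h0 hf
    have h1 : ∑ j ∈ s, f j = ∑ j ∈ s.filter (· ∈ window x l), f j := by
      refine (Finset.sum_filter_of_ne fun j hj hne => ?_).symm
      rw [mem_window]
      refine ⟨hs j hj, ?_⟩
      by_contra hlt
      exact hne (h0 j hj (by omega))
    rw [h1]
    refine (norm_sum_le_of_le _ fun j _ => hf j).trans ?_
    rw [Finset.sum_const, nsmul_eq_mul]
    have hc : (s.filter (· ∈ window x l)).card ≤ l :=
      (Finset.card_le_card fun j hj => (Finset.mem_filter.mp hj).2).trans (card_window_le x l)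
    gcongr
  have h1 := key (Finset.Ici x) (fun j => ⁅A x, B j⁆) m
    (fun j hj => Fin.le_def.mp (Finset.mem_Ici.mp hj))
    (fun j _ h => (lie_eq_zero_of_add_le hA hB h).1) (fun j => hab x j)
  have h2 := key (Finset.Ioi x) (fun i => ⁅A i, B x⁆) m'
    (fun j hj => (Fin.lt_def.mp (Finset.mem_Ioi.mp hj)).le)
    (fun j _ h => (lie_eq_zero_of_add_le hB hA h).2) (fun j => hab j x)
  calc ‖localBracket A B x‖ ≤ m * (2 * a * b) + m' * (2 * a * b) :=
        (norm_add_le _ _).trans (add_le_add h1 h2)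
    _ = _ := by push_cast; ring

end LocalBracket

/-! ### Graded iterated brackets -/

section Convolution

/-- Summation of a finitely supported convolution over all degrees. -/
theorem sum_range_sum_Icc_sub {M : Type*} [AddCommMonoid M] {n L : ℕ} {f : ℕ → ℕ → M}
    (hp : ∀ p s, n < p → f p s = 0) (hs : ∀ p s, L ≤ s → f p s = 0) :
    ∑ q ∈ Finset.range (n + L), ∑ p ∈ Finset.Icc 1 q, f p (q - p) =
      ∑ p ∈ Finset.Icc 1 n, ∑ s ∈ Finset.range L, f p s := by
  have h1 : ∑ q ∈ Finset.range (n + L), ∑ p ∈ Finset.Icc 1 q, f p (q - p) =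
      ∑ p ∈ Finset.Icc 1 (n + L), ∑ q ∈ Finset.Ico p (n + L), f p (q - p) :=
    Finset.sum_comm' fun q p => by
      simp only [Finset.mem_range, Finset.mem_Icc, Finset.mem_Ico]
      omega
  rw [h1]
  refine (Finset.sum_subset_zero_on_sdiff (Finset.Icc_subset_Icc_right (by omega))
    (fun p hp' => ?_) fun p hp' => ?_).symm
  · refine Finset.sum_eq_zero fun q _ => hp _ _ ?_
    simp only [Finset.mem_sdiff, Finset.mem_Icc] at hp'
    omega
  · rw [Finset.sum_Ico_eq_sum_range]
    simp only [Nat.add_sub_cancel_left]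
    have hp'' := (Finset.mem_Icc.mp hp').2
    refine Finset.sum_subset (Finset.range_subset_range.mpr (by omega)) fun s _ hs' => ?_
    exact hs _ _ (by simpa using hs')

/-- Graded iterated brackets: for graded families `W` (in degrees `p ≥ 1`) and `X`, the degree `q`
component of `ad_W ^ k X`. The bracket may depend on the degree `q` of its result, which serves
for the numerical majorants. -/
def iterBracket {E F : Type*} [AddCommMonoid F] (br : ℕ → E → F → F) (W : ℕ → E) (X : ℕ → F) :
    ℕ → ℕ → F
  | 0, q => X q
  | k + 1, q => ∑ p ∈ Finset.Icc 1 q, br q (W p) (iterBracket br W X k (q - p))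

section

variable {E F : Type*} [AddCommMonoid F] {br : ℕ → E → F → F} {W W' : ℕ → E} {X X' : ℕ → F}

theorem iterBracket_congr_le {q : ℕ} (k : ℕ) (hW : ∀ p, 1 ≤ p → p ≤ q → W p = W' p)
    (hX : ∀ j ≤ q, X j = X' j) : iterBracket br W X k q = iterBracket br W' X' k q := by
  induction k generalizing q with
  | zero => exact hX q le_rfl
  | succ k ih =>
    refine Finset.sum_congr rfl fun p hp => ?_
    rw [Finset.mem_Icc] at hp
    rw [hW p hp.1 hp.2, ih (fun p' h1 h2 => hW p' h1 (by omega)) fun j hj => hX j (by omega)]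

/-- Degrees of `W` start at one, so that with at least one bracket the component of degree `q`
involves only components of `X` of smaller degree. -/
theorem iterBracket_congr {q k : ℕ} (hk : 1 ≤ k) (hW : ∀ p, 1 ≤ p → p ≤ q → W p = W' p)
    (hX : ∀ j < q, X j = X' j) : iterBracket br W X k q = iterBracket br W' X' k q := by
  obtain ⟨k, rfl⟩ : ∃ l, k = l + 1 := ⟨k - 1, by omega⟩
  refine Finset.sum_congr rfl fun p hp => ?_
  rw [Finset.mem_Icc] at hp
  rw [hW p hp.1 hp.2, iterBracket_congr_le k (fun p' h1 h2 => hW p' h1 (by omega))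
    fun j hj => hX j (by omega)]

theorem iterBracket_eq_zero_of_lt (hbr : ∀ q w, br q w 0 = 0) {k q : ℕ} (h : q < k) :
    iterBracket br W X k q = 0 := by
  induction k generalizing q with
  | zero => omega
  | succ k ih =>
    refine Finset.sum_eq_zero fun p hp => ?_
    rw [Finset.mem_Icc] at hp
    rw [ih (by omega), hbr]

theorem iterBracket_eq_zero_of_le [Zero E] {n : ℕ} (hr : ∀ q w, br q w 0 = 0)
    (hl : ∀ q x, br q 0 x = 0) (hW : ∀ p, n < p → W p = 0) (hX : ∀ q, n ≤ q → X q = 0)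
    {k q : ℕ} (h : n * (k + 1) ≤ q) : iterBracket br W X k q = 0 := by
  induction k generalizing q with
  | zero => exact hX q (by simpa using h)
  | succ k ih =>
    refine Finset.sum_eq_zero fun p _ => ?_
    by_cases hp : n < p
    · rw [hW p hp, hl]
    · have h2 : n * (k + 1 + 1) = n * (k + 1) + n := by ring
      rw [ih (by omega), hr]

/-- The sum of the graded components is the iterated bracket of the sums. -/
theorem sum_iterBracket {F : Type*} [AddCommMonoid F] {b : F → F → F} {W X : ℕ → F} {n : ℕ}
    (hr : ∀ w, b w 0 = 0) (hl : ∀ x, b 0 x = 0)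
    (hb : ∀ (s t : Finset ℕ) (f g : ℕ → F),
      b (∑ i ∈ s, f i) (∑ j ∈ t, g j) = ∑ i ∈ s, ∑ j ∈ t, b (f i) (g j))
    (hW : ∀ p, n < p → W p = 0) (hX : ∀ q, n ≤ q → X q = 0) (k : ℕ) :
    ∑ q ∈ Finset.range (n * (k + 1)), iterBracket (fun _ => b) W X k q =
      (b (∑ p ∈ Finset.Icc 1 n, W p))^[k] (∑ q ∈ Finset.range n, X q) := by
  induction k with
  | zero => simp [iterBracket]
  | succ k ih =>
    rw [Function.iterate_succ_apply', ← ih, hb, show n * (k + 1 + 1) = n + n * (k + 1) by ring]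
    refine sum_range_sum_Icc_sub (f := fun p s => b (W p) (iterBracket (fun _ => b) W X k s))
      (fun p s h => ?_) fun p s h => ?_
    · rw [hW p h, hl]
    · rw [iterBracket_eq_zero_of_le (fun _ => hr) (fun _ => hl) hW hX h, hr]

end

end Convolution

section NestedSum

variable {N : ℕ} {d : Fin N → ℕ}

theorem lie_finset_sum {ι : Type*} (s : Finset ι) (A : Op d) (f : ι → Op d) :
    ⁅A, ∑ i ∈ s, f i⁆ = ∑ i ∈ s, ⁅A, f i⁆ := by
  simp only [Ring.lie_def, Finset.sum_sub_distrib, Finset.mul_sum, Finset.sum_mul]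

theorem finset_sum_lie_sum {ι κ : Type*} (s : Finset ι) (t : Finset κ) (f : ι → Op d)
    (g : κ → Op d) : ⁅∑ i ∈ s, f i, ∑ j ∈ t, g j⁆ = ∑ i ∈ s, ∑ j ∈ t, ⁅f i, g j⁆ := by
  simp only [Ring.lie_def, Finset.sum_sub_distrib, Finset.sum_mul_sum]
  congr 1
  exact Finset.sum_comm

theorem nestedSum_zero (W : ℕ → Op d) (M : ℕ) (X : Op d) :
    nestedSum W 0 M X = if M = 0 then X else 0 := by
  unfold nestedSum
  cases M with
  | zero => simp [nestedComm]
  | succ M => simp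

theorem nestedSum_succ (W : ℕ → Op d) (k M : ℕ) (X : Op d) :
    nestedSum W (k + 1) M X = ∑ p ∈ Finset.Icc 1 M, ⁅W p, nestedSum W k (M - p) X⁆ := by
  simp only [nestedSum, lie_finset_sum]
  rw [Finset.sum_sigma']
  refine Finset.sum_bij' (fun i _ => ⟨i 0, fun j => i j.succ⟩) (fun x _ => Fin.cons x.1 x.2)
    ?_ ?_ ?_ ?_ ?_
  · intro i hi
    rw [Finset.mem_filter, Finset.Nat.mem_antidiagonalTuple, Fin.sum_univ_succ] at hi
    simp only [Finset.mem_sigma, Finset.mem_Icc, Finset.mem_filter,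
      Finset.Nat.mem_antidiagonalTuple]
    exact ⟨⟨hi.2 0, by omega⟩, by omega, fun j => hi.2 j.succ⟩
  · intro x hx
    simp only [Finset.mem_sigma, Finset.mem_Icc, Finset.mem_filter,
      Finset.Nat.mem_antidiagonalTuple] at hx
    rw [Finset.mem_filter, Finset.Nat.mem_antidiagonalTuple, Fin.sum_univ_succ]
    simp only [Fin.cons_zero, Fin.cons_succ]
    refine ⟨by omega, fun j => ?_⟩
    refine Fin.cases ?_ (fun j => ?_) j
    · simpa using hx.1.1
    · simpa using hx.2.2 j
  · intro i _
    exact Fin.cons_self_tail i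
  · intro x _
    rfl
  · intro i _
    rfl

/-- The nested commutator sums are the graded components of `ad_W ^ k X`. -/
theorem iterBracket_eq_sum_nestedSum (W X : ℕ → Op d) (k q : ℕ) :
    iterBracket (fun _ A B => ⁅A, B⁆) W X k q =
      ∑ s ∈ Finset.range (q + 1), nestedSum W k (q - s) (X s) := by
  induction k generalizing q with
  | zero =>
    rw [Finset.sum_eq_single_of_mem q (by simp)]
    · simp [iterBracket, nestedSum_zero]
    · intro s hs hne
      rw [Finset.mem_range] at hs
      rw [nestedSum_zero, if_neg (by omega)]
  | succ k ih =>
    simp only [iterBracket, ih, lie_finset_sum, nestedSum_succ]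
    rw [Finset.sum_comm' (t' := Finset.range (q + 1)) (s' := fun s => Finset.Icc 1 (q - s))]
    · refine Finset.sum_congr rfl fun s _ => Finset.sum_congr rfl fun p _ => ?_
      rw [Nat.sub_right_comm]
    · intro p s
      simp only [Finset.mem_range, Finset.mem_Icc]
      omega

theorem iterBracket_single (W : ℕ → Op d) (X : Op d) (k q : ℕ) :
    iterBracket (fun _ A B => ⁅A, B⁆) W (Pi.single 0 X) k q = nestedSum W k q X := by
  rw [iterBracket_eq_sum_nestedSum, Finset.sum_eq_single_of_mem 0 (by simp)]
  · simp
  · intro s _ hs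
    rw [Pi.single_eq_of_ne hs]
    unfold nestedSum
    refine Finset.sum_eq_zero fun i _ => ?_
    have hn : ∀ (k : ℕ) (A : Fin k → Op d), nestedComm k A 0 = 0 := fun k => by
      induction k with
      | zero => exact fun _ => rfl
      | succ k ih => intro A; rw [nestedComm, ih, Ring.lie_def]; simp
    exact hn k _

end NestedSum

section Transform

/-- The coefficient of `ad_Ω ^ k H` in `exp (-Ω) H exp Ω`. -/
def coefH (k : ℕ) : ℂ := (-1) ^ k / (k.factorial : ℂ)

/-- The coefficient of `ad_Ω ^ k (∂_t Ω)` in `-i exp (-Ω) ∂_t (exp Ω)`. -/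
def coefD (k : ℕ) : ℂ := Complex.I * ((-1) ^ (k + 1) / ((k + 1).factorial : ℂ))

theorem norm_coefH (k : ℕ) : ‖coefH k‖ = 1 / (k.factorial : ℝ) := by
  simp [coefH]

theorem norm_coefD (k : ℕ) : ‖coefD k‖ = 1 / ((k + 1).factorial : ℝ) := by
  rw [coefD, norm_mul, norm_div, Complex.norm_natCast]
  simp

/-- The contribution to the transformed Hamiltonian of order `k` in the generator and of degree
`q`, for the generator `W`, the Hamiltonian `X` and the time derivative `Y` of the generator; the
component of degree `q` of `Y` is the derivative of the component of degree `q + 1` of `W`. -/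
def frameTerm {F : Type*} [AddCommGroup F] [Module ℂ F] (b : F → F → F) (W X Y : ℕ → F)
    (k q : ℕ) : F :=
  coefH k • iterBracket (fun _ => b) W X k q + coefD k • iterBracket (fun _ => b) W Y k q

theorem frameTerm_congr {F : Type*} [AddCommGroup F] [Module ℂ F] {b : F → F → F}
    {W W' X Y Y' : ℕ → F} {k q : ℕ} (hk : 1 ≤ k) (hW : ∀ p, 1 ≤ p → p ≤ q → W p = W' p)
    (hY : ∀ j < q, Y j = Y' j) : frameTerm b W X Y k q = frameTerm b W' X Y' k q := by
  rw [frameTerm, frameTerm, iterBracket_congr hk hW hY,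
    iterBracket_congr hk hW fun j _ => (rfl : X j = X j)]

variable {N : ℕ} {d : Fin N → ℕ}

/-- The recursion for `G^(q)` in terms of graded brackets. -/
theorem nextG_eq_sum_frameTerm (T : ℝ) (H : ℝ → Op d) (G : ℕ → ℝ → Op d) (q : ℕ) (t : ℝ) :
    nextG T H G q t = ∑ k ∈ Finset.Icc 1 q,
      frameTerm (fun A B => ⁅A, B⁆) (fun p => omegaOf T G p t) (Pi.single 0 (H t))
        (fun j => domegaOf T G (j + 1) t) k q := by
  simp only [nextG, frameTerm, Finset.sum_add_distrib, iterBracket_single]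
  congr 1
  rw [Finset.smul_sum]
  simp only [Finset.smul_sum, smul_smul, iterBracket_eq_sum_nestedSum]
  have hz : ∀ k M (X : Op d), M < k → nestedSum (fun p => omegaOf T G p t) k M X = 0 := by
    intro k M X h
    rw [← iterBracket_single]
    exact iterBracket_eq_zero_of_lt (fun _ w => by simp [Ring.lie_def]) h
  rw [Finset.sum_comm' (t' := Finset.Icc 1 q) (s' := fun k => Finset.Icc 1 (q + 1 - k))]
  · refine Finset.sum_congr rfl fun k hk => ?_
    rw [Finset.mem_Icc] at hk
    rw [← Finset.smul_sum, ← Finset.smul_sum, coefD]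
    congr 1
    have h1 : Finset.Icc 1 (q + 1 - k) = (Finset.range (q + 1 - k)).image (· + 1) := by
      ext m
      simp only [Finset.mem_Icc, Finset.mem_image, Finset.mem_range]
      exact ⟨fun h => ⟨m - 1, by omega, by omega⟩, fun ⟨a, h1, h2⟩ => by omega⟩
    rw [h1, Finset.sum_image (fun a _ b _ h => by simpa using h)]
    have hsub : Finset.range (q + 1 - k) ⊆ Finset.range (q + 1) :=
      Finset.range_subset_range.mpr (by omega)
    refine Finset.sum_subset_zero_on_sdiff hsub
      (fun s hs => ?_) fun s _ => ?_
    · simp only [Finset.mem_sdiff, Finset.mem_range] at hs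
      exact hz _ _ _ (by omega)
    · rw [Nat.add_sub_add_right]
  · intro m k
    simp only [Finset.mem_Icc]
    omega

end Transform

/-! ### The numerical majorant -/

section Majorant

/-- Sequences can be defined by a recursion that expresses each term through the earlier ones. -/
theorem exists_eq_recursion {α : Type*} [Inhabited α] (F : (ℕ → α) → ℕ → α)
    (hF : ∀ q g g', (∀ j < q, g j = g' j) → F g q = F g' q) : ∃ g : ℕ → α, ∀ q, g q = F g q := by
  classical
  let g : ℕ → α := Nat.lt_wfRel.wf.fix
    fun q ih => F (fun j => if h : j < q then ih j h else default) q
  refine ⟨g, fun q => ?_⟩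
  have h := Nat.lt_wfRel.wf.fix_eq
    (fun q (ih : ∀ j, j < q → α) => F (fun j => if h : j < q then ih j h else default) q) q
  refine h.trans (hF q _ _ fun j hj => ?_)
  exact dif_pos hj

/-- The numerical bracket: it bounds the local norm of the commutator of a family of range `R p`
with one of range `R (q - p + 1)`. -/
def numBracket (R : ℕ) (q : ℕ) (a b : ℝ) : ℝ := 2 * (R * (q + 1) : ℕ) * a * b

theorem numBracket_nonneg {R q : ℕ} {a b : ℝ} (ha : 0 ≤ a) (hb : 0 ≤ b) :
    0 ≤ numBracket R q a b := by
  unfold numBracket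
  positivity

theorem iterBracket_num_nonneg {R : ℕ} {w X : ℕ → ℝ} (hw : ∀ p, 0 ≤ w p) (hX : ∀ q, 0 ≤ X q)
    (k q : ℕ) : 0 ≤ iterBracket (numBracket R) w X k q := by
  induction k generalizing q with
  | zero => exact hX q
  | succ k ih => exact Finset.sum_nonneg fun p _ => numBracket_nonneg (hw p) (ih _)

/-- If the generator has degrees at most `n`, then the `k`-th iterated bracket has degrees below
`n (k + 1)`, so that the ranges contribute at most the factor `(k + 1)!`. It is this factorial
that the coefficients of the exponential series compensate. -/
theorem sum_iterBracket_num_le {R n : ℕ} {w X : ℕ → ℝ} {z : ℝ} (hz : 0 < z) (hw : ∀ p, 0 ≤ w p)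
    (hX : ∀ q, 0 ≤ X q) (hwn : ∀ p, n < p → w p = 0) (hXn : ∀ q, n ≤ q → X q = 0) (k : ℕ) :
    ∑ q ∈ Finset.range (n * (k + 1)), z ^ q * iterBracket (numBracket R) w X k q ≤
      (2 * R * n * ∑ p ∈ Finset.Icc 1 n, z ^ p * w p) ^ k * ((k + 1).factorial : ℝ) *
        ∑ q ∈ Finset.range n, z ^ q * X q := by
  have hr : ∀ q w, numBracket R q w 0 = 0 := fun q w => by simp [numBracket]
  have hl : ∀ q x, numBracket R q 0 x = 0 := fun q x => by simp [numBracket]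
  induction k with
  | zero => simp [iterBracket]
  | succ k ih =>
    set ω := ∑ p ∈ Finset.Icc 1 n, z ^ p * w p with hω
    have hω0 : 0 ≤ ω := Finset.sum_nonneg fun p _ => mul_nonneg (pow_nonneg hz.le _) (hw p)
    set I := iterBracket (numBracket R) w X k with hI
    have hI0 : ∀ q, 0 ≤ I q := iterBracket_num_nonneg hw hX k
    have hstep : ∀ q ∈ Finset.range (n * (k + 1 + 1)),
        z ^ q * iterBracket (numBracket R) w X (k + 1) q ≤
          ∑ p ∈ Finset.Icc 1 q,
            2 * R * n * (k + 2) * ((z ^ p * w p) * (z ^ (q - p) * I (q - p))) := by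
      intro q hq
      rw [Finset.mem_range] at hq
      rw [iterBracket, Finset.mul_sum]
      refine Finset.sum_le_sum fun p hp => ?_
      rw [Finset.mem_Icc] at hp
      have hzq : z ^ q = z ^ p * z ^ (q - p) := by rw [← pow_add]; congr 1; omega
      have hq' : ((R * (q + 1) : ℕ) : ℝ) ≤ R * (n * (k + 2)) := by
        have : R * (q + 1) ≤ R * (n * (k + 2)) := Nat.mul_le_mul_left _ (by
          have : n * (k + 2) = n * (k + 1 + 1) := by ring
          omega)
        exact_mod_cast this
      have hnn : 0 ≤ (z ^ p * w p) * (z ^ (q - p) * I (q - p)) := by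
        have := hw p
        have := hI0 (q - p)
        positivity
      calc z ^ q * numBracket R q (w p) (I (q - p))
          = 2 * ((R * (q + 1) : ℕ) : ℝ) * ((z ^ p * w p) * (z ^ (q - p) * I (q - p))) := by
            rw [hzq, numBracket]; ring
        _ ≤ 2 * (R * (n * (k + 2))) * ((z ^ p * w p) * (z ^ (q - p) * I (q - p))) := by gcongr
        _ = _ := by ring
    refine (Finset.sum_le_sum hstep).trans ?_
    rw [show n * (k + 1 + 1) = n + n * (k + 1) by ring,
      sum_range_sum_Icc_sub
        (f := fun p s => 2 * (R : ℝ) * n * (k + 2) * ((z ^ p * w p) * (z ^ s * I s)))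
        (fun p s h => by simp [hwn p h])
        (fun p s h => by simp [hI, iterBracket_eq_zero_of_le hr hl hwn hXn h])]
    simp only [← Finset.mul_sum, ← Finset.sum_mul]
    rw [← hω]
    calc 2 * (R : ℝ) * n * (k + 2) * (ω * ∑ s ∈ Finset.range (n * (k + 1)), z ^ s * I s)
        ≤ 2 * (R : ℝ) * n * (k + 2) * (ω * ((2 * R * n * ω) ^ k * ((k + 1).factorial : ℝ) *
          ∑ q ∈ Finset.range n, z ^ q * X q)) := by gcongr
      _ = _ := by
        rw [Nat.factorial_succ (k + 1)]
        push_cast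
        ring

/-- Majorant of the local norm of the contribution of order `k` and degree `q` to the transformed
Hamiltonian, when `γ j` bounds the local norm of `G^(j)`. -/
def majTerm (R : ℕ) (h T : ℝ) (γ : ℕ → ℝ) (k q : ℕ) : ℝ :=
  1 / (k.factorial : ℝ) *
      iterBracket (numBracket R) (fun p => 2 * T * γ (p - 1)) (Pi.single 0 (2 * h)) k q +
    1 / ((k + 1).factorial : ℝ) *
      iterBracket (numBracket R) (fun p => 2 * T * γ (p - 1)) (fun j => 2 * γ j) k q

/-- Truncation of a sequence to the indices below `n`. -/
def truncSeq {α : Type*} [Zero α] (n : ℕ) (γ : ℕ → α) (j : ℕ) : α := if j < n then γ j else 0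

variable {R : ℕ} {h T : ℝ} {γ γ' : ℕ → ℝ}

theorem majTerm_nonneg (hh : 0 ≤ h) (hT : 0 ≤ T) (hγ : ∀ q, 0 ≤ γ q) (k q : ℕ) :
    0 ≤ majTerm R h T γ k q := by
  have hw : ∀ p, 0 ≤ 2 * T * γ (p - 1) := fun p => by have := hγ (p - 1); positivity
  have h1 := iterBracket_num_nonneg (R := R) hw (X := Pi.single 0 (2 * h))
    (fun q => by
      by_cases hq : q = 0
      · subst hq; simpa using hh
      · rw [Pi.single_eq_of_ne hq]) k q
  have h2 := iterBracket_num_nonneg (R := R) hw (X := fun j => 2 * γ j)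
    (fun q => by have := hγ q; positivity) k q
  unfold majTerm
  positivity

theorem majTerm_congr {k q : ℕ} (hk : 1 ≤ k) (hγ : ∀ j < q, γ j = γ' j) :
    majTerm R h T γ k q = majTerm R h T γ' k q := by
  have hW : ∀ p, 1 ≤ p → p ≤ q → 2 * T * γ (p - 1) = 2 * T * γ' (p - 1) := fun p h1 h2 => by
    rw [hγ (p - 1) (by omega)]
  unfold majTerm
  rw [iterBracket_congr hk hW (fun j _ => rfl),
    iterBracket_congr (X := fun j => 2 * γ j) (X' := fun j => 2 * γ' j) hk hW
      (fun j hj => by rw [hγ j hj])]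

/-- The numerical sequence that solves the recursion for `G^(q)` with norms in place of
operators. -/
theorem exists_majorant (R : ℕ) {h T : ℝ} (hh : 0 ≤ h) (hT : 0 ≤ T) :
    ∃ γ : ℕ → ℝ, γ 0 = 2 * h ∧ (∀ q, 1 ≤ q → γ q = ∑ k ∈ Finset.Icc 1 q, majTerm R h T γ k q) ∧
      ∀ q, 0 ≤ γ q := by
  obtain ⟨γ, hγ⟩ := exists_eq_recursion
    (fun (γ : ℕ → ℝ) q => if q = 0 then 2 * h else ∑ k ∈ Finset.Icc 1 q, majTerm R h T γ k q)
    (fun q g g' hg => by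
      congr 1
      refine Finset.sum_congr rfl fun k hk => majTerm_congr (Finset.mem_Icc.mp hk).1 hg)
  have h1 : ∀ q, 1 ≤ q → γ q = ∑ k ∈ Finset.Icc 1 q, majTerm R h T γ k q := fun q hq => by
    conv_lhs => rw [hγ q, if_neg (by omega)]
  have h0 : γ 0 = 2 * h := by rw [hγ 0, if_pos rfl]
  refine ⟨γ, h0, h1, fun q => ?_⟩
  induction q using Nat.strong_induction_on with
  | _ q ih =>
    by_cases hq : q = 0
    · subst hq
      rw [h0]
      positivity
    · rw [h1 q (by omega)]
      refine Finset.sum_nonneg fun k hk => ?_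
      rw [majTerm_congr (γ' := truncSeq q γ) (Finset.mem_Icc.mp hk).1
        fun j hj => by rw [truncSeq, if_pos hj]]
      refine majTerm_nonneg hh hT (fun j => ?_) k q
      unfold truncSeq
      split_ifs with hj
      · exact ih j hj
      · exact le_rfl

theorem sum_truncSeq {m n : ℕ} (hmn : m ≤ n) (z : ℝ) (γ : ℕ → ℝ) :
    ∑ q ∈ Finset.range n, z ^ q * truncSeq m γ q = ∑ q ∈ Finset.range m, z ^ q * γ q := by
  refine (Finset.sum_subset_zero_on_sdiff (Finset.range_subset_range.mpr hmn)
    (fun q hq => ?_) fun q hq => ?_).symm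
  · simp only [Finset.mem_sdiff, Finset.mem_range] at hq
    rw [truncSeq, if_neg hq.2, mul_zero]
  · rw [truncSeq, if_pos (Finset.mem_range.mp hq)]

/-- Geometric decay in the order `k` of the weighted sums of the majorants. -/
theorem sum_majTerm_le {n m : ℕ} {z : ℝ} (hh : 0 ≤ h) (hT : 0 ≤ T) (hz : 0 < z)
    (hγ : ∀ q, 0 ≤ γ q) (hn : 1 ≤ n) (hmn : m ≤ n) (hsmall : 32 * R * n * T * z * h ≤ 1 / 6)
    (hΓ : ∑ q ∈ Finset.range m, z ^ q * γ q ≤ 4 * h) (k : ℕ) :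
    ∑ q ∈ Finset.range (n * (k + 1)), z ^ q * majTerm R h T (truncSeq m γ) k q ≤
      10 * h * (1 / 6) ^ k := by
  have ht : ∀ q, 0 ≤ truncSeq m γ q := fun q => by
    unfold truncSeq
    split_ifs
    · exact hγ q
    · exact le_rfl
  have htn : ∀ q, n ≤ q → truncSeq m γ q = 0 := fun q hq => by
    rw [truncSeq, if_neg (by omega)]
  set Γ := ∑ q ∈ Finset.range m, z ^ q * γ q with hΓd
  have hΓ0 : 0 ≤ Γ := Finset.sum_nonneg fun q _ => mul_nonneg (pow_nonneg hz.le _) (hγ q)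
  have hw : ∀ p, 0 ≤ 2 * T * truncSeq m γ (p - 1) := fun p => by
    have := ht (p - 1)
    positivity
  have hwn : ∀ p, n < p → 2 * T * truncSeq m γ (p - 1) = 0 := fun p hp => by
    rw [htn _ (by omega), mul_zero]
  have hω : ∑ p ∈ Finset.Icc 1 n, z ^ p * (2 * T * truncSeq m γ (p - 1)) = 2 * T * z * Γ := by
    have h1 : Finset.Icc 1 n = (Finset.range n).image (· + 1) := by
      ext p
      simp only [Finset.mem_Icc, Finset.mem_image, Finset.mem_range]
      exact ⟨fun h => ⟨p - 1, by omega, by omega⟩, fun ⟨a, h1, h2⟩ => by omega⟩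
    rw [h1, Finset.sum_image (fun a _ b _ h => by simpa using h), hΓd, ← sum_truncSeq hmn,
      Finset.mul_sum]
    refine Finset.sum_congr rfl fun q _ => ?_
    rw [Nat.add_sub_cancel, pow_succ]
    ring
  have hA := sum_iterBracket_num_le (R := R) (X := Pi.single 0 (2 * h)) hz hw
    (fun q => by
      by_cases hq : q = 0
      · subst hq; simpa using hh
      · rw [Pi.single_eq_of_ne hq])
    hwn (fun q hq => Pi.single_eq_of_ne (by omega) _) k
  have hB := sum_iterBracket_num_le (R := R) (X := fun j => 2 * truncSeq m γ j) hz hw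
    (fun q => by have := ht q; positivity) hwn (fun q hq => by rw [htn q hq, mul_zero]) k
  rw [hω] at hA hB
  have hXA : ∑ q ∈ Finset.range n, z ^ q * (Pi.single 0 (2 * h) : ℕ → ℝ) q = 2 * h := by
    rw [Finset.sum_eq_single_of_mem 0 (Finset.mem_range.mpr hn)]
    · simp
    · intro q _ hq
      rw [Pi.single_eq_of_ne hq, mul_zero]
  have hXB : ∑ q ∈ Finset.range n, z ^ q * (2 * truncSeq m γ q) = 2 * Γ := by
    rw [hΓd, ← sum_truncSeq hmn, Finset.mul_sum]
    exact Finset.sum_congr rfl fun q _ => by ring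
  rw [hXA] at hA
  rw [hXB] at hB
  set y := 2 * (R : ℝ) * n * (2 * T * z * Γ) with hy
  have hy0 : 0 ≤ y := by positivity
  have hy6 : 2 * y ≤ 1 / 6 := by
    calc 2 * y = 8 * (R * n * T * z) * Γ := by rw [hy]; ring
      _ ≤ 8 * (R * n * T * z) * (4 * h) := by gcongr
      _ = 32 * R * n * T * z * h := by ring
      _ ≤ 1 / 6 := hsmall
  have hk0 : (0 : ℝ) < k.factorial := by exact_mod_cast k.factorial_pos
  have hk1 : (0 : ℝ) < (k + 1).factorial := by exact_mod_cast (k + 1).factorial_pos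
  -- for a term of `H` the factorial is not fully compensated: `(k + 1)! / k! = k + 1 ≤ 2 ^ k`
  have h2k : (k : ℝ) + 1 ≤ 2 ^ k := by exact_mod_cast Nat.lt_two_pow_self (n := k)
  have hfac : ((k + 1).factorial : ℝ) = (k + 1) * k.factorial := by
    rw [Nat.factorial_succ]
    push_cast
    ring
  have e1 : ∑ q ∈ Finset.range (n * (k + 1)), z ^ q * (1 / (k.factorial : ℝ) *
      iterBracket (numBracket R) (fun p => 2 * T * truncSeq m γ (p - 1))
        (Pi.single 0 (2 * h)) k q) ≤ (1 / 6) ^ k * (2 * h) := by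
    calc _ = 1 / (k.factorial : ℝ) * ∑ q ∈ Finset.range (n * (k + 1)), z ^ q *
          iterBracket (numBracket R) (fun p => 2 * T * truncSeq m γ (p - 1))
            (Pi.single 0 (2 * h)) k q := by
          rw [Finset.mul_sum]
          exact Finset.sum_congr rfl fun q _ => by ring
      _ ≤ 1 / (k.factorial : ℝ) * (y ^ k * ((k + 1).factorial : ℝ) * (2 * h)) := by gcongr
      _ = ((k : ℝ) + 1) * y ^ k * (2 * h) := by rw [hfac]; field_simp
      _ ≤ 2 ^ k * y ^ k * (2 * h) := by gcongr
      _ = (2 * y) ^ k * (2 * h) := by rw [mul_pow 2 y]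
      _ ≤ (1 / 6) ^ k * (2 * h) := by gcongr
  have e2 : ∑ q ∈ Finset.range (n * (k + 1)), z ^ q * (1 / ((k + 1).factorial : ℝ) *
      iterBracket (numBracket R) (fun p => 2 * T * truncSeq m γ (p - 1))
        (fun j => 2 * truncSeq m γ j) k q) ≤ (1 / 6) ^ k * (8 * h) := by
    calc _ = 1 / ((k + 1).factorial : ℝ) * ∑ q ∈ Finset.range (n * (k + 1)), z ^ q *
          iterBracket (numBracket R) (fun p => 2 * T * truncSeq m γ (p - 1))
            (fun j => 2 * truncSeq m γ j) k q := by
          rw [Finset.mul_sum]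
          exact Finset.sum_congr rfl fun q _ => by ring
      _ ≤ 1 / ((k + 1).factorial : ℝ) * (y ^ k * ((k + 1).factorial : ℝ) * (2 * Γ)) := by gcongr
      _ = y ^ k * (2 * Γ) := by field_simp
      _ ≤ (2 * y) ^ k * (2 * (4 * h)) := by
          gcongr
          linarith
      _ ≤ (1 / 6) ^ k * (2 * (4 * h)) := by gcongr
      _ = _ := by ring
  calc _ ≤ (1 / 6) ^ k * (2 * h) + (1 / 6) ^ k * (8 * h) := by
        refine le_trans (le_of_eq ?_) (add_le_add e1 e2)
        rw [← Finset.sum_add_distrib]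
        exact Finset.sum_congr rfl fun q _ => by rw [majTerm, mul_add]
    _ = _ := by ring

/-- The weighted sum of the majorants up to order `n` closes on itself: the terms of
degree at most `m + 1` are bounded by those of degree at most `m`, with the geometric series over
the orders `k ≥ 1`. -/
theorem sum_majorant_le {n : ℕ} {z : ℝ} (hh : 0 ≤ h) (hT : 0 ≤ T) (hz : 0 < z)
    (hγ : ∀ q, 0 ≤ γ q) (h0 : γ 0 = 2 * h)
    (hrec : ∀ q, 1 ≤ q → γ q = ∑ k ∈ Finset.Icc 1 q, majTerm R h T γ k q)
    (hsmall : 32 * R * n * T * z * h ≤ 1 / 6) :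
    ∑ q ∈ Finset.range (n + 1), z ^ q * γ q ≤ 4 * h := by
  suffices ∀ m ≤ n, ∑ q ∈ Finset.range (m + 1), z ^ q * γ q ≤ 4 * h from this n le_rfl
  intro m
  induction m with
  | zero =>
    intro _
    simp only [zero_add, Finset.range_one, Finset.sum_singleton, pow_zero, one_mul, h0]
    linarith
  | succ m ih =>
    intro hm
    have hΓ := ih (by omega)
    have ht : ∀ q, 0 ≤ truncSeq (m + 1) γ q := fun q => by
      unfold truncSeq
      split_ifs
      · exact hγ q
      · exact le_rfl
    have hpos : ∀ k q, 0 ≤ z ^ q * majTerm R h T (truncSeq (m + 1) γ) k q := fun k q =>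
      mul_nonneg (pow_nonneg hz.le _) (majTerm_nonneg hh hT ht k q)
    have hq : ∀ q ∈ Finset.range (m + 1), z ^ (q + 1) * γ (q + 1) ≤
        ∑ k ∈ Finset.Icc 1 (m + 1),
          z ^ (q + 1) * majTerm R h T (truncSeq (m + 1) γ) k (q + 1) := by
      intro q hq
      rw [Finset.mem_range] at hq
      rw [hrec (q + 1) (by omega), Finset.mul_sum]
      have : ∀ k ∈ Finset.Icc 1 (q + 1), z ^ (q + 1) * majTerm R h T γ k (q + 1) =
          z ^ (q + 1) * majTerm R h T (truncSeq (m + 1) γ) k (q + 1) := fun k hk => by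
        rw [majTerm_congr (Finset.mem_Icc.mp hk).1
          fun j hj => (by rw [truncSeq, if_pos (by omega)] : γ j = truncSeq (m + 1) γ j)]
      rw [Finset.sum_congr rfl this]
      exact Finset.sum_le_sum_of_subset_of_nonneg (Finset.Icc_subset_Icc_right (by omega))
        fun k _ _ => hpos k _
    rw [Finset.sum_range_succ', pow_zero, one_mul, h0]
    have hs : ∑ q ∈ Finset.range (m + 1), z ^ (q + 1) * γ (q + 1) ≤ 2 * h := by
      calc _ ≤ ∑ k ∈ Finset.Icc 1 (m + 1), ∑ q ∈ Finset.range (m + 1),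
            z ^ (q + 1) * majTerm R h T (truncSeq (m + 1) γ) k (q + 1) := by
            rw [Finset.sum_comm]
            exact Finset.sum_le_sum hq
        _ ≤ ∑ k ∈ Finset.Icc 1 (m + 1), 10 * h * (1 / 6) ^ k := by
            refine Finset.sum_le_sum fun k hk => ?_
            refine le_trans ?_ (sum_majTerm_le hh hT hz hγ (by omega) hm hsmall hΓ k)
            have h1 : ∑ q ∈ Finset.range (m + 1),
                z ^ (q + 1) * majTerm R h T (truncSeq (m + 1) γ) k (q + 1) ≤
                ∑ q ∈ Finset.range (m + 1 + 1),
                  z ^ q * majTerm R h T (truncSeq (m + 1) γ) k q := by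
              rw [Finset.sum_range_succ' _ (m + 1)]
              exact le_add_of_nonneg_right (hpos k 0)
            refine h1.trans (Finset.sum_le_sum_of_subset_of_nonneg
              (Finset.range_subset_range.mpr ?_) fun q _ _ => hpos k q)
            have hk1 := (Finset.mem_Icc.mp hk).1
            have : n * 2 ≤ n * (k + 1) := Nat.mul_le_mul_left _ (by omega)
            omega
        _ ≤ 2 * h := by
            rw [← Finset.mul_sum]
            have hgeo : ∑ k ∈ Finset.Icc 1 (m + 1), (1 / 6 : ℝ) ^ k ≤ 1 / 5 := by
              have : ∀ m : ℕ,
                  ∑ k ∈ Finset.Icc 1 m, (1 / 6 : ℝ) ^ k = 1 / 5 * (1 - (1 / 6) ^ m) := by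
                intro m
                induction m with
                | zero => simp
                | succ m ih => rw [Finset.sum_Icc_succ_top (by omega), ih, pow_succ]; ring
              rw [this]
              have : (0 : ℝ) ≤ (1 / 6) ^ (m + 1) := by positivity
              linarith
            calc 10 * h * ∑ k ∈ Finset.Icc 1 (m + 1), (1 / 6 : ℝ) ^ k
                ≤ 10 * h * (1 / 5) := by gcongr
              _ = 2 * h := by ring
    linarith

end Majorant

/-! ### Local representations on one period -/

section LocalRep

variable {N : ℕ} {d : Fin N → ℕ}

/-- On the period `[0, T]`, the operators `F t` are the sums of the local terms `f t i`, which have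
range `R (q + 1)`, depend measurably on `t` and have norm at most `c`. The local terms, unlike their
sum, need not be periodic in time; hence the restriction to one period, over which time averages and
primitives are taken. -/
structure IsLocalRep (R : ℕ) (T : ℝ) (q : ℕ) (c : ℝ) (F : ℝ → Op d) (f : ℝ → Fin N → Op d) :
    Prop where
  supp : ∀ t i, SupportedOn (window i (R * (q + 1))) (f t i)
  meas : ∀ i, AEStronglyMeasurable (fun t => f t i) (volume.restrict (Set.Ioc 0 T))
  bound : ∀ t ∈ Set.Icc 0 T, ∀ i, ‖f t i‖ ≤ c
  sum : ∀ t ∈ Set.Icc 0 T, ∑ i, f t i = F t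

namespace IsLocalRep

variable {R : ℕ} {T : ℝ} {q : ℕ} {c c' : ℝ} {F F' : ℝ → Op d} {f f' : ℝ → Fin N → Op d}

theorem zero (hc : 0 ≤ c) :
    IsLocalRep R T q c (fun _ => (0 : Op d)) (fun _ => (0 : Fin N → Op d)) where
  supp _ _ := SupportedOn.zero _
  meas _ := aestronglyMeasurable_const
  bound _ _ _ := by simpa using hc
  sum _ _ := by simp

theorem add (hf : IsLocalRep R T q c F f) (hf' : IsLocalRep R T q c' F' f') :
    IsLocalRep R T q (c + c') (fun t => F t + F' t) (fun t => f t + f' t) where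
  supp t i := (hf.supp t i).add (hf'.supp t i)
  meas i := (hf.meas i).add (hf'.meas i)
  bound t ht i := (norm_add_le _ _).trans (add_le_add (hf.bound t ht i) (hf'.bound t ht i))
  sum t ht := by
    simp only [Pi.add_apply, Finset.sum_add_distrib, hf.sum t ht, hf'.sum t ht]

theorem smul (a : ℂ) (hf : IsLocalRep R T q c F f) :
    IsLocalRep R T q (‖a‖ * c) (fun t => a • F t) (fun t => a • f t) where
  supp t i := (hf.supp t i).smul a
  meas i := (hf.meas i).const_smul a
  bound t ht i := by
    rw [Pi.smul_apply, norm_smul]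
    exact mul_le_mul_of_nonneg_left (hf.bound t ht i) (norm_nonneg _)
  sum t ht := by
    simp only [Pi.smul_apply, ← Finset.smul_sum, hf.sum t ht]

theorem finset_sum {ι : Type*} (s : Finset ι) {c : ι → ℝ} {F : ι → ℝ → Op d}
    {f : ι → ℝ → Fin N → Op d} (hf : ∀ k ∈ s, IsLocalRep R T q (c k) (F k) (f k)) :
    IsLocalRep R T q (∑ k ∈ s, c k) (fun t => ∑ k ∈ s, F k t) (fun t => ∑ k ∈ s, f k t) where
  supp t i := by
    rw [Finset.sum_apply]
    exact SupportedOn.sum s fun k hk => (hf k hk).supp t i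
  meas i := by
    simp only [Finset.sum_apply]
    exact Finset.aestronglyMeasurable_fun_sum s fun k hk => (hf k hk).meas i
  bound t ht i := by
    rw [Finset.sum_apply]
    exact norm_sum_le_of_le _ fun k hk => (hf k hk).bound t ht i
  sum t ht := by
    simp only [Finset.sum_apply]
    rw [Finset.sum_comm]
    exact Finset.sum_congr rfl fun k hk => (hf k hk).sum t ht

theorem lie {p : ℕ} (h1 : 1 ≤ p) (hpq : p ≤ q) (hf : IsLocalRep R T (p - 1) c F f)
    (hf' : IsLocalRep R T (q - p) c' F' f') :
    IsLocalRep R T q (numBracket R q c c') (fun t => ⁅F t, F' t⁆)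
      (fun t => localBracket (f t) (f' t)) where
  supp t i := by
    have h := supportedOn_localBracket (hf.supp t) (hf'.supp t) i
    have e : R * (p - 1 + 1) + R * (q - p + 1) = R * (q + 1) := by
      rw [← mul_add]; congr 1; omega
    rwa [e] at h
  meas i := by
    have hA := hf.meas
    have hB := hf'.meas
    simp only [localBracket, Ring.lie_def]
    exact (Finset.aestronglyMeasurable_fun_sum _ fun j _ =>
        ((hA i).mul (hB j)).sub ((hB j).mul (hA i))).add
      (Finset.aestronglyMeasurable_fun_sum _ fun j _ =>
        ((hA j).mul (hB i)).sub ((hB i).mul (hA j)))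
  bound t ht i := by
    have h := norm_localBracket_le (hf.supp t) (hf'.supp t) (hf.bound t ht) (hf'.bound t ht) i
    have e : R * (p - 1 + 1) + R * (q - p + 1) = R * (q + 1) := by
      rw [← mul_add]; congr 1; omega
    rwa [e] at h
  sum t ht := by
    rw [sum_localBracket, hf.sum t ht, hf'.sum t ht]

/-- Local representations of graded iterated brackets. The generator is needed in degrees up to
`Q`, the other argument in degrees below `Q` only, unless there is no bracket at all. -/
theorem iterBracket {W X : ℕ → ℝ → Op d} {w x : ℕ → ℝ → Fin N → Op d} {wn xn : ℕ → ℝ} {Q : ℕ}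
    (hw : ∀ p, 1 ≤ p → p ≤ Q → IsLocalRep R T (p - 1) (wn p) (W p) (w p))
    (hx : ∀ j < Q, IsLocalRep R T j (xn j) (X j) (x j)) (k q : ℕ) (hq : q < Q ∨ q ≤ Q ∧ 1 ≤ k) :
    IsLocalRep R T q (iterBracket (numBracket R) wn xn k q)
      (fun t => iterBracket (fun _ A B => ⁅A, B⁆) (fun p => W p t) (fun j => X j t) k q)
      (fun t => Floquet.iterBracket (fun _ => localBracket) (fun p => w p t)
        (fun j => x j t) k q) := by
  induction k generalizing q with
  | zero => exact hx q (by omega)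
  | succ k ih =>
    refine finset_sum _ fun p hp => ?_
    rw [Finset.mem_Icc] at hp
    exact lie hp.1 hp.2 (hw p hp.1 (by omega)) (ih (q - p) (by omega))

theorem single (hf : IsLocalRep R T 0 c F f) (j : ℕ) :
    IsLocalRep R T j ((Pi.single 0 c : ℕ → ℝ) j) (fun t => (Pi.single 0 (F t) : ℕ → Op d) j)
      (fun t => (Pi.single 0 (f t) : ℕ → Fin N → Op d) j) := by
  by_cases hj : j = 0
  · subst hj
    simpa using hf
  · simp only [Pi.single_eq_of_ne hj]
    exact zero le_rfl

theorem intervalIntegrable (hf : IsLocalRep R T q c F f) {t : ℝ} (ht : t ∈ Set.Icc 0 T)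
    (i : Fin N) : IntervalIntegrable (fun s => f s i) volume 0 t := by
  rw [intervalIntegrable_iff_integrableOn_Ioc_of_le ht.1]
  refine Integrable.of_bound
    ((hf.meas i).mono_measure (Measure.restrict_mono (Set.Ioc_subset_Ioc_right ht.2) le_rfl)) c ?_
  refine (ae_restrict_iff' measurableSet_Ioc).mpr (Filter.Eventually.of_forall fun s hs => ?_)
  exact hf.bound s ⟨hs.1.le, hs.2.trans ht.2⟩ i

theorem integral_sum (hf : IsLocalRep R T q c F f) {t : ℝ} (ht : t ∈ Set.Icc 0 T) :
    ∫ s in (0 : ℝ)..t, F s = ∑ i, ∫ s in (0 : ℝ)..t, f s i := by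
  rw [← intervalIntegral.integral_finsetSum fun i _ => hf.intervalIntegrable ht i]
  refine intervalIntegral.integral_congr fun s hs => ?_
  rw [Set.uIcc_of_le ht.1] at hs
  exact (hf.sum s ⟨hs.1, hs.2.trans ht.2⟩).symm

theorem norm_integral_le (hf : IsLocalRep R T q c F f) (hc : 0 ≤ c) {t : ℝ}
    (ht : t ∈ Set.Icc 0 T) (i : Fin N) : ‖∫ s in (0 : ℝ)..t, f s i‖ ≤ T * c := by
  have h : ‖∫ s in (0 : ℝ)..t, f s i‖ ≤ c * |t - 0| := by
    refine intervalIntegral.norm_integral_le_of_norm_le_const fun s hs => ?_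
    rw [Set.uIoc_of_le ht.1] at hs
    exact hf.bound s ⟨hs.1.le, hs.2.trans ht.2⟩ i
  rw [sub_zero, abs_of_nonneg ht.1] at h
  calc _ ≤ c * t := h
    _ ≤ c * T := by gcongr; exact ht.2
    _ = _ := mul_comm _ _

theorem norm_timeAvg_le (hf : IsLocalRep R T q c F f) (hT : 0 < T) (hc : 0 ≤ c) (i : Fin N) :
    ‖timeAvg T fun s => f s i‖ ≤ c := by
  rw [timeAvg, norm_smul, norm_inv, Real.norm_of_nonneg hT.le]
  calc _ ≤ T⁻¹ * (T * c) := by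
        gcongr
        exact hf.norm_integral_le hc ⟨hT.le, le_rfl⟩ i
    _ = c := by field_simp

theorem sum_timeAvg (hf : IsLocalRep R T q c F f) (hT : 0 < T) :
    ∑ i, timeAvg T (fun s => f s i) = timeAvg T F := by
  simp only [timeAvg]
  rw [hf.integral_sum ⟨hT.le, le_rfl⟩, Finset.smul_sum]

theorem supportedOn_timeAvg (hf : IsLocalRep R T q c F f) (i : Fin N) :
    SupportedOn (window i (R * (q + 1))) (timeAvg T fun s => f s i) :=
  (SupportedOn.intervalIntegral (fun t => hf.supp t i) 0 T).real_smul _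

theorem oscPart (hf : IsLocalRep R T q c F f) (hT : 0 < T) (hc : 0 ≤ c) :
    IsLocalRep R T q (2 * c) (fun t => oscPart T F t)
      (fun t i => Floquet.oscPart T (fun s => f s i) t) where
  supp t i := (hf.supp t i).sub (hf.supportedOn_timeAvg i)
  meas i := (hf.meas i).sub aestronglyMeasurable_const
  bound t ht i := by
    calc _ ≤ ‖f t i‖ + ‖timeAvg T fun s => f s i‖ := norm_sub_le _ _
      _ ≤ c + c := add_le_add (hf.bound t ht i) (hf.norm_timeAvg_le hT hc i)
      _ = 2 * c := by ring
  sum t ht := by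
    simp only [Floquet.oscPart, Finset.sum_sub_distrib, hf.sum t ht, hf.sum_timeAvg hT]

theorem primitive (hf : IsLocalRep R T q c F f) (hT : 0 < T) (hc : 0 ≤ c) :
    IsLocalRep R T q (T * c) (fun t => ∫ s in (0 : ℝ)..t, F s)
      (fun t i => ∫ s in (0 : ℝ)..t, f s i) where
  supp t i := SupportedOn.intervalIntegral (fun t => hf.supp t i) 0 t
  meas i := by
    have h := hf.intervalIntegrable ⟨hT.le, le_rfl⟩ i
    have h' : IntegrableOn (fun s => f s i) (Set.uIcc 0 T) := by
      rw [Set.uIcc_of_le hT.le]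
      exact (integrableOn_Icc_iff_integrableOn_Ioc (by simp)).mpr
        ((intervalIntegrable_iff_integrableOn_Ioc_of_le hT.le).mp h)
    have hc := intervalIntegral.continuousOn_primitive_interval h'
    rw [Set.uIcc_of_le hT.le] at hc
    exact (hc.mono Set.Ioc_subset_Icc_self).aestronglyMeasurable measurableSet_Ioc
  bound t ht i := hf.norm_integral_le hc ht i
  sum t ht := (hf.integral_sum ht).symm

theorem domegaOf {G : ℕ → ℝ → Op d} {g : ℕ → ℝ → Fin N → Op d} {p : ℕ}
    (hf : IsLocalRep R T (p - 1) c (G (p - 1)) (g (p - 1))) (hT : 0 < T) (hc : 0 ≤ c) :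
    IsLocalRep R T (p - 1) (2 * c) (domegaOf T G p)
      (fun t i => Floquet.domegaOf T (fun q s => g q s i) p t) := by
  have h := (hf.oscPart hT hc).smul (-Complex.I)
  rwa [norm_neg, Complex.norm_I, one_mul] at h

theorem omegaOf {G : ℕ → ℝ → Op d} {g : ℕ → ℝ → Fin N → Op d} {p : ℕ}
    (hf : IsLocalRep R T (p - 1) c (G (p - 1)) (g (p - 1))) (hT : 0 < T) (hc : 0 ≤ c) :
    IsLocalRep R T (p - 1) (2 * T * c) (omegaOf T G p)
      (fun t i => Floquet.omegaOf T (fun q s => g q s i) p t) := by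
  have h := ((hf.oscPart hT hc).primitive hT (by positivity)).smul (-Complex.I)
  rw [norm_neg, Complex.norm_I, one_mul, ← mul_assoc, mul_comm T 2] at h
  exact h

/-- The local norm of a contribution to the transformed Hamiltonian is at most its numerical
majorant. -/
theorem frameTerm {h : ℝ} {H : ℝ → Op d} {x : ℝ → Fin N → Op d} {G : ℕ → ℝ → Op d}
    {g : ℕ → ℝ → Fin N → Op d} {γ : ℕ → ℝ} {Q : ℕ} (hT : 0 < T)
    (hγ : ∀ q, 0 ≤ γ q) (hH : IsLocalRep R T 0 (2 * h) H x)
    (hg : ∀ j < Q, IsLocalRep R T j (γ j) (G j) (g j)) (k q : ℕ) (hq : q < Q ∨ q ≤ Q ∧ 1 ≤ k) :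
    IsLocalRep R T q (majTerm R h T γ k q)
      (fun t => frameTerm (fun A B => ⁅A, B⁆) (fun p => Floquet.omegaOf T G p t)
        (Pi.single 0 (H t)) (fun j => Floquet.domegaOf T G (j + 1) t) k q)
      (fun t => Floquet.frameTerm localBracket
        (fun p i => Floquet.omegaOf T (fun q s => g q s i) p t)
        (Pi.single 0 (x t))
        (fun j i => Floquet.domegaOf T (fun q s => g q s i) (j + 1) t) k q) := by
  have hw : ∀ p, 1 ≤ p → p ≤ Q → IsLocalRep R T (p - 1) (2 * T * γ (p - 1)) _ _ :=
    fun p h1 h2 => (hg (p - 1) (by omega)).omegaOf hT (hγ _)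
  have h1 := (iterBracket (w := fun p t i => Floquet.omegaOf T (fun q s => g q s i) p t)
    (wn := fun p => 2 * T * γ (p - 1)) hw (fun j _ => hH.single j) k q hq).smul (coefH k)
  have h2 := (iterBracket (w := fun p t i => Floquet.omegaOf T (fun q s => g q s i) p t)
    (x := fun j t i => Floquet.domegaOf T (fun q s => g q s i) (j + 1) t)
    (wn := fun p => 2 * T * γ (p - 1)) (xn := fun j => 2 * γ j) hw
    (fun j hj => (hg j hj).domegaOf (p := j + 1) hT (hγ _)) k q hq).smul (coefD k)
  have h3 := h1.add h2
  rw [norm_coefH, norm_coefD] at h3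
  exact h3

end IsLocalRep

end LocalRep

/-! ### Regularity and Hermiticity of the generators -/

section Regular

variable {N : ℕ} {d : Fin N → ℕ}

theorem iterBracket_mem {S : Submodule ℂ (ℝ → Op d)}
    (hlie : ∀ F ∈ S, ∀ F' ∈ S, (fun t => ⁅F t, F' t⁆) ∈ S) {W X : ℕ → ℝ → Op d}
    {Q : ℕ} (hW : ∀ p, 1 ≤ p → p ≤ Q → W p ∈ S) (hX : ∀ j < Q, X j ∈ S) (k q : ℕ)
    (hq : q < Q ∨ q ≤ Q ∧ 1 ≤ k) :
    (fun t => iterBracket (fun _ A B => ⁅A, B⁆) (fun p => W p t) (fun j => X j t) k q) ∈ S := by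
  induction k generalizing q with
  | zero => exact hX q (by omega)
  | succ k ih =>
    have h : (fun t => iterBracket (fun _ A B => ⁅A, B⁆) (fun p => W p t) (fun j => X j t)
        (k + 1) q) = ∑ p ∈ Finset.Icc 1 q, fun t => ⁅W p t,
          iterBracket (fun _ A B => ⁅A, B⁆) (fun p => W p t) (fun j => X j t) k (q - p)⁆ := by
      funext t
      rw [Finset.sum_apply]
      rfl
    rw [h]
    refine S.sum_mem fun p hp => ?_
    rw [Finset.mem_Icc] at hp
    exact hlie _ (hW p hp.1 (by omega)) _ (ih (q - p) (by omega))

/-- Properties of functions of time which are stable under linear combinations and commutators are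
inherited by the operators of the recursion. -/
theorem nextG_mem {S : Submodule ℂ (ℝ → Op d)}
    (hlie : ∀ F ∈ S, ∀ F' ∈ S, (fun t => ⁅F t, F' t⁆) ∈ S) {T : ℝ} {H : ℝ → Op d}
    {G : ℕ → ℝ → Op d} {q : ℕ} (hH : H ∈ S) (hΩ : ∀ p, 1 ≤ p → p ≤ q → omegaOf T G p ∈ S)
    (hD : ∀ j < q, domegaOf T G (j + 1) ∈ S) : nextG T H G q ∈ S := by
  have hs : ∀ j, (fun t => (Pi.single 0 (H t) : ℕ → Op d) j) ∈ S := fun j => by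
    by_cases hj : j = 0
    · subst hj
      simpa using hH
    · simp only [Pi.single_eq_of_ne hj]
      exact S.zero_mem
  have h : nextG T H G q = ∑ k ∈ Finset.Icc 1 q,
      (coefH k • (fun t => iterBracket (fun _ A B => ⁅A, B⁆) (fun p => omegaOf T G p t)
        (Pi.single 0 (H t)) k q) +
      coefD k • (fun t => iterBracket (fun _ A B => ⁅A, B⁆) (fun p => omegaOf T G p t)
        (fun j => domegaOf T G (j + 1) t) k q)) := by
    funext t
    rw [nextG_eq_sum_frameTerm, Finset.sum_apply]
    rfl
  rw [h]
  refine S.sum_mem fun k hk => ?_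
  have hk1 := (Finset.mem_Icc.mp hk).1
  exact S.add_mem
    (S.smul_mem _ (iterBracket_mem hlie hΩ (fun j _ => hs j) k q (Or.inr ⟨le_rfl, hk1⟩)))
    (S.smul_mem _ (iterBracket_mem hlie hΩ hD k q (Or.inr ⟨le_rfl, hk1⟩)))

/-- The bounded measurable `T`-periodic functions of time. -/
def regularSubmodule (d : Fin N → ℕ) (T : ℝ) : Submodule ℂ (ℝ → Op d) where
  carrier := {F | Function.Periodic F T ∧ AEStronglyMeasurable F volume ∧ ∃ C, ∀ t, ‖F t‖ ≤ C}
  zero_mem' := ⟨fun _ => rfl, aestronglyMeasurable_const, 0, by simp⟩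
  add_mem' := by
    rintro F F' ⟨h1, h2, C, h3⟩ ⟨h1', h2', C', h3'⟩
    exact ⟨h1.add h1', h2.add h2', C + C', fun t =>
      (norm_add_le _ _).trans (add_le_add (h3 t) (h3' t))⟩
  smul_mem' := by
    rintro c F ⟨h1, h2, C, h3⟩
    exact ⟨h1.smul c, h2.const_smul c, ‖c‖ * C, fun t => by
      rw [Pi.smul_apply, norm_smul]
      exact mul_le_mul_of_nonneg_left (h3 t) (norm_nonneg _)⟩

variable {T : ℝ} {F F' : ℝ → Op d}

theorem lie_mem_regularSubmodule (hF : F ∈ regularSubmodule d T)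
    (hF' : F' ∈ regularSubmodule d T) : (fun t => ⁅F t, F' t⁆) ∈ regularSubmodule d T := by
  obtain ⟨h1, h2, C, h3⟩ := hF
  obtain ⟨h1', h2', C', h3'⟩ := hF'
  refine ⟨fun t => ?_, ?_, 2 * C * C', fun t => (norm_lie_le_two_mul _ _).trans ?_⟩
  · dsimp only
    rw [h1 t, h1' t]
  · simp only [Ring.lie_def]
    exact (h2.mul h2').sub (h2'.mul h2)
  · have := (norm_nonneg _).trans (h3 t)
    gcongr
    · exact h3 t
    · exact h3' t

theorem intervalIntegrable_of_mem_regularSubmodule (hF : F ∈ regularSubmodule d T) (a b : ℝ) :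
    IntervalIntegrable F volume a b := by
  obtain ⟨-, h2, C, h3⟩ := hF
  rw [intervalIntegrable_iff]
  have : IsFiniteMeasure (volume.restrict (Set.uIoc a b)) := by
    rw [Set.uIoc]
    infer_instance
  exact Integrable.of_bound h2.restrict C (Filter.Eventually.of_forall h3)

theorem locallyIntegrable_of_mem_regularSubmodule (hF : F ∈ regularSubmodule d T) :
    LocallyIntegrable F volume := by
  obtain ⟨-, h2, C, h3⟩ := hF
  exact fun x => ⟨Metric.ball x 1, Metric.ball_mem_nhds x one_pos,
    haveI : IsFiniteMeasure (volume.restrict (Metric.ball x (1 : ℝ))) :=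
      ⟨by rw [Measure.restrict_apply_univ]; exact measure_ball_lt_top⟩
    Integrable.of_bound h2.restrict C (Filter.Eventually.of_forall h3)⟩

theorem const_mem_regularSubmodule (A : Op d) : (fun _ => A) ∈ regularSubmodule d T :=
  ⟨fun _ => rfl, aestronglyMeasurable_const, ‖A‖, fun _ => le_rfl⟩

theorem oscPart_mem_regularSubmodule (hF : F ∈ regularSubmodule d T) :
    oscPart T F ∈ regularSubmodule d T :=
  (regularSubmodule d T).sub_mem hF (const_mem_regularSubmodule _)

theorem integral_oscPart (hT : 0 < T) (hF : F ∈ regularSubmodule d T) :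
    ∫ t in (0 : ℝ)..T, oscPart T F t = 0 := by
  simp only [oscPart]
  rw [intervalIntegral.integral_sub (intervalIntegrable_of_mem_regularSubmodule hF _ _)
    (intervalIntegrable_const), intervalIntegral.integral_const, timeAvg, sub_zero, smul_smul,
    mul_inv_cancel₀ hT.ne', one_smul, sub_self]

theorem dist_primitive_le {C : ℝ} (hC : ∀ t, ‖F t‖ ≤ C) (hF : F ∈ regularSubmodule d T)
    (s t : ℝ) : ‖(∫ x in (0 : ℝ)..t, F x) - ∫ x in (0 : ℝ)..s, F x‖ ≤ C * |t - s| := by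
  rw [intervalIntegral.integral_interval_sub_left
    (intervalIntegrable_of_mem_regularSubmodule hF _ _)
    (intervalIntegrable_of_mem_regularSubmodule hF _ _)]
  exact intervalIntegral.norm_integral_le_of_norm_le_const fun x _ => hC x

theorem primitive_mem_regularSubmodule (hT : 0 < T) (hF : F ∈ regularSubmodule d T)
    (h0 : ∫ t in (0 : ℝ)..T, F t = 0) :
    (fun t => ∫ x in (0 : ℝ)..t, F x) ∈ regularSubmodule d T := by
  obtain ⟨C, hC⟩ := hF.2.2
  have hC0 : 0 ≤ C := (norm_nonneg _).trans (hC 0)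
  have hcont : Continuous fun t => ∫ x in (0 : ℝ)..t, F x :=
    intervalIntegral.continuous_primitive (intervalIntegrable_of_mem_regularSubmodule hF) 0
  have hper : Function.Periodic (fun t => ∫ x in (0 : ℝ)..t, F x) T := fun t => by
    dsimp only
    rw [← intervalIntegral.integral_add_adjacent_intervals
      (intervalIntegrable_of_mem_regularSubmodule hF 0 t)
      (intervalIntegrable_of_mem_regularSubmodule hF t (t + T)),
      hF.1.intervalIntegral_add_eq t 0, zero_add, h0, add_zero]
  refine ⟨hper, hcont.aestronglyMeasurable, C * T, fun t => ?_⟩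
  obtain ⟨y, hy, hty⟩ := hper.exists_mem_Ico₀ hT t
  change ‖∫ x in (0 : ℝ)..t, F x‖ ≤ C * T
  rw [hty]
  have h := dist_primitive_le hC hF 0 y
  rw [intervalIntegral.integral_same, sub_zero, sub_zero, abs_of_nonneg hy.1] at h
  exact h.trans (by gcongr; exact hy.2.le)

theorem domegaOf_mem_regularSubmodule {G : ℕ → ℝ → Op d} {p : ℕ}
    (hG : G (p - 1) ∈ regularSubmodule d T) : domegaOf T G p ∈ regularSubmodule d T :=
  (regularSubmodule d T).smul_mem _ (oscPart_mem_regularSubmodule hG)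

theorem omegaOf_mem_regularSubmodule (hT : 0 < T) {G : ℕ → ℝ → Op d} {p : ℕ}
    (hG : G (p - 1) ∈ regularSubmodule d T) : omegaOf T G p ∈ regularSubmodule d T :=
  (regularSubmodule d T).smul_mem _ (primitive_mem_regularSubmodule hT
    (oscPart_mem_regularSubmodule hG) (integral_oscPart hT hG))

theorem opG_mem_regularSubmodule (hT : 0 < T) {H : ℝ → Op d} (hH : H ∈ regularSubmodule d T)
    (q : ℕ) : opG T H q ∈ regularSubmodule d T := by
  induction q using Nat.strong_induction_on with
  | _ q ih =>
    by_cases hq : q = 0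
    · subst hq
      exact hH
    · rw [opG_eq T H q (by omega)]
      exact nextG_mem (fun F hF F' hF' => lie_mem_regularSubmodule hF hF') hH
        (fun p h1 h2 => omegaOf_mem_regularSubmodule hT (ih (p - 1) (by omega)))
        (fun j hj => domegaOf_mem_regularSubmodule (p := j + 1) (ih j hj))

/-- The functions of time that are continuous at `t`. -/
def continuousAtSubmodule (d : Fin N → ℕ) (t : ℝ) : Submodule ℂ (ℝ → Op d) where
  carrier := {F | ContinuousAt F t}
  zero_mem' := continuousAt_const
  add_mem' h h' := ContinuousAt.add h h'
  smul_mem' c _ h := ContinuousAt.const_smul h c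

theorem lipschitz_omegaOf {G : ℕ → ℝ → Op d} {p : ℕ} (hG : G (p - 1) ∈ regularSubmodule d T) :
    ∃ K : NNReal, LipschitzWith K (omegaOf T G p) := by
  have h := oscPart_mem_regularSubmodule hG
  obtain ⟨C, hC⟩ := h.2.2
  refine ⟨C.toNNReal, LipschitzWith.of_dist_le_mul fun t s => ?_⟩
  rw [dist_eq_norm, Real.dist_eq, Real.coe_toNNReal C ((norm_nonneg _).trans (hC 0)), omegaOf,
    omegaOf, ← smul_sub, norm_smul, norm_neg, Complex.norm_I, one_mul]
  exact dist_primitive_le hC h s t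

theorem opG_continuousAt (hT : 0 < T) {H : ℝ → Op d} (hH : H ∈ regularSubmodule d T) {t : ℝ}
    (ht : ContinuousAt H t) (q : ℕ) : ContinuousAt (opG T H q) t := by
  induction q using Nat.strong_induction_on with
  | _ q ih =>
    by_cases hq : q = 0
    · subst hq
      exact ht
    · rw [opG_eq T H q (by omega)]
      refine nextG_mem (S := continuousAtSubmodule d t) (fun F hF F' hF' => ?_) ht
        (fun p _ _ => ?_) (fun j hj => ?_)
      · change ContinuousAt (fun s => ⁅F s, F' s⁆) t
        simp only [Ring.lie_def]
        exact (ContinuousAt.mul hF hF').sub (ContinuousAt.mul hF' hF)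
      · obtain ⟨K, hK⟩ := lipschitz_omegaOf (p := p) (opG_mem_regularSubmodule hT hH (p - 1))
        exact hK.continuous.continuousAt
      · exact ((ih j hj).sub continuousAt_const).const_smul (-Complex.I)

theorem ae_hasDerivAt_omegaOf {G : ℕ → ℝ → Op d} {p : ℕ}
    (hG : G (p - 1) ∈ regularSubmodule d T) :
    ∀ᵐ t, HasDerivAt (omegaOf T G p) (domegaOf T G p t) t := by
  filter_upwards [LocallyIntegrable.ae_hasDerivAt_integral
    (locallyIntegrable_of_mem_regularSubmodule (oscPart_mem_regularSubmodule hG))] with t ht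
  exact (ht 0).const_smul (-Complex.I)

theorem hasDerivAt_omegaOf {G : ℕ → ℝ → Op d} {p : ℕ}
    (hG : G (p - 1) ∈ regularSubmodule d T) {t : ℝ} (ht : ContinuousAt (G (p - 1)) t) :
    HasDerivAt (omegaOf T G p) (domegaOf T G p t) t := by
  have h := oscPart_mem_regularSubmodule hG
  have h1 : ContinuousAt (oscPart T (G (p - 1))) t := ht.sub continuousAt_const
  exact (intervalIntegral.integral_hasDerivAt_right
    (intervalIntegrable_of_mem_regularSubmodule h 0 t)
    h.2.1.stronglyMeasurableAtFilter h1).const_smul (-Complex.I)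

end Regular

section Hermitian

variable {N : ℕ} {d : Fin N → ℕ}

theorem star_lie_of_star_eq {A B : Op d} {ε : ℂ} (hA : star A = -A) (hB : star B = ε • B) :
    star ⁅A, B⁆ = ε • ⁅A, B⁆ := by
  rw [Ring.lie_def, star_sub, star_mul, star_mul, hA, hB]
  simp only [smul_mul_assoc, mul_smul_comm, mul_neg, neg_mul, smul_sub, smul_neg]
  abel

/-- Brackets with skew-Hermitian generators preserve Hermitian (`ε = 1`) and skew-Hermitian
(`ε = -1`) operators. -/
theorem star_iterBracket {W X : ℕ → Op d} {ε : ℂ} {q k : ℕ} (hk : 1 ≤ k)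
    (hW : ∀ p, 1 ≤ p → p ≤ q → star (W p) = -W p) (hX : ∀ j < q, star (X j) = ε • X j) :
    star (iterBracket (fun _ A B => ⁅A, B⁆) W X k q) =
      ε • iterBracket (fun _ A B => ⁅A, B⁆) W X k q := by
  suffices ∀ k q', (q' < q ∨ q' ≤ q ∧ 1 ≤ k) →
      star (iterBracket (fun _ A B => ⁅A, B⁆) W X k q') =
        ε • iterBracket (fun _ A B => ⁅A, B⁆) W X k q' from this k q (Or.inr ⟨le_rfl, hk⟩)
  intro k
  induction k with
  | zero => exact fun q' hq => hX q' (by omega)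
  | succ k ih =>
    intro q' hq
    rw [iterBracket, star_sum, Finset.smul_sum]
    refine Finset.sum_congr rfl fun p hp => ?_
    rw [Finset.mem_Icc] at hp
    exact star_lie_of_star_eq (hW p hp.1 (by omega)) (ih _ (by omega))

theorem star_coefH (k : ℕ) : star (coefH k) = coefH k := by
  simp [coefH]

theorem star_coefD (k : ℕ) : star (coefD k) = -coefD k := by
  simp [coefD]

theorem star_intervalIntegral {F : ℝ → Op d} (a b : ℝ) :
    star (∫ t in a..b, F t) = ∫ t in a..b, star (F t) := by
  by_cases hF : IntervalIntegrable F volume a b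
  · exact ((starL' ℝ : Op d ≃L[ℝ] Op d).toContinuousLinearMap.intervalIntegral_comp_comm hF).symm
  · rw [intervalIntegral.integral_undef hF, intervalIntegral.integral_undef, star_zero]
    intro h
    refine hF ?_
    have h' := fun s (hs : IntegrableOn (fun t => star (F t)) s volume) =>
      (starL' ℝ : Op d ≃L[ℝ] Op d).toContinuousLinearMap.integrable_comp hs
    exact ⟨by simpa [IntegrableOn] using h' _ h.1, by simpa [IntegrableOn] using h' _ h.2⟩

variable {T : ℝ} {F : ℝ → Op d}

theorem star_timeAvg (hF : ∀ t, star (F t) = F t) : star (timeAvg T F) = timeAvg T F := by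
  simp only [timeAvg, star_smul, star_intervalIntegral, hF, star_trivial]

theorem star_oscPart (hF : ∀ t, star (F t) = F t) (t : ℝ) :
    star (oscPart T F t) = oscPart T F t := by
  rw [oscPart, star_sub, hF, star_timeAvg hF]

theorem star_domegaOf {G : ℕ → ℝ → Op d} {p : ℕ} (hG : ∀ t, star (G (p - 1) t) = G (p - 1) t)
    (t : ℝ) : star (domegaOf T G p t) = -domegaOf T G p t := by
  simp [domegaOf, star_smul, star_oscPart hG]

theorem star_omegaOf {G : ℕ → ℝ → Op d} {p : ℕ} (hG : ∀ t, star (G (p - 1) t) = G (p - 1) t)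
    (t : ℝ) : star (omegaOf T G p t) = -omegaOf T G p t := by
  simp [omegaOf, star_smul, star_intervalIntegral, star_oscPart hG]

theorem star_opG {H : ℝ → Op d} (hH : ∀ t, star (H t) = H t) (q : ℕ) (t : ℝ) :
    star (opG T H q t) = opG T H q t := by
  induction q using Nat.strong_induction_on generalizing t with
  | _ q ih =>
    by_cases hq : q = 0
    · subst hq
      exact hH t
    · rw [opG_eq T H q (by omega), nextG_eq_sum_frameTerm, star_sum]
      refine Finset.sum_congr rfl fun k hk => ?_
      have hk1 := (Finset.mem_Icc.mp hk).1
      have hΩ : ∀ p, 1 ≤ p → p ≤ q →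
          star (omegaOf T (opG T H) p t) = -omegaOf T (opG T H) p t :=
        fun p h1 h2 => star_omegaOf (fun s => ih (p - 1) (by omega) s) t
      rw [frameTerm, star_add, star_smul, star_smul, star_coefH, star_coefD,
        star_iterBracket (ε := 1) hk1 hΩ (fun j _ => by
          by_cases hj : j = 0
          · subst hj
            simp [hH t]
          · simp [Pi.single_eq_of_ne hj]),
        star_iterBracket (ε := -1) hk1 hΩ (fun j hj => by
          rw [neg_one_smul]
          exact star_domegaOf (p := j + 1) (fun s => ih j hj s) t)]
      simp

end Hermitian

/-! ### Interval decompositions -/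

section Intervals

variable {N : ℕ} {d : Fin N → ℕ} {κ : ℝ}

/-- `A` has an interval decomposition of weighted norm at most `c`; the bound is stated site by
site, which also makes sense for the empty chain. -/
def HasIntervalBound (κ : ℝ) (A : Op d) (c : ℝ) : Prop :=
  ∃ Φ : Fin N → Fin N → Op d, IsIntervalSum A Φ ∧
    ∀ i, ∑ a ∈ Finset.Iic i, ∑ b ∈ Finset.Ici i,
      ‖Φ a b‖ * Real.exp (κ * ((Finset.Icc a b).card : ℝ)) ≤ c

theorem HasIntervalBound.exists_weightedNorm_le {A : Op d} {c : ℝ} (h : HasIntervalBound κ A c)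
    (hc : 0 ≤ c) : ∃ Φ, IsIntervalSum A Φ ∧ weightedNorm κ Φ ≤ c := by
  obtain ⟨Φ, h1, h2⟩ := h
  exact ⟨Φ, h1, Real.iSup_le h2 hc⟩

theorem HasIntervalBound.mono {A : Op d} {c c' : ℝ} (h : HasIntervalBound κ A c) (hc : c ≤ c') :
    HasIntervalBound κ A c' := by
  obtain ⟨Φ, h1, h2⟩ := h
  exact ⟨Φ, h1, fun i => (h2 i).trans hc⟩

/-- Interval decompositions can be superposed. -/
theorem HasIntervalBound.hasSum (hκ : 0 ≤ κ) {ι : Type*} {A : ι → Op d} {c : ι → ℝ} {A' : Op d}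
    {c' : ℝ} (h : ∀ k, HasIntervalBound κ (A k) (c k)) (hA : HasSum A A') (hc : HasSum c c') :
    HasIntervalBound κ A' c' := by
  choose Φ h1 h2 using h
  have hw : ∀ a b : Fin N, 1 ≤ Real.exp (κ * ((Finset.Icc a b).card : ℝ)) := fun a b =>
    Real.one_le_exp (by positivity)
  have hle : ∀ a b, a ≤ b → ∀ k, ‖Φ k a b‖ ≤ c k := by
    intro a b hab k
    refine le_trans ?_ (h2 k a)
    have e1 : ‖Φ k a b‖ ≤ ‖Φ k a b‖ * Real.exp (κ * ((Finset.Icc a b).card : ℝ)) :=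
      le_mul_of_one_le_right (norm_nonneg _) (hw a b)
    have e2 := Finset.single_le_sum (f := fun b =>
      ‖Φ k a b‖ * Real.exp (κ * ((Finset.Icc a b).card : ℝ))) (fun b _ => by positivity)
      (Finset.mem_Ici.mpr hab)
    have e3 := Finset.single_le_sum (f := fun a' => ∑ b ∈ Finset.Ici a,
      ‖Φ k a' b‖ * Real.exp (κ * ((Finset.Icc a' b).card : ℝ)))
      (fun a' _ => Finset.sum_nonneg fun b _ => by positivity)
      (Finset.mem_Iic.mpr (le_refl a))
    exact e1.trans (e2.trans e3)
  have hsn : ∀ a b, a ≤ b → Summable fun k => ‖Φ k a b‖ := fun a b hab =>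
    hc.summable.of_nonneg_of_le (fun _ => norm_nonneg _) (hle a b hab)
  refine ⟨fun a b => ∑' k, Φ k a b, ⟨fun a b hab => SupportedOn.tsum fun k => (h1 k).1 a b hab,
    ?_⟩, fun i => ?_⟩
  · refine hA.unique ?_
    rw [show A = fun k => ∑ a, ∑ b ∈ Finset.Ici a, Φ k a b from funext fun k => (h1 k).2]
    exact hasSum_sum fun a _ => hasSum_sum fun b hb =>
      (hsn a b (Finset.mem_Ici.mp hb)).of_norm.hasSum
  · have hs : HasSum (fun k => ∑ a ∈ Finset.Iic i, ∑ b ∈ Finset.Ici i,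
        ‖Φ k a b‖ * Real.exp (κ * ((Finset.Icc a b).card : ℝ)))
        (∑ a ∈ Finset.Iic i, ∑ b ∈ Finset.Ici i,
          (∑' k, ‖Φ k a b‖) * Real.exp (κ * ((Finset.Icc a b).card : ℝ))) :=
      hasSum_sum fun a ha => hasSum_sum fun b hb =>
        (hsn a b ((Finset.mem_Iic.mp ha).trans (Finset.mem_Ici.mp hb))).hasSum.mul_right _
    refine le_trans ?_ (hasSum_le (fun k => h2 k i) hs hc)
    refine Finset.sum_le_sum fun a ha => Finset.sum_le_sum fun b hb => ?_
    gcongr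
    exact norm_tsum_le_tsum_norm (hsn a b ((Finset.mem_Iic.mp ha).trans (Finset.mem_Ici.mp hb)))

theorem HasIntervalBound.sum (hκ : 0 ≤ κ) {ι : Type*} (s : Finset ι) {A : ι → Op d} {c : ι → ℝ}
    (h : ∀ k ∈ s, HasIntervalBound κ (A k) (c k)) :
    HasIntervalBound κ (∑ k ∈ s, A k) (∑ k ∈ s, c k) := by
  rw [← Finset.sum_coe_sort, ← Finset.sum_coe_sort s c]
  exact HasIntervalBound.hasSum (ι := s) hκ (fun k => h k k.2) (hasSum_fintype _)
    (hasSum_fintype _)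

theorem card_filter_lt_add_le (i : Fin N) (m : ℕ) :
    ((Finset.Iic i).filter fun a : Fin N => i.val < a.val + m).card ≤ m := by
  calc _ ≤ (Finset.Ico (i.val + 1 - m) (i.val + 1)).card :=
        Finset.card_le_card_of_injOn Fin.val (fun a ha => by
          simp only [Finset.coe_filter, Finset.mem_Iic, Set.mem_ofPred_eq, Fin.le_def] at ha
          simp only [Finset.coe_Ico, Set.mem_Ico]
          omega) Fin.val_injective.injOn
    _ ≤ m := by rw [Nat.card_Ico]; omega

/-- The last site of the window of length `m` that starts at `a`. -/
def windowEnd (a : Fin N) (m : ℕ) : Fin N := ⟨min (a.val + m - 1) (N - 1), by have := a.2; omega⟩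

theorem window_eq_Icc (a : Fin N) {m : ℕ} (hm : 1 ≤ m) :
    window a m = Finset.Icc a (windowEnd a m) := by
  ext j
  rw [mem_window, Finset.mem_Icc, Fin.le_def, Fin.le_def, windowEnd]
  have := j.2
  dsimp only
  omega

theorem le_windowEnd (a : Fin N) {m : ℕ} (hm : 1 ≤ m) : a ≤ windowEnd a m := by
  have := a.2
  rw [Fin.le_def, windowEnd]
  dsimp only
  omega

/-- A sum of local terms is an interval decomposition: every site lies in at most `m` windows of
length `m`. -/
theorem HasIntervalBound.of_local (hκ : 0 ≤ κ) {m : ℕ} (hm : 1 ≤ m) {f : Fin N → Op d} {b : ℝ}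
    (hf : ∀ i, SupportedOn (window i m) (f i)) (hb : ∀ i, ‖f i‖ ≤ b) :
    HasIntervalBound κ (∑ i, f i) (m * Real.exp (κ * m) * b) := by
  refine ⟨fun a c => if c = windowEnd a m then f a else 0, ⟨fun a c _ => ?_, ?_⟩, fun i => ?_⟩
  · beta_reduce
    split_ifs with h
    · rw [h, ← window_eq_Icc a hm]
      exact hf a
    · exact SupportedOn.zero _
  · refine Finset.sum_congr rfl fun a _ => ?_
    rw [Finset.sum_ite_eq', if_pos (Finset.mem_Ici.mpr (le_windowEnd a hm))]
  · have hb0 : 0 ≤ b := (norm_nonneg _).trans (hb i)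
    have h1 : ∀ a ∈ Finset.Iic i, ∑ c ∈ Finset.Ici i,
        ‖(if c = windowEnd a m then f a else 0 : Op d)‖ *
          Real.exp (κ * ((Finset.Icc a c).card : ℝ)) ≤
        if i.val < a.val + m then b * Real.exp (κ * m) else 0 := by
      intro a _
      have e : ∀ c, ‖(if c = windowEnd a m then f a else 0 : Op d)‖ *
          Real.exp (κ * ((Finset.Icc a c).card : ℝ)) = if c = windowEnd a m then
            ‖f a‖ * Real.exp (κ * ((Finset.Icc a (windowEnd a m)).card : ℝ)) else 0 := fun c => by
        split_ifs with h
        · rw [h]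
        · simp
      simp only [e]
      rw [Finset.sum_ite_eq']
      by_cases h : i.val < a.val + m
      · rw [if_pos h]
        have hcard : ((Finset.Icc a (windowEnd a m)).card : ℝ) ≤ m := by
          rw [← window_eq_Icc a hm]
          exact_mod_cast card_window_le a m
        split_ifs
        · gcongr
          exact hb a
        · positivity
      · rw [if_neg h, if_neg]
        rw [Finset.mem_Ici, Fin.le_def, windowEnd]
        have := i.2
        dsimp only
        omega
    refine (Finset.sum_le_sum h1).trans ?_
    rw [← Finset.sum_filter, Finset.sum_const, nsmul_eq_mul]
    calc _ ≤ (m : ℝ) * (b * Real.exp (κ * m)) := by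
          gcongr
          exact_mod_cast card_filter_lt_add_le i m
      _ = _ := by ring

/-- The commutator with a sum of local terms is extensive: an interval `I` meets at most
`|I| + m` windows of length `m`. -/
theorem HasIntervalBound.norm_lie_le (hκ : 0 ≤ κ) {A : Op d} {c : ℝ}
    (hA : HasIntervalBound κ A c) {m : ℕ} (hm : 1 ≤ m) {B : Fin N → Op d} {b : ℝ} (hb0 : 0 ≤ b)
    (hB : ∀ i, SupportedOn (window i m) (B i)) (hb : ∀ i, ‖B i‖ ≤ b) :
    ‖⁅A, ∑ j, B j⁆‖ ≤ N * (c * (4 * m * b)) := by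
  obtain ⟨Φ, ⟨h1, h2⟩, h3⟩ := hA
  have hone : ∀ a e, a ≤ e → ‖⁅Φ a e, ∑ j, B j⁆‖ ≤
      ((Finset.Icc a e).card : ℝ) * ‖Φ a e‖ * (4 * m * b) := by
    intro a e hae
    have hsum : ⁅Φ a e, ∑ j, B j⁆ = ∑ j ∈ Finset.univ.filter
        (fun j : Fin N => j.val ≤ e.val ∧ a.val < j.val + m), ⁅Φ a e, B j⁆ := by
      rw [lie_finset_sum]
      refine (Finset.sum_filter_of_ne fun j _ hne => ?_).symm
      by_contra hj
      refine hne ((h1 a e hae).lie_eq_zero ?_ (hB j))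
      rw [Finset.disjoint_left]
      intro x hx hx'
      rw [Finset.mem_Icc, Fin.le_def, Fin.le_def] at hx
      rw [mem_window] at hx'
      omega
    have hIcc : (Finset.Icc a e).card = e.val + 1 - a.val := Fin.card_Icc a e
    have hcard : (Finset.univ.filter
        (fun j : Fin N => j.val ≤ e.val ∧ a.val < j.val + m)).card ≤
        2 * (Finset.Icc a e).card * m := by
      calc _ ≤ (Finset.Ico (a.val + 1 - m) (e.val + 1)).card :=
            Finset.card_le_card_of_injOn Fin.val (fun j hj => by
              simp only [Finset.coe_filter, Finset.mem_univ, true_and, Set.mem_ofPred_eq] at hj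
              simp only [Finset.coe_Ico, Set.mem_Ico]
              omega) Fin.val_injective.injOn
        _ ≤ (Finset.Icc a e).card + m := by
            rw [Nat.card_Ico, hIcc]
            omega
        _ ≤ 2 * (Finset.Icc a e).card * m := by
            have : 1 ≤ (Finset.Icc a e).card := by
              rw [hIcc]
              rw [Fin.le_def] at hae
              omega
            nlinarith
    rw [hsum]
    refine (norm_sum_le_of_le _ (fun j _ => (norm_lie_le_two_mul (Φ a e) (B j)).trans
      (mul_le_mul_of_nonneg_left (hb j) (by positivity)))).trans ?_
    rw [Finset.sum_const, nsmul_eq_mul]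
    calc _ ≤ ((2 * (Finset.Icc a e).card * m : ℕ) : ℝ) * (2 * ‖Φ a e‖ * b) := by
          gcongr
      _ = _ := by push_cast; ring
  have hcount : ∑ a, ∑ e ∈ Finset.Ici a, ((Finset.Icc a e).card : ℝ) * ‖Φ a e‖ ≤ N * c := by
    have e1 : ∑ a, ∑ e ∈ Finset.Ici a, ((Finset.Icc a e).card : ℝ) * ‖Φ a e‖ =
        ∑ i, ∑ a ∈ Finset.Iic i, ∑ e ∈ Finset.Ici i, ‖Φ a e‖ := by
      have : ∀ a, ∑ e ∈ Finset.Ici a, ((Finset.Icc a e).card : ℝ) * ‖Φ a e‖ =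
          ∑ i ∈ Finset.Ici a, ∑ e ∈ Finset.Ici i, ‖Φ a e‖ := fun a => by
        rw [Finset.sum_comm' (t' := Finset.Ici a) (s' := fun e => Finset.Icc a e)]
        · exact Finset.sum_congr rfl fun e _ => by rw [Finset.sum_const, nsmul_eq_mul]
        · intro i e
          simp only [Finset.mem_Ici, Finset.mem_Icc]
          exact ⟨fun h => ⟨h, h.1.trans h.2⟩, fun h => h.1⟩
      simp only [this]
      exact Finset.sum_comm' fun a i => by simp
    rw [e1]
    calc _ ≤ ∑ _i : Fin N, c := Finset.sum_le_sum fun i _ => le_trans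
          (Finset.sum_le_sum fun a _ => Finset.sum_le_sum fun e _ =>
            le_mul_of_one_le_right (norm_nonneg _) (Real.one_le_exp (by positivity))) (h3 i)
      _ = N * c := by simp
  have hexp : ⁅A, ∑ j, B j⁆ = ∑ a, ∑ e ∈ Finset.Ici a, ⁅Φ a e, ∑ j, B j⁆ := by
    rw [h2]
    generalize ∑ j, B j = S
    simp only [Ring.lie_def, Finset.sum_mul, Finset.mul_sum, Finset.sum_sub_distrib]
  rw [hexp]
  calc _ ≤ ∑ a, ∑ e ∈ Finset.Ici a, ((Finset.Icc a e).card : ℝ) * ‖Φ a e‖ * (4 * m * b) :=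
        norm_sum_le_of_le _ fun a _ => norm_sum_le_of_le _ fun e he =>
          hone a e (Finset.mem_Ici.mp he)
    _ = (∑ a, ∑ e ∈ Finset.Ici a, ((Finset.Icc a e).card : ℝ) * ‖Φ a e‖) * (4 * m * b) := by
        simp only [Finset.sum_mul]
    _ ≤ N * c * (4 * m * b) := by gcongr
    _ = _ := by ring

end Intervals

/-! ### The transformed Hamiltonian -/

section Chain

variable {N : ℕ} {d : Fin N → ℕ} {R : ℕ} {h T : ℝ}

theorem DrivenChain.norm_V_le (E : DrivenChain d R h T) (t : ℝ) : ‖E.V t‖ ≤ N * h := by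
  refine (norm_sum_le_of_le _ fun i _ => E.norm_drv_le i t).trans ?_
  simp

theorem DrivenChain.V_mem (E : DrivenChain d R h T) : E.V ∈ regularSubmodule d T :=
  ⟨E.drv_periodic, Finset.aestronglyMeasurable_fun_sum _ fun i _ => E.drv_meas i, N * h,
    E.norm_V_le⟩

theorem DrivenChain.H_mem (E : DrivenChain d R h T) : E.H ∈ regularSubmodule d T :=
  (regularSubmodule d T).add_mem (const_mem_regularSubmodule E.H0) E.V_mem

theorem DrivenChain.star_H (E : DrivenChain d R h T) (t : ℝ) : star (E.H t) = E.H t := by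
  rw [DrivenChain.H, star_add]
  congr 1
  · exact E.stat_herm
  · exact E.drv_herm t

theorem DrivenChain.Hbar_zero (E : DrivenChain d R h T) (hT : 0 < T) : Hbar T E.H 0 = E.H0 := by
  rw [Hbar, opG_zero, timeAvg]
  simp only [DrivenChain.H]
  rw [intervalIntegral.integral_add intervalIntegrable_const
    (intervalIntegrable_of_mem_regularSubmodule E.V_mem _ _), intervalIntegral.integral_const]
  have : ∫ t in (0 : ℝ)..T, E.V t = 0 := E.drv_mean
  rw [this, add_zero, sub_zero, smul_smul, inv_mul_cancel₀ hT.ne', one_smul]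

theorem DrivenChain.isLocalRep_H (E : DrivenChain d R h T) :
    IsLocalRep R T 0 (2 * h) E.H (fun t i => E.stat i + E.drv i t) where
  supp t i := by
    rw [zero_add, mul_one]
    exact (E.stat_supp i).add (E.drv_supp i t)
  meas i := aestronglyMeasurable_const.add (E.drv_meas i).restrict
  bound t _ i := (norm_add_le _ _).trans (by linarith [E.norm_stat_le i, E.norm_drv_le i t])
  sum t _ := by
    rw [Finset.sum_add_distrib]
    rfl

/-- The operators of the recursion have local representations whose norms are bounded by the
numerical majorant. -/
theorem DrivenChain.exists_isLocalRep (E : DrivenChain d R h T) (hT : 0 < T) {γ : ℕ → ℝ}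
    (h0 : γ 0 = 2 * h) (hrec : ∀ q, 1 ≤ q → γ q = ∑ k ∈ Finset.Icc 1 q, majTerm R h T γ k q)
    (hγ : ∀ q, 0 ≤ γ q) :
    ∃ g : ℕ → ℝ → Fin N → Op d, ∀ q, IsLocalRep R T q (γ q) (opG T E.H q) (g q) := by
  obtain ⟨g, hg⟩ := exists_eq_recursion (α := ℝ → Fin N → Op d)
    (fun g q => if q = 0 then fun t i => E.stat i + E.drv i t else
      fun t => ∑ k ∈ Finset.Icc 1 q, frameTerm localBracket
        (fun p i => omegaOf T (fun q s => g q s i) p t)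
        (Pi.single 0 (fun i => E.stat i + E.drv i t))
        (fun j i => domegaOf T (fun q s => g q s i) (j + 1) t) k q)
    (fun q g g' hgg => by
      congr 1
      funext t
      refine Finset.sum_congr rfl fun k hk => ?_
      refine frameTerm_congr (Finset.mem_Icc.mp hk).1 (fun p h1 h2 => ?_) fun j hj => ?_
      · funext i
        simp only [omegaOf]
        rw [hgg (p - 1) (by omega)]
      · funext i
        simp only [domegaOf, Nat.add_sub_cancel]
        rw [hgg j hj])
  refine ⟨g, fun q => ?_⟩
  induction q using Nat.strong_induction_on with
  | _ q ih =>
    by_cases hq : q = 0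
    · subst hq
      rw [hg 0, if_pos rfl, h0]
      exact E.isLocalRep_H
    · rw [hg q, if_neg hq, hrec q (by omega), opG_eq T E.H q (by omega)]
      have := IsLocalRep.finset_sum (Finset.Icc 1 q) (fun k hk =>
        IsLocalRep.frameTerm hT hγ E.isLocalRep_H ih k q
          (Or.inr ⟨le_rfl, (Finset.mem_Icc.mp hk).1⟩))
      convert this using 2 with t
      exact nextG_eq_sum_frameTerm _ _ _ _ _

theorem omegaOf_truncSeq_of_le {G : ℕ → ℝ → Op d} {n p : ℕ} (h1 : 1 ≤ p) (hp : p ≤ n) :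
    omegaOf T (truncSeq n G) p = omegaOf T G p := by
  unfold omegaOf
  rw [truncSeq, if_pos (by omega)]

theorem domegaOf_truncSeq_of_le {G : ℕ → ℝ → Op d} {n p : ℕ} (h1 : 1 ≤ p) (hp : p ≤ n) :
    domegaOf T (truncSeq n G) p = domegaOf T G p := by
  unfold domegaOf
  rw [truncSeq, if_pos (by omega)]

theorem oscPart_zero (t : ℝ) : oscPart T (0 : ℝ → Op d) t = 0 := by
  simp [oscPart, timeAvg]

theorem omegaOf_truncSeq_of_lt {G : ℕ → ℝ → Op d} {n p : ℕ} (hp : n < p) (t : ℝ) :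
    omegaOf T (truncSeq n G) p t = 0 := by
  unfold omegaOf
  rw [truncSeq, if_neg (by omega)]
  simp [oscPart_zero]

theorem domegaOf_truncSeq_of_lt {G : ℕ → ℝ → Op d} {n p : ℕ} (hp : n < p) (t : ℝ) :
    domegaOf T (truncSeq n G) p t = 0 := by
  unfold domegaOf
  rw [truncSeq, if_neg (by omega), oscPart_zero, smul_zero]

/-- The contribution of order `k` and degree `q` to the transformed Hamiltonian `H'(t)`, for the
generator `Ω_1 + … + Ω_n`. -/
def frameOp (T : ℝ) (H : ℝ → Op d) (n : ℕ) (t : ℝ) (k q : ℕ) : Op d :=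
  frameTerm (fun A B => ⁅A, B⁆) (fun p => omegaOf T (truncSeq n (opG T H)) p t)
    (Pi.single 0 (H t)) (fun j => domegaOf T (truncSeq n (opG T H)) (j + 1) t) k q

variable {H : ℝ → Op d} {n : ℕ}

/-- The set of times at which all generators `Ω_1, …, Ω_n` have their formal derivatives. -/
def goodTimes (T : ℝ) (H : ℝ → Op d) (n : ℕ) : Set ℝ :=
  {t | ∀ p ∈ Finset.Icc 1 n, HasDerivAt (omega T H p) (domegaOf T (opG T H) p t) t}

theorem hasDerivAt_sum_omega {t : ℝ} (ht : t ∈ goodTimes T H n) :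
    HasDerivAt (fun s => ∑ p ∈ Finset.Icc 1 n, omega T H p s)
      (∑ p ∈ Finset.Icc 1 n, domegaOf T (opG T H) p t) t :=
  HasDerivAt.fun_sum ht

theorem differentiableAt_Q {t : ℝ} (ht : t ∈ goodTimes T H n) :
    DifferentiableAt ℝ (Q T H n) t := by
  obtain ⟨K, hK, -⟩ := hasDerivAt_exp_curve (hasDerivAt_sum_omega ht)
  exact hK.differentiableAt

theorem star_sum_omega (hH : ∀ t, star (H t) = H t) (n : ℕ) (t : ℝ) :
    star (∑ p ∈ Finset.Icc 1 n, omega T H p t) = -∑ p ∈ Finset.Icc 1 n, omega T H p t := by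
  rw [star_sum, ← Finset.sum_neg_distrib]
  exact Finset.sum_congr rfl fun p _ => star_omegaOf (star_opG hH (p - 1)) t

theorem Q_mem_unitary (hH : ∀ t, star (H t) = H t) (n : ℕ) (t : ℝ) :
    Q T H n t ∈ unitary (Op d) := by
  let : NormedAlgebra ℚ (Op d) := NormedAlgebra.restrictScalars ℚ ℂ (Op d)
  exact NormedSpace.exp_mem_unitary_of_mem_skewAdjoint
    (skewAdjoint.mem_iff.mpr (star_sum_omega hH n t))

theorem star_Q (hH : ∀ t, star (H t) = H t) (n : ℕ) (t : ℝ) :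
    star (Q T H n t) = NormedSpace.exp (-∑ p ∈ Finset.Icc 1 n, omega T H p t) := by
  rw [Q, NormedSpace.star_exp, star_sum_omega hH]

/-- Expansion of the transformed Hamiltonian by order and degree. -/
theorem hasSum_frameOp (hH : ∀ t, star (H t) = H t) (hn : 1 ≤ n) {t : ℝ}
    (ht : t ∈ goodTimes T H n) :
    HasSum (fun k => ∑ q ∈ Finset.range (n * (k + 1)), frameOp T H n t k q)
      (Hprime T H n t) := by
  obtain ⟨K, hK, hKs⟩ := hasDerivAt_exp_curve (hasDerivAt_sum_omega ht)
  have hconj := hasSum_exp_conj (∑ p ∈ Finset.Icc 1 n, omega T H p t) (H t)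
  have hHp : Hprime T H n t =
      NormedSpace.exp (-∑ p ∈ Finset.Icc 1 n, omega T H p t) * H t *
        NormedSpace.exp (∑ p ∈ Finset.Icc 1 n, omega T H p t) + (-Complex.I) • K := by
    have hd : deriv (Q T H n) t = Q T H n t * K := hK.deriv
    rw [Hprime, hd, ← mul_assoc, (Unitary.mem_iff.mp (Q_mem_unitary hH n t)).1, one_mul,
      star_Q hH, Q, sub_eq_add_neg, neg_smul]
  rw [hHp]
  refine (hconj.add (hKs.const_smul (-Complex.I))).congr_fun fun k => ?_
  have hr : ∀ A : Op d, ⁅A, (0 : Op d)⁆ = 0 := fun A => by simp [Ring.lie_def]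
  have hl : ∀ A : Op d, ⁅(0 : Op d), A⁆ = 0 := fun A => by simp [Ring.lie_def]
  have hW : ∀ p, n < p → (fun p => omegaOf T (truncSeq n (opG T H)) p t) p = 0 :=
    fun p hp => omegaOf_truncSeq_of_lt hp t
  have hΩ : ∑ p ∈ Finset.Icc 1 n, omegaOf T (truncSeq n (opG T H)) p t =
      ∑ p ∈ Finset.Icc 1 n, omega T H p t := by
    refine Finset.sum_congr rfl fun p hp => ?_
    rw [Finset.mem_Icc] at hp
    rw [omegaOf_truncSeq_of_le hp.1 hp.2]
    rfl
  have hD : ∑ j ∈ Finset.range n, domegaOf T (truncSeq n (opG T H)) (j + 1) t =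
      ∑ p ∈ Finset.Icc 1 n, domegaOf T (opG T H) p t := by
    have h1 : Finset.Icc 1 n = (Finset.range n).image (· + 1) := by
      ext p
      simp only [Finset.mem_Icc, Finset.mem_image, Finset.mem_range]
      exact ⟨fun h => ⟨p - 1, by omega, by omega⟩, fun ⟨a, h1, h2⟩ => by omega⟩
    rw [h1, Finset.sum_image (fun a _ b _ h => by simpa using h)]
    refine Finset.sum_congr rfl fun j hj => ?_
    rw [Finset.mem_range] at hj
    rw [domegaOf_truncSeq_of_le (by omega) (by omega)]
  have hX : ∑ q ∈ Finset.range n, (Pi.single 0 (H t) : ℕ → Op d) q = H t := by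
    rw [Finset.sum_eq_single_of_mem 0 (Finset.mem_range.mpr hn)]
    · simp
    · intro q _ hq
      rw [Pi.single_eq_of_ne hq]
  have e1 := sum_iterBracket (b := fun A B : Op d => ⁅A, B⁆) hr hl finset_sum_lie_sum hW
    (X := Pi.single 0 (H t)) (fun q hq => Pi.single_eq_of_ne (by omega) _) k
  have e2 := sum_iterBracket (b := fun A B : Op d => ⁅A, B⁆) hr hl finset_sum_lie_sum hW
    (X := fun j => domegaOf T (truncSeq n (opG T H)) (j + 1) t)
    (fun q hq => domegaOf_truncSeq_of_lt (by omega) t) k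
  rw [hΩ, hX] at e1
  rw [hΩ, hD] at e2
  simp only [frameOp, frameTerm, Finset.sum_add_distrib, ← Finset.smul_sum]
  rw [e1, e2]
  congr 1
  rw [smul_smul, coefD]
  congr 1
  rw [pow_succ]
  ring

/-- In degrees below `n` the oscillating parts cancel, by the choice of the generators. -/
theorem hasSum_frameOp_of_lt {q : ℕ} (hq : q < n) (t : ℝ) :
    HasSum (fun k => frameOp T H n t k q) (Hbar T H q) := by
  have hr : ∀ (q : ℕ) (A : Op d), (fun (_ : ℕ) (A B : Op d) => ⁅A, B⁆) q A 0 = 0 :=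
    fun _ A => by simp [Ring.lie_def]
  have hzero : ∀ k ∉ Finset.range (q + 1), frameOp T H n t k q = 0 := fun k hk => by
    rw [Finset.mem_range] at hk
    rw [frameOp, frameTerm, iterBracket_eq_zero_of_lt hr (by omega),
      iterBracket_eq_zero_of_lt hr (by omega), smul_zero, smul_zero, add_zero]
  have hsum : ∑ k ∈ Finset.range (q + 1), frameOp T H n t k q = Hbar T H q := by
    have h1 : Finset.Icc 1 q = (Finset.range q).image (· + 1) := by
      ext p
      simp only [Finset.mem_Icc, Finset.mem_image, Finset.mem_range]
      exact ⟨fun h => ⟨p - 1, by omega, by omega⟩, fun ⟨a, h1, h2⟩ => by omega⟩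
    have hcong : ∀ k, 1 ≤ k → frameOp T H n t k q =
        frameTerm (fun A B => ⁅A, B⁆) (fun p => omegaOf T (opG T H) p t) (Pi.single 0 (H t))
          (fun j => domegaOf T (opG T H) (j + 1) t) k q := fun k hk =>
      frameTerm_congr hk (fun p hp1 hp2 => by rw [omegaOf_truncSeq_of_le hp1 (by omega)])
        fun j hj => by rw [domegaOf_truncSeq_of_le (by omega) (by omega)]
    have hz : frameOp T H n t 0 q = (Pi.single 0 (H t) : ℕ → Op d) q - oscPart T (opG T H q) t := by
      simp only [frameOp, frameTerm, iterBracket]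
      rw [domegaOf_truncSeq_of_le (by omega) (by omega), domegaOf, Nat.add_sub_cancel, smul_smul,
        coefH, coefD]
      simp [sub_eq_add_neg]
    rw [Finset.sum_range_succ', hz]
    by_cases hq0 : q = 0
    · subst hq0
      simp [oscPart, opG_zero, Hbar]
    · have hs : ∑ k ∈ Finset.range q, frameOp T H n t (k + 1) q = opG T H q t := by
        rw [opG_eq T H q (by omega), nextG_eq_sum_frameTerm, h1,
          Finset.sum_image (fun a _ b _ h => by simpa using h)]
        exact Finset.sum_congr rfl fun k _ => hcong (k + 1) (by omega)
      rw [hs, Pi.single_eq_of_ne hq0, oscPart, Hbar]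
      abel
  rw [← hsum]
  exact hasSum_sum_of_ne_finset_zero hzero

theorem DrivenChain.Hstar_eq_sum (E : DrivenChain d R h T) (hT : 0 < T) (hn : 1 ≤ n) :
    E.Hstar n = ∑ q ∈ Finset.range n, Hbar T E.H q := by
  rw [DrivenChain.Hstar, Finset.range_eq_Ico, Finset.sum_eq_sum_Ico_succ_bot hn,
    E.Hbar_zero hT]

theorem DrivenChain.hasSum_deltaH (E : DrivenChain d R h T) (hT : 0 < T) (hn : 1 ≤ n) {t : ℝ}
    (ht : t ∈ goodTimes T E.H n) :
    HasSum (fun k => ∑ q ∈ Finset.Ico n (n * (k + 1)), frameOp T E.H n t k q)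
      (E.deltaH n t) := by
  rw [DrivenChain.deltaH, E.Hstar_eq_sum hT hn]
  refine ((hasSum_frameOp E.star_H hn ht).sub
    (hasSum_sum fun q hq => hasSum_frameOp_of_lt (Finset.mem_range.mp hq) t)).congr_fun
      fun k => ?_
  have hle : n ≤ n * (k + 1) := Nat.le_mul_of_pos_right n (by omega)
  rw [Finset.sum_Ico_eq_sub _ hle]

theorem truncSeq_mem {G : ℕ → ℝ → Op d} {S : Submodule ℂ (ℝ → Op d)} (hG : ∀ q, G q ∈ S)
    (n q : ℕ) : truncSeq n G q ∈ S := by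
  unfold truncSeq
  split_ifs
  · exact hG q
  · exact S.zero_mem

theorem frameOp_periodic (hT : 0 < T) (hH : H ∈ regularSubmodule d T) (n : ℕ) :
    Function.Periodic (frameOp T H n) T := by
  intro t
  have hG : ∀ q, truncSeq n (opG T H) q ∈ regularSubmodule d T :=
    truncSeq_mem (opG_mem_regularSubmodule hT hH) n
  have h1 : (fun p => omegaOf T (truncSeq n (opG T H)) p (t + T)) =
      fun p => omegaOf T (truncSeq n (opG T H)) p t :=
    funext fun p => (omegaOf_mem_regularSubmodule hT (hG (p - 1))).1 t
  have h2 : (fun j => domegaOf T (truncSeq n (opG T H)) (j + 1) (t + T)) =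
      fun j => domegaOf T (truncSeq n (opG T H)) (j + 1) t :=
    funext fun j => (domegaOf_mem_regularSubmodule (p := j + 1) (hG j)).1 t
  funext k q
  simp only [frameOp]
  rw [h1, h2, hH.1 t]

/-- Bound on a weighted local contribution of degree `q ≥ n`: the gap between `r` and
`r₀ + κ R + 1` absorbs the range, its weight and the factor `exp (r₀ q)`. -/
theorem range_mul_exp_le {κ r₀ r : ℝ} (hr₀ : 0 ≤ r₀) (hr : r₀ + 1 + R * κ ≤ r) {q : ℕ}
    (hq : n ≤ q) :
    ((R * (q + 1) : ℕ) : ℝ) * Real.exp (κ * ((R * (q + 1) : ℕ) : ℝ)) ≤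
      R * Real.exp (κ * R) * Real.exp (-r₀ * n) * Real.exp r ^ q := by
  have h1 : ((q : ℝ) + 1) ≤ Real.exp q := Real.add_one_le_exp _
  have hq' : (n : ℝ) ≤ q := by exact_mod_cast hq
  have h2 : Real.exp q * Real.exp (κ * R * q) ≤ Real.exp (-r₀ * n) * Real.exp r ^ q := by
    rw [← Real.exp_nat_mul, ← Real.exp_add, ← Real.exp_add]
    apply Real.exp_le_exp.mpr
    have e1 : (q : ℝ) * (r₀ + 1 + R * κ) ≤ q * r := by gcongr
    have e2 : r₀ * n ≤ r₀ * q := by gcongr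
    linarith
  push_cast
  calc (R : ℝ) * (q + 1) * Real.exp (κ * (R * (q + 1)))
      ≤ R * Real.exp q * Real.exp (κ * (R * (q + 1))) := by gcongr
    _ = R * Real.exp (κ * R) * (Real.exp q * Real.exp (κ * R * q)) := by
        rw [show κ * (R * ((q : ℝ) + 1)) = κ * R + κ * R * q by ring, Real.exp_add]
        ring
    _ ≤ R * Real.exp (κ * R) * (Real.exp (-r₀ * n) * Real.exp r ^ q) := by
        exact mul_le_mul_of_nonneg_left h2 (by positivity)
    _ = _ := by ring

/-- The remaining drive has an interval decomposition of exponentially small weighted norm. -/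
theorem DrivenChain.deltaH_hasIntervalBound_of_one_le (E : DrivenChain d R h T) (hh : 0 ≤ h)
    (hT : 0 < T) (hR : 1 ≤ R) {κ r₀ r : ℝ} (hκ : 0 ≤ κ) (hr₀ : 0 ≤ r₀) (hr : r₀ + 1 + R * κ ≤ r)
    (hn : 1 ≤ n) (hsmall : 32 * R * n * T * Real.exp r * h ≤ 1 / 6) {t : ℝ}
    (ht : t ∈ goodTimes T E.H n) :
    HasIntervalBound κ (E.deltaH n t)
      (R * Real.exp (κ * R) * Real.exp (-r₀ * n) * (12 * h)) := by
  obtain ⟨γ, h0, hrec, hγ⟩ := exists_majorant R hh hT.le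
  obtain ⟨g, hg⟩ := E.exists_isLocalRep hT h0 hrec hγ
  have hΓ : ∑ q ∈ Finset.range n, Real.exp r ^ q * γ q ≤ 4 * h :=
    (Finset.sum_le_sum_of_subset_of_nonneg (Finset.range_subset_range.mpr (Nat.le_succ n))
      fun q _ _ => mul_nonneg (by positivity) (hγ q)).trans
      (sum_majorant_le hh hT.le (Real.exp_pos r) hγ h0 hrec hsmall)
  have hmaj := sum_majTerm_le hh hT.le (Real.exp_pos r) hγ hn le_rfl hsmall hΓ
  have hγt : ∀ q, 0 ≤ truncSeq n γ q := fun q => by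
    unfold truncSeq
    split_ifs
    · exact hγ q
    · exact le_rfl
  have hgt : ∀ q, IsLocalRep R T q (truncSeq n γ q) (truncSeq n (opG T E.H) q)
      (truncSeq n g q) := fun q => by
    unfold truncSeq
    split_ifs
    · exact hg q
    · exact IsLocalRep.zero le_rfl
  -- the local representations live on one period, so that `t` is moved there
  obtain ⟨s, hs, hts⟩ := (frameOp_periodic hT E.H_mem n).exists_mem_Ico₀ hT t
  have hsum := E.hasSum_deltaH hT hn ht
  rw [hts] at hsum
  set C := (R : ℝ) * Real.exp (κ * R) * Real.exp (-r₀ * n) with hC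
  have hC0 : 0 ≤ C := by positivity
  refine HasIntervalBound.hasSum (c := fun k => C * (10 * h * (1 / 6) ^ k)) hκ (fun k => ?_) hsum ?_
  · refine (HasIntervalBound.sum (c := fun q => C * (Real.exp r ^ q *
      majTerm R h T (truncSeq n γ) k q)) hκ _ fun q hq => ?_).mono ?_
    · have hrep := IsLocalRep.frameTerm hT hγt E.isLocalRep_H (Q := q + 1) (fun j _ => hgt j) k q
        (Or.inl (Nat.lt_succ_self q))
      have hb := HasIntervalBound.of_local hκ (Nat.mul_pos hR (Nat.succ_pos q)) (hrep.supp s)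
        (hrep.bound s ⟨hs.1, hs.2.le⟩)
      rw [hrep.sum s ⟨hs.1, hs.2.le⟩] at hb
      refine hb.mono ?_
      rw [← mul_assoc]
      refine mul_le_mul_of_nonneg_right ?_ (majTerm_nonneg hh hT.le hγt k q)
      exact range_mul_exp_le hr₀ hr (Finset.mem_Ico.mp hq).1
    · rw [← Finset.mul_sum]
      refine mul_le_mul_of_nonneg_left (le_trans ?_ (hmaj k)) hC0
      refine Finset.sum_le_sum_of_subset_of_nonneg (fun q hq => ?_) fun q _ _ =>
        mul_nonneg (by positivity) (majTerm_nonneg hh hT.le hγt k q)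
      exact Finset.mem_range.mpr (Finset.mem_Ico.mp hq).2
  · have hgeo := hasSum_geometric_of_lt_one (r := (1 / 6 : ℝ)) (by norm_num) (by norm_num)
    have e : 12 * h = 10 * h * (1 - 1 / 6)⁻¹ := by
      norm_num
      ring
    rw [e]
    exact (hgeo.mul_left (10 * h)).mul_left C

end Chain

/-! ### Evolutions and almost conserved operators -/

section LocallyLipschitz

theorem locallyLipschitz_mul {A : Type*} [NormedRing A] [NormedAlgebra ℝ A] {f g : ℝ → A}
    (hf : LocallyLipschitz f) (hg : LocallyLipschitz g) : LocallyLipschitz fun t => f t * g t :=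
  (contDiff_mul (𝕜 := ℝ) (n := 1) (𝔸 := A)).locallyLipschitz.comp (hf.prodMk hg)

theorem locallyLipschitz_primitive {E : Type*} [NormedAddCommGroup E] [NormedSpace ℝ E]
    {F : ℝ → E} (hF : ∀ a b, IntervalIntegrable F volume a b)
    (hb : ∀ x, ∃ C, ∀ᶠ t in nhds x, ‖F t‖ ≤ C) :
    LocallyLipschitz fun t => ∫ s in (0 : ℝ)..t, F s := by
  intro x
  obtain ⟨C, hC⟩ := hb x
  obtain ⟨ε, hε, hball⟩ := Metric.eventually_nhds_iff_ball.mp hC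
  refine ⟨C.toNNReal, Metric.ball x ε, Metric.ball_mem_nhds x hε,
    LipschitzOnWith.of_dist_le_mul fun t ht s hs => ?_⟩
  have hC0 : 0 ≤ C := (norm_nonneg _).trans (hball x (Metric.mem_ball_self hε))
  rw [dist_eq_norm, intervalIntegral.integral_interval_sub_left (hF _ _) (hF _ _), Real.dist_eq,
    Real.coe_toNNReal C hC0]
  refine intervalIntegral.norm_integral_le_of_norm_le_const fun u hu => hball u ?_
  have hconv : Set.uIcc s t ⊆ Metric.ball x ε := by
    rw [← segment_eq_uIcc]
    exact (convex_ball x ε).segment_subset hs ht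
  exact hconv (Set.uIoc_subset_uIcc hu)

/-- The mean value inequality for locally Lipschitz functions needs the bound on the derivative
almost everywhere only. -/
theorem norm_sub_le_of_locallyLipschitz {E : Type*} [NormedAddCommGroup E] [NormedSpace ℝ E]
    [CompleteSpace E] {f : ℝ → E} (hf : LocallyLipschitz f) {M : ℝ}
    (hd : ∀ᵐ t, ∃ f', HasDerivAt f f' t ∧ ‖f'‖ ≤ M) {a b : ℝ} (hab : a ≤ b) :
    ‖f b - f a‖ ≤ M * (b - a) := by
  have hmeas : AEStronglyMeasurable (deriv f) volume := by
    have h := hf.continuous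
    have hsec : SecondCountableTopologyEither ℝ E := inferInstance
    exact aestronglyMeasurable_deriv f volume
  have hbd : ∀ᵐ t, ‖deriv f t‖ ≤ M := by
    filter_upwards [hd] with t ⟨f', h1, h2⟩
    rwa [h1.deriv]
  have hbd' : ∀ s : Set ℝ, ∀ᵐ t ∂(volume.restrict s), ‖deriv f t‖ ≤ M :=
    fun s => ae_restrict_of_ae hbd
  have hint : ∀ s t, IntervalIntegrable (deriv f) volume s t := fun s t => by
    rw [intervalIntegrable_iff]
    have : IsFiniteMeasure (volume.restrict (Set.uIoc s t)) := by
      rw [Set.uIoc]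
      infer_instance
    exact Integrable.of_bound hmeas.restrict M (hbd' _)
  have hloc : LocallyIntegrable (deriv f) volume := fun x =>
    ⟨Metric.ball x 1, Metric.ball_mem_nhds x one_pos,
      have : IsFiniteMeasure (volume.restrict (Metric.ball x (1 : ℝ))) :=
        ⟨by rw [Measure.restrict_apply_univ]; exact measure_ball_lt_top⟩
      Integrable.of_bound hmeas.restrict M (hbd' _)⟩
  have hM : ∀ s t, ‖∫ u in s..t, deriv f u‖ ≤ M * |t - s| := fun s t =>
    intervalIntegral.norm_integral_le_of_norm_le_const_ae (hbd.mono fun u hu _ => hu)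
  have hM0 : 0 ≤ M := by
    obtain ⟨t, f', -, h2⟩ := hd.exists
    exact (norm_nonneg _).trans h2
  -- `f` minus the primitive of its derivative is locally Lipschitz with derivative zero almost
  -- everywhere, hence constant
  have hP : LocallyLipschitz fun t => ∫ u in a..t, deriv f u :=
    (LipschitzWith.of_dist_le_mul (K := M.toNNReal) fun t s => by
      rw [dist_eq_norm, intervalIntegral.integral_interval_sub_left (hint _ _) (hint _ _),
        Real.dist_eq, Real.coe_toNNReal M hM0]
      exact hM s t).locallyLipschitz
  have hg : LocallyLipschitz fun t => f t - ∫ u in a..t, deriv f u := hf.sub hP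
  obtain ⟨K, hK⟩ := hg.locallyLipschitzOn.exists_lipschitzOnWith_of_compact
    (isCompact_uIcc (a := a) (b := b))
  obtain ⟨C, hC⟩ := hK.absolutelyContinuousOnInterval.const_of_ae_hasDerivAt_zero (by
    filter_upwards [hd, LocallyIntegrable.ae_hasDerivAt_integral hloc] with t ⟨f', h1, _⟩ h3 _
    have := h1.sub (h3 a)
    rwa [h1.deriv, sub_self] at this)
  have h1 := hC b Set.right_mem_uIcc
  have h2 := hC a Set.left_mem_uIcc
  rw [intervalIntegral.integral_same, sub_zero] at h2
  rw [h2, ← h1, sub_sub_cancel]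
  have := hM a b
  rwa [abs_of_nonneg (sub_nonneg.mpr hab)] at this

theorem eq_of_locallyLipschitz {E : Type*} [NormedAddCommGroup E] [NormedSpace ℝ E]
    [CompleteSpace E] {f : ℝ → E} (hf : LocallyLipschitz f) (hd : ∀ᵐ t, HasDerivAt f 0 t)
    (a b : ℝ) : f a = f b := by
  have key : ∀ a b, a ≤ b → f a = f b := fun a b hab => by
    have h := norm_sub_le_of_locallyLipschitz hf (M := 0)
      (hd.mono fun t ht => ⟨0, ht, by simp⟩) hab
    rw [zero_mul, norm_le_zero_iff, sub_eq_zero] at h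
    exact h.symm
  rcases le_total a b with h | h
  · exact key a b h
  · exact (key b a h).symm

end LocallyLipschitz

section Evolution

variable {N : ℕ} {d : Fin N → ℕ} {T : ℝ} {H : ℝ → Op d}

theorem norm_one_op_le : ‖(1 : Op d)‖ ≤ 1 := by
  rcases subsingleton_or_nontrivial (Op d) with h | h
  · rw [Subsingleton.elim (1 : Op d) 0, norm_zero]
    exact zero_le_one
  · rw [CStarRing.norm_one]

theorem norm_le_one_of_star_mul_self {A : Op d} (hA : star A * A = 1) : ‖A‖ ≤ 1 := by
  have h := CStarRing.norm_star_mul_self (x := A)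
  rw [hA] at h
  nlinarith [norm_nonneg A, norm_one_op_le (d := d)]

theorem locallyLipschitz_star {f : ℝ → Op d} (hf : LocallyLipschitz f) :
    LocallyLipschitz fun t => star (f t) :=
  (starₗᵢ ℂ : Op d ≃ₗᵢ⋆[ℂ] Op d).lipschitz.locallyLipschitz.comp hf

section Propagator

variable {U : ℝ → Op d}

theorem IsPropagator.zero (hU : IsPropagator H U) : U 0 = 1 := by
  have := (hU.2 0).2
  simpa using this

theorem IsPropagator.intervalIntegrable (hU : IsPropagator H U) (a b : ℝ) :
    IntervalIntegrable (fun s => H s * U s) volume a b :=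
  (hU.2 a).1.symm.trans (hU.2 b).1

theorem IsPropagator.locallyLipschitz (hU : IsPropagator H U) (hH : H ∈ regularSubmodule d T) :
    LocallyLipschitz U := by
  obtain ⟨C, hC⟩ := hH.2.2
  have hC0 : 0 ≤ C := (norm_nonneg _).trans (hC 0)
  have h := locallyLipschitz_primitive hU.intervalIntegrable (fun x => by
    have hev : ∀ᶠ t in nhds x, ‖U t‖ < ‖U x‖ + 1 :=
      hU.1.norm.continuousAt.eventually_lt continuousAt_const (lt_add_one _)
    refine ⟨C * (‖U x‖ + 1), hev.mono fun t ht => (norm_mul_le _ _).trans ?_⟩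
    gcongr
    exact hC t)
  have hs : LocallyLipschitz fun t => Complex.I • ∫ s in (0 : ℝ)..t, H s * U s :=
    (lipschitzWith_smul Complex.I).locallyLipschitz.comp h
  have he : U = fun t => 1 - Complex.I • ∫ s in (0 : ℝ)..t, H s * U s :=
    funext fun t => (hU.2 t).2
  rw [he]
  exact (LocallyLipschitz.const 1).sub hs

theorem IsPropagator.ae_hasDerivAt (hU : IsPropagator H U) :
    ∀ᵐ t, HasDerivAt U ((-Complex.I) • (H t * U t)) t := by
  have hloc : LocallyIntegrable (fun s => H s * U s) volume := fun x =>
    ⟨Set.Ioc (x - 1) (x + 1), Ioc_mem_nhds (by linarith) (by linarith),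
      (intervalIntegrable_iff_integrableOn_Ioc_of_le (by linarith)).mp
        (hU.intervalIntegrable _ _)⟩
  filter_upwards [LocallyIntegrable.ae_hasDerivAt_integral hloc] with t ht
  have he : U = fun t => 1 - Complex.I • ∫ s in (0 : ℝ)..t, H s * U s :=
    funext fun t => (hU.2 t).2
  have h1 : HasDerivAt (fun t => 1 - Complex.I • ∫ s in (0 : ℝ)..t, H s * U s)
      ((-Complex.I) • (H t * U t)) t :=
    (((ht 0).const_smul Complex.I).const_sub 1).congr_deriv (neg_smul _ _).symm
  rwa [← he] at h1

/-- The evolution generated by a Hermitian Hamiltonian is unitary. -/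
theorem IsPropagator.star_mul_self (hU : IsPropagator H U) (hH : H ∈ regularSubmodule d T)
    (hs : ∀ t, star (H t) = H t) (t : ℝ) : star (U t) * U t = 1 := by
  have hL := hU.locallyLipschitz hH
  have h := eq_of_locallyLipschitz (locallyLipschitz_mul (locallyLipschitz_star hL) hL) (by
    filter_upwards [hU.ae_hasDerivAt] with t ht
    refine (ht.star.mul ht).congr_deriv ?_
    simp [star_smul, star_mul, hs, mul_assoc]) t 0
  rw [h, hU.zero]
  simp

end Propagator

/-- An operator conserved by one Hamiltonian is almost conserved by another one that is close to
it: `‖[H', A]‖ ≤ M` bounds the rate of change of `W† A W`. -/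
theorem norm_conj_sub_le {H' W : ℝ → Op d} {A : Op d} {M : ℝ} (hW : LocallyLipschitz W)
    (hWu : ∀ t, star (W t) * W t = 1)
    (hd : ∀ᵐ t, HasDerivAt W ((-Complex.I) • (H' t * W t)) t ∧ star (H' t) = H' t ∧
      ‖⁅H' t, A⁆‖ ≤ M) {s t : ℝ} (hst : s ≤ t) :
    ‖star (W t) * A * W t - star (W s) * A * W s‖ ≤ M * (t - s) := by
  refine norm_sub_le_of_locallyLipschitz (f := fun t => star (W t) * A * W t)
    (locallyLipschitz_mul (locallyLipschitz_mul (locallyLipschitz_star hW)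
      (LocallyLipschitz.const A)) hW) ?_ hst
  filter_upwards [hd] with u ⟨h1, h2, h3⟩
  refine ⟨_, (h1.star.mul_const A).mul h1, ?_⟩
  have e : star ((-Complex.I) • (H' u * W u)) * A * W u +
      star (W u) * A * ((-Complex.I) • (H' u * W u)) =
      Complex.I • (star (W u) * ⁅H' u, A⁆ * W u) := by
    rw [star_smul, star_mul, h2, Ring.lie_def]
    simp only [star_neg, Complex.star_def, Complex.conj_I, neg_neg, smul_mul_assoc,
      mul_smul_comm, neg_smul, mul_assoc, sub_eq_add_neg, mul_neg, neg_mul, mul_add, add_mul,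
      smul_add, smul_neg]
  rw [e, norm_smul, Complex.norm_I, one_mul]
  have hw := norm_le_one_of_star_mul_self (hWu u)
  calc _ ≤ ‖star (W u)‖ * ‖⁅H' u, A⁆‖ * ‖W u‖ :=
        (norm_mul_le _ _).trans (mul_le_mul_of_nonneg_right (norm_mul_le _ _) (norm_nonneg _))
    _ ≤ 1 * ‖⁅H' u, A⁆‖ * 1 := by
        rw [norm_star]
        gcongr
    _ ≤ M := by rwa [one_mul, mul_one]

section Frame

variable {n : ℕ}

theorem sum_omega_mem (hT : 0 < T) (hH : H ∈ regularSubmodule d T) (n : ℕ) :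
    (fun t => ∑ p ∈ Finset.Icc 1 n, omega T H p t) ∈ regularSubmodule d T := by
  have h : (fun t => ∑ p ∈ Finset.Icc 1 n, omega T H p t) =
      ∑ p ∈ Finset.Icc 1 n, omega T H p := by
    funext t
    rw [Finset.sum_apply]
  rw [h]
  exact Submodule.sum_mem _ fun p _ =>
    omegaOf_mem_regularSubmodule hT (opG_mem_regularSubmodule hT hH (p - 1))

theorem Q_periodic (hT : 0 < T) (hH : H ∈ regularSubmodule d T) (n : ℕ) :
    Function.Periodic (Q T H n) T := fun t => by
  have := (sum_omega_mem hT hH n).1 t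
  dsimp only at this
  rw [Q, this, Q]

theorem Q_at_zero (n : ℕ) : Q T H n 0 = 1 := by
  simp [Q, omega, omegaOf]

theorem exists_lipschitzWith_sum_omega (hT : 0 < T) (hH : H ∈ regularSubmodule d T) (n : ℕ) :
    ∃ K, LipschitzWith K fun t => ∑ p ∈ Finset.Icc 1 n, omega T H p t := by
  induction n with
  | zero => exact ⟨0, by simp⟩
  | succ n ih =>
    obtain ⟨K, hK⟩ := ih
    obtain ⟨K', hK'⟩ := lipschitz_omegaOf (p := n + 1) (opG_mem_regularSubmodule hT hH n)
    refine ⟨K + K', ?_⟩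
    simp only [Finset.sum_Icc_succ_top (Nat.le_add_left 1 n)]
    exact hK.add hK'

theorem exists_lipschitzWith_Q (hT : 0 < T) (hH : H ∈ regularSubmodule d T) (n : ℕ) :
    ∃ K, LipschitzWith K (Q T H n) := by
  let : NormedAlgebra ℚ (Op d) := NormedAlgebra.restrictScalars ℚ ℂ (Op d)
  obtain ⟨C, hC⟩ := (sum_omega_mem hT hH n).2.2
  obtain ⟨K, hK⟩ := exists_lipschitzWith_sum_omega hT hH n
  have hexp : LocallyLipschitz (NormedSpace.exp : Op d → Op d) :=
    (contDiff_iff_contDiffAt.mpr fun x =>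
      (NormedSpace.exp_analytic (𝕂 := ℝ) x).contDiffAt (n := 1)).locallyLipschitz
  obtain ⟨K', hK'⟩ := hexp.locallyLipschitzOn.exists_lipschitzOnWith_of_compact
    (isCompact_closedBall (0 : Op d) C)
  refine ⟨K' * K, fun s t => ?_⟩
  refine (hK' (x := ∑ p ∈ Finset.Icc 1 n, omega T H p s) ?_
    (y := ∑ p ∈ Finset.Icc 1 n, omega T H p t) ?_).trans ?_
  · simpa using hC s
  · simpa using hC t
  · rw [ENNReal.coe_mul, mul_assoc]
    gcongr
    exact hK s t

theorem star_mul_Q (hs : ∀ t, star (H t) = H t) (n : ℕ) (t : ℝ) :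
    star (Q T H n t) * Q T H n t = 1 := (Unitary.mem_iff.mp (Q_mem_unitary hs n t)).1

theorem Q_mul_star (hs : ∀ t, star (H t) = H t) (n : ℕ) (t : ℝ) :
    Q T H n t * star (Q T H n t) = 1 := (Unitary.mem_iff.mp (Q_mem_unitary hs n t)).2

theorem ae_mem_goodTimes (hT : 0 < T) (hH : H ∈ regularSubmodule d T) (n : ℕ) :
    ∀ᵐ t, t ∈ goodTimes T H n := by
  refine (Filter.eventually_all_finset _).mpr fun p _ => ?_
  exact ae_hasDerivAt_omegaOf (opG_mem_regularSubmodule hT hH (p - 1))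

theorem mem_goodTimes_of_continuousAt (hT : 0 < T) (hH : H ∈ regularSubmodule d T) (n : ℕ) {t : ℝ}
    (ht : ContinuousAt H t) : t ∈ goodTimes T H n := fun p _ =>
  hasDerivAt_omegaOf (opG_mem_regularSubmodule hT hH (p - 1)) (opG_continuousAt hT hH ht (p - 1))

/-- The derivative of `Q† Q = 1`. -/
theorem star_deriv_Q (hs : ∀ t, star (H t) = H t) {t : ℝ} (ht : DifferentiableAt ℝ (Q T H n) t) :
    star (deriv (Q T H n) t) * Q T H n t = -(star (Q T H n t) * deriv (Q T H n) t) := by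
  have h1 := ht.hasDerivAt.star.mul ht.hasDerivAt
  have h2 : (fun t => star (Q T H n t) * Q T H n t) = fun _ => 1 := funext (star_mul_Q hs n)
  have h3 : HasDerivAt (fun t => star (Q T H n t) * Q T H n t) 0 t := by
    rw [h2]
    exact hasDerivAt_const t _
  exact eq_neg_of_add_eq_zero_left (h1.unique h3)

theorem star_Hprime (hs : ∀ t, star (H t) = H t) {t : ℝ} (ht : DifferentiableAt ℝ (Q T H n) t) :
    star (Hprime T H n t) = Hprime T H n t := by
  rw [Hprime, star_sub, star_smul, star_mul, star_mul, star_mul, star_star, hs,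
    star_deriv_Q hs ht]
  simp [mul_assoc]

theorem Hprime_mem (hT : 0 < T) (hH : H ∈ regularSubmodule d T) (hs : ∀ t, star (H t) = H t)
    (n : ℕ) : Hprime T H n ∈ regularSubmodule d T := by
  obtain ⟨K, hK⟩ := exists_lipschitzWith_Q hT hH n
  obtain ⟨hper, hmeas, C, hC⟩ := hH
  have hQ : ∀ t, ‖Q T H n t‖ ≤ 1 := fun t => norm_le_one_of_star_mul_self (star_mul_Q hs n t)
  have hQm : AEStronglyMeasurable (Q T H n) volume := hK.continuous.aestronglyMeasurable
  have hQsm : AEStronglyMeasurable (fun t => star (Q T H n t)) volume :=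
    hK.continuous.star.aestronglyMeasurable
  have hdm : AEStronglyMeasurable (deriv (Q T H n)) volume := aestronglyMeasurable_deriv _ _
  refine ⟨fun t => ?_, ?_, C + K, fun t => ?_⟩
  · have hp := Q_periodic hT ⟨hper, hmeas, C, hC⟩ n
    have hd : deriv (Q T H n) (t + T) = deriv (Q T H n) t := by
      rw [← deriv_comp_add_const]
      congr 1
      exact funext hp
    simp only [Hprime]
    rw [hp t, hper t, hd]
  · exact ((hQsm.mul hmeas).mul hQm).sub ((hQsm.mul hdm).const_smul Complex.I)
  · rw [Hprime]
    refine (norm_sub_le _ _).trans (add_le_add ?_ ?_)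
    · calc _ ≤ ‖star (Q T H n t)‖ * ‖H t‖ * ‖Q T H n t‖ :=
            (norm_mul_le _ _).trans (mul_le_mul_of_nonneg_right (norm_mul_le _ _) (norm_nonneg _))
        _ ≤ 1 * C * 1 := by
            rw [norm_star]
            have := (norm_nonneg _).trans (hC t)
            gcongr
            · exact hQ t
            · exact hC t
            · exact hQ t
        _ = C := by ring
    · rw [norm_smul, Complex.norm_I, one_mul]
      calc _ ≤ ‖star (Q T H n t)‖ * ‖deriv (Q T H n) t‖ := norm_mul_le _ _
        _ ≤ 1 * K := by
            rw [norm_star]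
            gcongr
            · exact hQ t
            · exact norm_deriv_le_of_lipschitz hK
        _ = K := one_mul _

variable {U W : ℝ → Op d}

theorem locallyLipschitz_rotated (hT : 0 < T) (hH : H ∈ regularSubmodule d T)
    (hU : IsPropagator H U) (hW : ∀ t, W t = star (Q T H n t) * U t) : LocallyLipschitz W := by
  obtain ⟨K, hK⟩ := exists_lipschitzWith_Q hT hH n
  rw [funext hW]
  exact locallyLipschitz_mul (locallyLipschitz_star hK.locallyLipschitz) (hU.locallyLipschitz hH)

theorem star_mul_rotated (hH : H ∈ regularSubmodule d T) (hs : ∀ t, star (H t) = H t)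
    (hU : IsPropagator H U) (hW : ∀ t, W t = star (Q T H n t) * U t) (t : ℝ) :
    star (W t) * W t = 1 := by
  rw [hW, star_mul, star_star, mul_assoc, ← mul_assoc (Q T H n t), Q_mul_star hs, one_mul,
    hU.star_mul_self hH hs]

theorem ae_hasDerivAt_rotated (hT : 0 < T) (hH : H ∈ regularSubmodule d T)
    (hs : ∀ t, star (H t) = H t) (hU : IsPropagator H U)
    (hW : ∀ t, W t = star (Q T H n t) * U t) :
    ∀ᵐ t, HasDerivAt W ((-Complex.I) • (Hprime T H n t * W t)) t := by
  filter_upwards [hU.ae_hasDerivAt, ae_mem_goodTimes hT hH n] with t h1 h2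
  have hQ := differentiableAt_Q h2
  have h3 := hQ.hasDerivAt.star.mul h1
  have e : star (deriv (Q T H n) t) =
      -(star (Q T H n t) * deriv (Q T H n) t) * star (Q T H n t) := by
    rw [← star_deriv_Q hs hQ, mul_assoc, Q_mul_star hs, mul_one]
  have e' : star (Q T H n t) * H t * Q T H n t * (star (Q T H n t) * U t) =
      star (Q T H n t) * (H t * U t) := by
    rw [← mul_assoc (star (Q T H n t) * H t * Q T H n t), mul_assoc _ (Q T H n t),
      Q_mul_star hs, mul_one, mul_assoc]
  rw [show W = fun t => star (Q T H n t) * U t from funext hW]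
  refine h3.congr_deriv ?_
  rw [e, Hprime, sub_mul, e', smul_sub, smul_mul_assoc, smul_smul, mul_smul_comm]
  simp only [neg_mul, Complex.I_mul_I, neg_neg, one_smul, mul_assoc, neg_smul]
  abel

/-- The rotated evolution solves the integrated evolution equation of `H'`, since it does so for
the derivatives almost everywhere. -/
theorem isPropagator_rotated (hT : 0 < T) (hH : H ∈ regularSubmodule d T)
    (hs : ∀ t, star (H t) = H t) (hU : IsPropagator H U)
    (hW : ∀ t, W t = star (Q T H n t) * U t) : IsPropagator (Hprime T H n) W := by
  have hL := locallyLipschitz_rotated hT hH hU hW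
  obtain ⟨-, hm, C, hC⟩ := Hprime_mem hT hH hs n
  have hC0 : 0 ≤ C := (norm_nonneg _).trans (hC 0)
  have hb : ∀ t, ‖Hprime T H n t * W t‖ ≤ C := fun t => by
    calc _ ≤ ‖Hprime T H n t‖ * ‖W t‖ := norm_mul_le _ _
      _ ≤ C * 1 := by
        gcongr
        · exact hC t
        · exact norm_le_one_of_star_mul_self (star_mul_rotated hH hs hU hW t)
      _ = C := mul_one C
  have hm' : AEStronglyMeasurable (fun t => Hprime T H n t * W t) volume :=
    hm.mul hL.continuous.aestronglyMeasurable
  have hint : ∀ a b, IntervalIntegrable (fun t => Hprime T H n t * W t) volume a b :=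
    fun a b => by
      rw [intervalIntegrable_iff]
      have : IsFiniteMeasure (volume.restrict (Set.uIoc a b)) := by
        rw [Set.uIoc]
        infer_instance
      exact Integrable.of_bound hm'.restrict C (Filter.Eventually.of_forall hb)
  have hloc : LocallyIntegrable (fun t => Hprime T H n t * W t) volume := fun x =>
    ⟨Set.Ioc (x - 1) (x + 1), Ioc_mem_nhds (by linarith) (by linarith),
      (intervalIntegrable_iff_integrableOn_Ioc_of_le (by linarith)).mp (hint _ _)⟩
  refine ⟨hL.continuous, fun t => ⟨hint 0 t, ?_⟩⟩
  have hP := locallyLipschitz_primitive hint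
    fun x => ⟨C, Filter.Eventually.of_forall hb⟩
  have hLf : LocallyLipschitz fun t =>
      W t + Complex.I • ∫ s in (0 : ℝ)..t, Hprime T H n s * W s :=
    hL.add ((lipschitzWith_smul Complex.I).locallyLipschitz.comp hP)
  have h := eq_of_locallyLipschitz hLf (by
    filter_upwards [ae_hasDerivAt_rotated hT hH hs hU hW,
      LocallyIntegrable.ae_hasDerivAt_integral hloc] with t h1 h2
    refine (h1.add ((h2 0).const_smul Complex.I)).congr_deriv ?_
    simp) t 0
  rw [intervalIntegral.integral_same, smul_zero, add_zero, hW 0, Q_at_zero, hU.zero, star_one,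
    one_mul] at h
  exact eq_sub_of_add_eq h

end Frame

end Evolution

/-! ### Bounds at the optimal order -/

section Bounds

variable {N : ℕ} {d : Fin N → ℕ} {R n : ℕ} {h T : ℝ}

theorem DrivenChain.deltaH_zero (E : DrivenChain d R h T) (t : ℝ) :
    E.deltaH 0 t = ∑ i, E.drv i t := by
  have hQ : Q T E.H 0 = fun _ => 1 := funext fun s => by simp [Q]
  have hV : ∑ i, E.drv i t = E.V t := rfl
  simp [hV, DrivenChain.deltaH, Hprime, hQ, DrivenChain.Hstar, DrivenChain.H]

/-- For `n = 0` the remaining drive is the whole drive, of range `R`. -/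
theorem DrivenChain.deltaH_hasIntervalBound (E : DrivenChain d R h T) (hh : 0 ≤ h) (hT : 0 < T)
    (hR : 1 ≤ R) {κ r₀ r : ℝ} (hκ : 0 ≤ κ) (hr₀ : 0 ≤ r₀) (hr : r₀ + 1 + R * κ ≤ r)
    (hsmall : 32 * R * n * T * Real.exp r * h ≤ 1 / 6) {t : ℝ} (ht : t ∈ goodTimes T E.H n) :
    HasIntervalBound κ (E.deltaH n t)
      (R * Real.exp (κ * R) * Real.exp (-r₀ * n) * (12 * h)) := by
  rcases Nat.eq_zero_or_pos n with rfl | hn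
  · rw [E.deltaH_zero]
    refine (HasIntervalBound.of_local hκ hR (fun i => E.drv_supp i t)
      fun i => E.norm_drv_le i t).mono ?_
    rw [Nat.cast_zero, mul_zero, Real.exp_zero, mul_one]
    gcongr
    linarith
  · exact E.deltaH_hasIntervalBound_of_one_le hh hT hR hκ hr₀ hr hn hsmall ht

/-- The averaged operators are sums of local terms, of summable weighted norms. -/
theorem DrivenChain.exists_isLocalSum_Hbar (E : DrivenChain d R h T) (hh : 0 ≤ h) (hT : 0 < T)
    {z : ℝ} (hz : 0 < z) (hsmall : 32 * R * n * T * z * h ≤ 1 / 6) :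
    ∃ (B : ℕ → Fin N → Op d) (γ : ℕ → ℝ),
      (∀ q, IsLocalSum (R * (q + 1)) (Hbar T E.H q) (B q)) ∧ (∀ q i, ‖B q i‖ ≤ γ q) ∧
      (∀ q, 0 ≤ γ q) ∧ ∑ q ∈ Finset.range (n + 1), z ^ q * γ q ≤ 4 * h := by
  obtain ⟨γ, h0, hrec, hγ⟩ := exists_majorant R hh hT.le
  obtain ⟨g, hg⟩ := E.exists_isLocalRep hT h0 hrec hγ
  exact ⟨fun q i => timeAvg T fun s => g q s i, γ,
    fun q => ⟨(hg q).supportedOn_timeAvg, ((hg q).sum_timeAvg hT).symm⟩,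
    fun q i => (hg q).norm_timeAvg_le hT (hγ q) i, hγ,
    sum_majorant_le hh hT.le hz hγ h0 hrec hsmall⟩

theorem DrivenChain.isHermitian_Hstar (E : DrivenChain d R h T) (n : ℕ) :
    (E.Hstar n).IsHermitian := by
  have hs : star (E.Hstar n) = E.Hstar n := by
    rw [DrivenChain.Hstar, star_add, star_sum]
    congr 1
    · exact E.stat_herm
    · exact Finset.sum_congr rfl fun q _ => star_timeAvg (star_opG E.star_H q)
  exact hs

theorem norm_le_localNorm (B : Fin N → Op d) (i : Fin N) : ‖B i‖ ≤ localNorm B :=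
  le_ciSup (f := fun i => ‖B i‖) (Set.finite_range _).bddAbove i

theorem DrivenChain.norm_Hstar_sub_le (E : DrivenChain d R h T) {B : ℕ → Fin N → Op d}
    (hB : ∀ q ∈ Finset.Ico 1 n, IsLocalSum (R * (q + 1)) (Hbar T E.H q) (B q)) :
    ‖E.Hstar n - E.H0‖ ≤ N * ∑ q ∈ Finset.Ico 1 n, localNorm (B q) := by
  rw [DrivenChain.Hstar, add_sub_cancel_left, Finset.mul_sum]
  refine norm_sum_le_of_le _ fun q hq => ?_
  rw [(hB q hq).2]
  refine (norm_sum_le_of_le _ fun i _ => norm_le_localNorm (B q) i).trans ?_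
  simp

/-- The effective Hamiltonian has an extensive commutator with every operator that has an interval
decomposition. -/
theorem DrivenChain.norm_lie_Hstar_le (E : DrivenChain d R h T) (hh : 0 ≤ h) (hT : 0 < T)
    (hR : 1 ≤ R) {κ r c : ℝ} (hκ : 0 ≤ κ) (hr : 1 ≤ r) (hc : 0 ≤ c)
    (hsmall : 32 * R * n * T * Real.exp r * h ≤ 1 / 6) {A : Op d}
    (hA : HasIntervalBound κ A c) : ‖⁅A, E.Hstar n⁆‖ ≤ N * (c * (16 * R * h)) := by
  obtain ⟨B, γ, hB, hbd, hγ, hsum⟩ := E.exists_isLocalSum_Hbar hh hT (Real.exp_pos r) hsmall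
  have hH : E.Hstar n = ∑ q ∈ Finset.range (max n 1), Hbar T E.H q := by
    rcases Nat.eq_zero_or_pos n with rfl | hn
    · simp [DrivenChain.Hstar, E.Hbar_zero hT]
    · rw [E.Hstar_eq_sum hT hn, max_eq_left hn]
  have hone : ∀ q, ‖⁅A, Hbar T E.H q⁆‖ ≤ N * (c * (4 * R)) * (Real.exp r ^ q * γ q) := by
    intro q
    rw [(hB q).2]
    refine (hA.norm_lie_le hκ (Nat.mul_pos hR (Nat.succ_pos q)) (hγ q) (hB q).1
      (hbd q)).trans ?_
    have h1 : (q : ℝ) + 1 ≤ Real.exp r ^ q := by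
      rw [← Real.exp_nat_mul]
      refine (Real.add_one_le_exp (q : ℝ)).trans (Real.exp_le_exp.mpr ?_)
      exact le_mul_of_one_le_right (Nat.cast_nonneg q) hr
    have := hγ q
    calc _ = N * (c * (4 * R)) * (((q : ℝ) + 1) * γ q) := by push_cast; ring
      _ ≤ _ := by gcongr
  rw [hH, lie_finset_sum]
  calc _ ≤ ∑ q ∈ Finset.range (max n 1), N * (c * (4 * R)) * (Real.exp r ^ q * γ q) :=
        norm_sum_le_of_le _ fun q _ => hone q
    _ = N * (c * (4 * R)) * ∑ q ∈ Finset.range (max n 1), Real.exp r ^ q * γ q := by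
        rw [Finset.mul_sum]
    _ ≤ N * (c * (4 * R)) * (4 * h) := by
        gcongr
        refine (Finset.sum_le_sum_of_subset_of_nonneg
          (Finset.range_subset_range.mpr (by omega)) fun q _ _ => ?_).trans hsum
        exact mul_nonneg (by positivity) (hγ q)
    _ = _ := by ring

theorem sum_localNorm_le {z : ℝ} (hz : 1 ≤ z) {B : ℕ → Fin N → Op d} {γ : ℕ → ℝ}
    (hbd : ∀ q i, ‖B q i‖ ≤ γ q) (hγ : ∀ q, 0 ≤ γ q) {b : ℝ}
    (hsum : ∑ q ∈ Finset.range (n + 1), z ^ q * γ q ≤ b) :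
    ∑ q ∈ Finset.Ico 1 n, localNorm (B q) ≤ b := by
  calc _ ≤ ∑ q ∈ Finset.Ico 1 n, z ^ q * γ q := Finset.sum_le_sum fun q _ =>
        (Real.iSup_le (hbd q) (hγ q)).trans
          (le_mul_of_one_le_left (hγ q) (one_le_pow₀ hz))
    _ ≤ ∑ q ∈ Finset.range (n + 1), z ^ q * γ q :=
        Finset.sum_le_sum_of_subset_of_nonneg (fun q hq => by
          rw [Finset.mem_Ico] at hq
          exact Finset.mem_range.mpr (by omega)) fun q _ _ => mul_nonneg (by positivity) (hγ q)
    _ ≤ b := hsum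

end Bounds

section Order

variable {R : ℕ} {h T r : ℝ}

/-- The order `n_*` is small enough for the majorant estimates with the weight `z = e^r`. -/
theorem nStar_small (hR : 1 ≤ R) (hh : 0 < h) (hT : 0 < T) :
    32 * R * (nStar 192 r R h T : ℝ) * T * Real.exp r * h ≤ 1 / 6 := by
  have hR0 : (0 : ℝ) < R := by exact_mod_cast hR
  have hn : (nStar 192 r R h T : ℝ) ≤ Real.exp (-r) / (192 * Real.exp 1 * R * h * T) :=
    Nat.floor_le (by positivity)
  have he : (1 : ℝ) ≤ Real.exp 1 := Real.one_le_exp zero_le_one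
  calc _ ≤ 32 * R * (Real.exp (-r) / (192 * Real.exp 1 * R * h * T)) * T * Real.exp r * h := by
        gcongr
    _ = 1 / (6 * Real.exp 1) := by
        rw [Real.exp_neg]
        field_simp
        norm_num
    _ ≤ 1 / 6 := by
        apply one_div_le_one_div_of_le (by norm_num)
        linarith

/-- The order `n_*` exceeds a multiple of `ω / h`, up to rounding. -/
theorem exp_neg_mul_nStar_le (hR : 1 ≤ R) (hh : 0 < h) (hT : 0 < T) {r₀ : ℝ} (hr₀ : 0 ≤ r₀) :
    Real.exp (-r₀ * (nStar 192 r R h T : ℝ)) ≤ Real.exp r₀ * Real.exp (-(2 *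
      (r₀ * Real.exp (-r) / (192 * Real.exp 1 * R * (4 * Real.pi)) *
        ((2 * Real.pi / T) / h)))) := by
  have hR0 : (0 : ℝ) < R := by exact_mod_cast hR
  have hn : Real.exp (-r) / (192 * Real.exp 1 * R * h * T) < (nStar 192 r R h T : ℝ) + 1 :=
    Nat.lt_floor_add_one _
  rw [← Real.exp_add, Real.exp_le_exp]
  have e : 2 * (r₀ * Real.exp (-r) / (192 * Real.exp 1 * R * (4 * Real.pi)) *
      ((2 * Real.pi / T) / h)) = r₀ * (Real.exp (-r) / (192 * Real.exp 1 * R * h * T)) := by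
    have := Real.pi_pos
    field_simp
    ring
  rw [e]
  have := mul_le_mul_of_nonneg_left hn.le hr₀
  linarith

end Order

end Floquet

end

theorem mainTheorem2 :
    ∃ C₀ C₁ : ℝ, 0 < C₀ ∧ 0 < C₁ ∧
    ∀ (R : ℕ) (κ r₀ r : ℝ), 1 ≤ R → 0 < κ → 0 < r₀ →
      r - r₀ > 1 + Real.log (C₁ * R) + R * κ →
    ∃ C c : ℝ, 0 < C ∧ 0 < c ∧
    ∀ (h T : ℝ), 0 < h → 0 < T →
    ∀ (N : ℕ) (d : Fin N → ℕ) (E : Floquet.DrivenChain d R h T) (n : ℕ),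
      n = Floquet.nStar C₀ r R h T →
      -- the frame transformation is unitary, periodic and trivial at time zero
      (∀ t, Floquet.Q T E.H n t ∈ unitary (Floquet.Op d)) ∧
      Function.Periodic (Floquet.Q T E.H n) T ∧
      Floquet.Q T E.H n 0 = 1 ∧
      -- the effective Hamiltonian is Hermitian, local, and close to the static part
      (E.Hstar n).IsHermitian ∧
      (∃ B : ℕ → Fin N → Floquet.Op d,
        (∀ q ∈ Finset.Ico 1 n,
          Floquet.IsLocalSum (R * (q + 1)) (Floquet.Hbar T E.H q) (B q)) ∧
        ‖E.Hstar n - E.H0‖ ≤ N * ∑ q ∈ Finset.Ico 1 n, Floquet.localNorm (B q) ∧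
        ∑ q ∈ Finset.Ico 1 n, Floquet.localNorm (B q) ≤ C * h) ∧
      -- the remaining drive, at almost every time and at every time of continuity of the drive
      (∃ D : Set ℝ, (∀ᵐ t, t ∈ D) ∧ (∀ t, ContinuousAt E.V t → t ∈ D) ∧
        ∀ t ∈ D, DifferentiableAt ℝ (Floquet.Q T E.H n) t ∧
          Floquet.Hprime T E.H n t = E.Hstar n + E.deltaH n t ∧
          ∃ Φ : Fin N → Fin N → Floquet.Op d,
            Floquet.IsIntervalSum (E.deltaH n t) Φ ∧
            Floquet.weightedNorm κ Φ ≤ C * h * Real.exp (-r₀ * n) ∧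
            Floquet.weightedNorm κ Φ ≤ C * h * Real.exp (-c * ((2 * Real.pi / T) / h))) ∧
      -- the evolution in the rotated frame, the absorption rate and the heating time
      (∀ U : ℝ → Floquet.Op d, Floquet.IsPropagator E.H U →
        ∀ W : ℝ → Floquet.Op d, (∀ t, W t = star (Floquet.Q T E.H n t) * U t) →
          Floquet.IsPropagator (Floquet.Hprime T E.H n) W ∧
          (∀ s t, s ≤ t →
            ‖star (W t) * E.Hstar n * W t - star (W s) * E.Hstar n * W s‖
              ≤ N * (C * h ^ 2 * Real.exp (-r₀ * n) * (t - s))) ∧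
          (∀ t, 0 ≤ t → t ≤ Real.exp (c * ((2 * Real.pi / T) / h)) / h →
            ‖star (W t) * E.Hstar n * W t - E.Hstar n‖
              ≤ N * (C * h * Real.exp (-c * ((2 * Real.pi / T) / h))))) := by
  refine ⟨192, 1, by norm_num, one_pos, fun R κ r₀ r hR hκ hr₀ hr => ?_⟩
  have hR1 : (1 : ℝ) ≤ R := by exact_mod_cast hR
  have hR0 : (0 : ℝ) < R := by linarith
  have hr' : r₀ + 1 + R * κ ≤ r := by
    have := Real.log_nonneg (x := 1 * (R : ℝ)) (by linarith)
    linarith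
  have hr1 : 1 ≤ r := by
    have := mul_pos hR0 hκ
    linarith
  -- `K` is the constant of the absorption rate; it exceeds that of the interval decomposition.
  -- The exponent `c` is half of what `n_*` gives: the other half pays for times up to `τ_*`.
  set K : ℝ := 192 * R ^ 2 * Real.exp (κ * R) with hK
  have hK0 : 0 < K := by positivity
  have hKe : K ≤ 4 + K * Real.exp r₀ := by
    have := le_mul_of_one_le_right hK0.le (Real.one_le_exp hr₀.le)
    linarith
  have hKe' : K * Real.exp r₀ ≤ 4 + K * Real.exp r₀ := by linarith
  have hK12 : 12 * R * Real.exp (κ * R) ≤ K := by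
    rw [hK]
    have : 12 * (R : ℝ) ≤ 192 * R ^ 2 := by nlinarith
    gcongr
  refine ⟨4 + K * Real.exp r₀, r₀ * Real.exp (-r) / (192 * Real.exp 1 * R * (4 * Real.pi)),
    by positivity, by have := Real.pi_pos; positivity, fun h T hh hT N d E n hn => ?_⟩
  have hsmall : 32 * R * n * T * Real.exp r * h ≤ 1 / 6 := hn ▸ Floquet.nStar_small hR hh hT
  have hdecay : Real.exp (-r₀ * n) ≤ _ :=
    hn ▸ Floquet.exp_neg_mul_nStar_le (r := r) hR hh hT hr₀.le
  rw [neg_mul (r₀ * Real.exp (-r) / _)]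
  set y : ℝ := r₀ * Real.exp (-r) / (192 * Real.exp 1 * R * (4 * Real.pi)) *
    ((2 * Real.pi / T) / h) with hy
  have hy0 : 0 ≤ y := by
    have := Real.pi_pos
    positivity
  have hdecay' : Real.exp (-r₀ * n) ≤ Real.exp r₀ * Real.exp (-y) :=
    hdecay.trans (by gcongr; linarith)
  clear_value K y
  have hstar := E.star_H
  have hmem := E.H_mem
  have hδ : ∀ t ∈ Floquet.goodTimes T E.H n, Floquet.HasIntervalBound κ (E.deltaH n t)
      (12 * R * Real.exp (κ * R) * (h * Real.exp (-r₀ * n))) := fun t ht =>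
    (E.deltaH_hasIntervalBound hh.le hT hR hκ.le hr₀.le hr' hsmall ht).mono
      (le_of_eq (by ring))
  refine ⟨Floquet.Q_mem_unitary hstar n, Floquet.Q_periodic hT hmem n, Floquet.Q_at_zero n,
    E.isHermitian_Hstar n, ?_, ?_, ?_⟩
  · obtain ⟨B, γ, hB, hbd, hγ, hsum⟩ :=
      E.exists_isLocalSum_Hbar hh.le hT (Real.exp_pos r) hsmall
    refine ⟨B, fun q _ => hB q, E.norm_Hstar_sub_le fun q _ => hB q,
      (Floquet.sum_localNorm_le (Real.one_le_exp (by linarith)) hbd hγ hsum).trans ?_⟩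
    have : 0 ≤ K * Real.exp r₀ * h := by positivity
    linarith
  · refine ⟨Floquet.goodTimes T E.H n, Floquet.ae_mem_goodTimes hT hmem n, fun t ht =>
      Floquet.mem_goodTimes_of_continuousAt hT hmem n (continuousAt_const.add ht), fun t ht =>
      ⟨Floquet.differentiableAt_Q ht, (add_sub_cancel _ _).symm, ?_⟩⟩
    obtain ⟨Φ, h1, h2⟩ := (hδ t ht).exists_weightedNorm_le (by positivity)
    refine ⟨Φ, h1, h2.trans ?_, h2.trans ?_⟩
    · rw [mul_assoc _ h]
      have := hK12.trans hKe
      gcongr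
    · calc _ ≤ K * (h * (Real.exp r₀ * Real.exp (-y))) := by gcongr
        _ = K * Real.exp r₀ * (h * Real.exp (-y)) := by ring
        _ ≤ (4 + K * Real.exp r₀) * (h * Real.exp (-y)) := by gcongr
        _ = _ := by ring
  · intro U hU W hW
    have hrate : ∀ s t, s ≤ t →
        ‖star (W t) * E.Hstar n * W t - star (W s) * E.Hstar n * W s‖ ≤
          N * (K * h ^ 2 * Real.exp (-r₀ * n)) * (t - s) := fun s t hst => by
      refine Floquet.norm_conj_sub_le (H' := Floquet.Hprime T E.H n)
        (Floquet.locallyLipschitz_rotated hT hmem hU hW)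
        (Floquet.star_mul_rotated hmem hstar hU hW) ?_ hst
      filter_upwards [Floquet.ae_hasDerivAt_rotated hT hmem hstar hU hW,
        Floquet.ae_mem_goodTimes hT hmem n] with u h1 h2
      refine ⟨h1, Floquet.star_Hprime hstar (Floquet.differentiableAt_Q h2), ?_⟩
      have e : ⁅Floquet.Hprime T E.H n u, E.Hstar n⁆ = ⁅E.deltaH n u, E.Hstar n⁆ := by
        simp only [Floquet.DrivenChain.deltaH, Ring.lie_def]
        noncomm_ring
      rw [e]
      refine (E.norm_lie_Hstar_le hh.le hT hR hκ.le hr1 (by positivity) hsmall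
        (hδ u h2)).trans (le_of_eq ?_)
      rw [hK]
      ring
    refine ⟨Floquet.isPropagator_rotated hT hmem hstar hU hW, fun s t hst => ?_,
      fun t ht0 ht => ?_⟩
    · refine (hrate s t hst).trans ?_
      have := sub_nonneg.mpr hst
      rw [mul_assoc (N : ℝ)]
      gcongr
    · have hW0 : W 0 = 1 := by
        rw [hW, Floquet.Q_at_zero, hU.zero, star_one, one_mul]
      have h1 := hrate 0 t ht0
      rw [hW0, star_one, one_mul, mul_one, sub_zero] at h1
      refine h1.trans ?_
      rw [mul_assoc (N : ℝ)]
      refine mul_le_mul_of_nonneg_left ?_ (Nat.cast_nonneg N)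
      calc _ ≤ K * h ^ 2 * (Real.exp r₀ * Real.exp (-(2 * y))) * (Real.exp y / h) := by gcongr
        _ = K * Real.exp r₀ * h * (Real.exp (-(2 * y)) * Real.exp y) := by field_simp
        _ = K * Real.exp r₀ * h * Real.exp (-y) := by
            rw [← Real.exp_add]
            congr 2
            ring
        _ ≤ _ := by gcongr
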